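/- Let $\mathfrak g=\mathfrak{sl}_3(\mathbb C)$ with simple roots $\alpha_1,\alpha_2$, $\theta=\alpha_1+\alpha_2$, $R^+=\{\alpha_1,\alpha_2,\theta\}$, root vectors $x_\alpha^\pm$ with $x_\theta^\pm=\pm[x_{\alpha_1}^\pm,x_{\alpha_2}^\pm]$, coroots $h_\alpha=[x_\alpha^+,x_\alpha^-]$, and let $\mathfrak g[t]=\mathfrak g\otimes\mathbb C[t]$. Write $y^{(s)}=y^s/s!$, and $\mathbf U=\mathbf U(\mathfrak g[t])$, graded by powers of $t$. For $\nu\in P^+=\mathbb Z_{\ge0}\omega_1+\mathbb Z_{\ge 0}\omega_2$ let $V(\nu)$ be the irreducible $\mathfrak g$-module of highest weight $\nu$, also regarded as a $\mathfrak g[t]$-module through evaluation at $t=0$, and let $\tau_m^*$ be the shift of the grading by $m$. For $\lambda=\lambda_1\omega_1+\lambda_2\omega_2$ and $\mu=\mu_1\omega_1+\mu_2\omega_2$ in $P^+$ put $|\mu|=\mu_1+\mu_2$, and let $\mathcal F_{\lambda,\mu}$ be the cyclic graded $\mathfrak g[t]$-module with generator $v_{\lambda,\mu}$ of degree $0$ and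 relations (for $\alpha\in R^+$, $i=1,2$, $s\ge0$) $$(x_\alpha^+\otimes t^s)v_{\lambda,\mu}=0,\quad (h_{\alpha_i}\otimes t^s)v_{\lambda,\mu}=\delta_{s,0}(\lambda+\mu)(h_{\alpha_i})v_{\lambda,\mu},\quad (x_{\alpha_i}^-\otimes1)^{(\lambda+\mu)(h_{\alpha_i})+1}v_{\lambda,\mu}=0,$$ and $(x_\alpha^+\otimes t)^{(s)}(x_\alpha^-\otimes1)^{(r+s)}v_{\lambda,\mu}=0$ for all $\alpha\in R^+$ and integers $r,s\ge1$ such that for some integer $k\ge1$ one has $r+s\ge1+rk+\sum_{j\ge k+1}\xi^\alpha_j$, where $\xi^\alpha$ is the partition $(\max(\lambda(h_\alpha),\mu(h_\alpha)),\min(\lambda(h_\alpha),\mu(h_\alpha)))$. The pair $(\lambda,\mu)$ is of *first kind* if $|\lambda|\ge|\mu|$, $\lambda_1\ge\mu_1$, $\lambda_2\ge\mu_2$, and of *second kind* if $|\lambda|\ge|\mu|$, $\lambda_1\ge\mu_1$, $\mu_2>\lambda_2$. Let $\mathcal F^+_{\lambda,\mu}$ be $\mathcal F_{\lambda+\omega_2,\mu-\omega_2}$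 if $\lambda_2\ge\mu_2>0$, $\mathcal F_{\lambda+\omega_1,\mu-\omega_1}$ if $\mu_2=0<\mu_1$, and $\mathcal F_{\lambda+(\mu_2-\lambda_2)\omega_2,\mu-(\mu_2-\lambda_2)\omega_2}$ if $\lambda_2<\mu_2$. Put $$w(a_1,b,a_2)=(x_{\alpha_1}^-\otimes t)^{(a_1)}(x_\theta^-\otimes t)^{(b)}(x_{\alpha_2}^-\otimes t)^{(a_2)}v_{\lambda,\mu}.$$ In each of the cases (i)–(iii) below there is a surjective $\mathfrak g[t]$-homomorphism $\phi(\lambda,\mu):\mathcal F_{\lambda,\mu}\to\mathcal F^+_{\lambda,\mu}$ that sends generator to generator, and the submodules listed form a decreasing filtration of $\operatorname{Ker}\phi(\lambda,\mu)$, the first of them being $\operatorname{Ker}\phi(\lambda,\mu)$ itself. Moreover: (i) Let $(\lambda,\mu)$ be of first kind with $\mu_1=0<\mu_2$. For $\max\{0,\mu_2-\lambda_1\}\le j\le\mu_2$ let $V_j=\mathbf U\,w(0,\mu_2-j,j)+\mathbf U\,w(0,0,\mu_2)$, and $V_{\mu_2+1}=0$. For each such $j$ the surjective graded homomorphism $\phi_j:\tau^*_{\mu_2}V(\lambda-(\mu_2-2j)\omega_1-j\omega_2)\to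 V_j/V_{j+1}$ that sends the highest weight generator to the class of $w(0,\mu_2-j,j)$ exists and is an isomorphism. Symmetrically, if $(\lambda,\mu)$ is of first kind with $\mu_2=0<\mu_1$, then for $\max\{0,\mu_1-\lambda_2\}\le j\le\mu_1$, with $V_j=\mathbf U\,w(j,\mu_1-j,0)+\mathbf U\,w(\mu_1,0,0)$ and $V_{\mu_1+1}=0$, the homomorphism $\tau^*_{\mu_1}V(\lambda-j\omega_1-(\mu_1-2j)\omega_2)\to V_j/V_{j+1}$ that sends the highest weight generator to the class of $w(j,\mu_1-j,0)$ exists and is a graded isomorphism. (ii) Let $(\lambda,\mu)$ be of first kind with $\mu_1,\mu_2>0$. Let $$\mathbb S=\{(a_1,a_2)\in\mathbb Z^2:0\le a_2<\mu_2,\ 0\le a_1\le\mu_1,\ \mu_2-\lambda_1\le a_2-a_1\le\lambda_2-\mu_1\},$$ $\mathbb S[j]=\{(a_1,a_2)\in\mathbb S:a_1+a_2=j\}$, and for $0\le j\le|\mu|$ $$V_j=\sum_{(a_1,a_2)\in\mathbb S,\ a_1+a_2\ge j}\mathbf U\,w(a_1,|\mu|-a_1-a_2,a_2)+\mathbf U\,w(0,0,\mu_2).$$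 For $0\le j<|\mu|$ the homomorphism $$\phi_j:\bigoplus_{(a_1,a_2)\in\mathbb S[j]}\tau^*_{|\mu|}V(\lambda-(\mu_2+a_1-2a_2)\omega_1-(\mu_1+a_2-2a_1)\omega_2)\to V_j/V_{j+1}$$ that sends the highest weight generator of the summand of $(a_1,a_2)$ to the class of $w(a_1,|\mu|-j,a_2)$ exists and is a graded isomorphism, and so is the homomorphism $\phi_{|\mu|}:\tau^*_{\mu_2}\mathcal F_{\lambda+\mu_2(\omega_1-\omega_2),\mu_1\omega_1}\to V_{|\mu|}$ that sends the generator to $w(0,0,\mu_2)$. (iii) Let $(\lambda,\mu)$ be of second kind, and $N=\mu_1+\lambda_2$. For $1\le\ell\le\mu_2-\lambda_2$ let $$\mathbb S_\ell=\{(a_1,a_2)\in\mathbb Z^2:0\le a_1\le\mu_1,\ 0\le a_2\le\lambda_2,\ \mu_1-\mu_2+\ell\le a_1-a_2\le\lambda_1-\lambda_2-\ell\},$$ $\mathbb S_\ell[j]=\{(a_1,a_2)\in\mathbb S_\ell:a_1+a_2=j\}$, $V_{\ell,0}=\mathbf U\,w(0,N+\ell,0)$ and, for $1\le j\le N$, $$V_{\ell,j}=\sum_{(a_1,a_2)\in\mathbb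 S_\ell,\ a_1+a_2\ge j}\mathbf U\,w(a_1,N+\ell-a_1-a_2,a_2)+\mathbf U\,w(0,N+\ell+1,0).$$ The filtration is $V_{1,0}\supseteq V_{1,1}\supseteq\dots\supseteq V_{1,N}\supseteq V_{2,0}\supseteq\dots\supseteq V_{\mu_2-\lambda_2,N}\supseteq0$. For $1\le\ell\le\mu_2-\lambda_2$ and $0\le j\le N$, let $V_{\ell,j}'$ be the term right after $V_{\ell,j}$. The homomorphism $$\phi_{\ell,j}:\bigoplus_{(a_1,a_2)\in\mathbb S_\ell[j]}\tau^*_{N+\ell}V\bigl((\lambda_1-\lambda_2-a_1+2a_2-\ell)\omega_1+(\mu_2-\mu_1-a_2+2a_1-\ell)\omega_2\bigr)\to V_{\ell,j}/V_{\ell,j}'$$ that sends the highest weight generator of the summand of $(a_1,a_2)$ to the class of $w(a_1,N+\ell-j,a_2)$ exists and is a graded isomorphism. Consequently, for all $\lambda,\mu\in P^+$, the module $\mathcal F_{\lambda,\mu}$ is finite-dimensional and $\dim\mathcal F_{\lambda,\mu}=\dim V(\lambda)\cdot\dim V(\mu)$. -/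

import Mathlib

open scoped TensorProduct DirectSum Polynomial

namespace SL3Current

noncomputable section

/-! ### Weights and roots of `sl₃` -/

/-- Dominant integral weights: `(a, b)` stands for `a ω₁ + b ω₂`. -/
abbrev Wt : Type := ℕ × ℕ

/-- The positive roots `α₁`, `α₂`, `θ = α₁ + α₂`. -/
inductive PosRoot : Type
  | al1 : PosRoot
  | al2 : PosRoot
  | th : PosRoot

/-- The value `ν(h_α)`. -/
def Wt.eval (ν : Wt) : PosRoot → ℕ
  | .al1 => ν.1
  | .al2 => ν.2
  | .th => ν.1 + ν.2

/-- `|ν| = ν₁ + ν₂`. -/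
def Wt.size (ν : Wt) : ℕ := ν.1 + ν.2

/-- The weight `a ω₁ + b ω₂` for integers `a, b`; it is only ever used for `a, b ≥ 0`. -/
def dom (a b : ℤ) : Wt := (a.toNat, b.toNat)

/-- `(λ, μ)` is a partition of `λ + μ` of first kind. -/
def IsFirstKind (lam mu : Wt) : Prop :=
  mu.size ≤ lam.size ∧ mu.1 ≤ lam.1 ∧ mu.2 ≤ lam.2

/-- `(λ, μ)` is a partition of `λ + μ` of second kind. -/
def IsSecondKind (lam mu : Wt) : Prop :=
  mu.size ≤ lam.size ∧ mu.1 ≤ lam.1 ∧ lam.2 < mu.2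

/-! ### The Lie algebra, its current algebra and their enveloping algebras -/

/-- `sl₃(ℂ)`. -/
abbrev Sl3 : Type := LieAlgebra.SpecialLinear.sl (Fin 3) ℂ

/-- The current algebra `sl₃[t] = ℂ[t] ⊗ sl₃`. -/
abbrev Cur : Type := ℂ[X] ⊗[ℂ] Sl3

/-- The enveloping algebra of `sl₃`. -/
abbrev USl3 : Type := UniversalEnvelopingAlgebra ℂ Sl3

/-- The enveloping algebra of `sl₃[t]`; an `sl₃[t]`-module is a module over it. -/
abbrev UCur : Type := UniversalEnvelopingAlgebra ℂ Cur

/-- The root vectors `x_α⁺`. -/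
def xp : PosRoot → Sl3
  | .al1 => LieAlgebra.SpecialLinear.single (0 : Fin 3) 1 (by decide) (1 : ℂ)
  | .al2 => LieAlgebra.SpecialLinear.single (1 : Fin 3) 2 (by decide) (1 : ℂ)
  | .th => LieAlgebra.SpecialLinear.single (0 : Fin 3) 2 (by decide) (1 : ℂ)

/-- The root vectors `x_α⁻`. -/
def xm : PosRoot → Sl3
  | .al1 => LieAlgebra.SpecialLinear.single (1 : Fin 3) 0 (by decide) (1 : ℂ)
  | .al2 => LieAlgebra.SpecialLinear.single (2 : Fin 3) 1 (by decide) (1 : ℂ)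
  | .th => LieAlgebra.SpecialLinear.single (2 : Fin 3) 0 (by decide) (1 : ℂ)

/-- The coroots `h_α = [x_α⁺, x_α⁻]`. -/
def hh (α : PosRoot) : Sl3 := ⁅xp α, xm α⁆

/-- The element `x` of `sl₃`, in the enveloping algebra of `sl₃`. -/
def inU (x : Sl3) : USl3 := UniversalEnvelopingAlgebra.ι ℂ x

/-- The element `x ⊗ tˢ`, in the enveloping algebra of `sl₃[t]`. -/
def tpow (x : Sl3) (s : ℕ) : UCur :=
  UniversalEnvelopingAlgebra.ι ℂ (((Polynomial.X : ℂ[X]) ^ s) ⊗ₜ[ℂ] x)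

/-- The divided power `y^(s) = yˢ / s!`. -/
def divPow (y : UCur) (s : ℕ) : UCur := ((s.factorial : ℂ)⁻¹) • y ^ s

/-- `U(sl₃[t])[s]`, spanned by the products `(x₁ ⊗ t^r₁) ⋯ (x_p ⊗ t^r_p)` with
`r₁ + ⋯ + r_p = s`. -/
def gradeU (s : ℕ) : Submodule ℂ UCur :=
  Submodule.span ℂ {u | ∃ l : List (Sl3 × ℕ),
    (l.map Prod.snd).sum = s ∧ u = (l.map fun p => tpow p.1 p.2).prod}

/-- The homomorphism `sl₃[t] → sl₃`, `f ⊗ x ↦ f(0) x`. -/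
def evZero : Cur →ₗ⁅ℂ⁆ Sl3 :=
  { (TensorProduct.lid ℂ Sl3).toLinearMap ∘ₗ
      TensorProduct.map (Polynomial.aeval (0 : ℂ)).toLinearMap LinearMap.id with
    map_lie' := by
      intro x y
      induction x using TensorProduct.induction_on with
      | zero => simp
      | add a b ha hb => simp_all [add_lie]
      | tmul f a =>
        induction y using TensorProduct.induction_on with
        | zero => simp
        | add c d hc hd => simp_all [lie_add]
        | tmul g b =>
          simp [LieAlgebra.ExtendScalars.bracket_tmul, smul_smul, mul_comm] }

theorem evZero_tmul (f : ℂ[X]) (x : Sl3) : evZero (f ⊗ₜ[ℂ] x) = f.eval 0 • x := by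
  change (TensorProduct.lid ℂ Sl3) (TensorProduct.map (Polynomial.aeval (0 : ℂ)).toLinearMap
    LinearMap.id (f ⊗ₜ[ℂ] x)) = _
  simp [Polynomial.aeval_def, Polynomial.eval₂_eq_eval_map]

section

attribute [local instance 100] LieRing.ofAssociativeRing

/-- The algebra homomorphism `U(sl₃[t]) → U(sl₃)` induced by evaluation at `t = 0`. -/
def evZeroU : UCur →ₐ[ℂ] USl3 :=
  UniversalEnvelopingAlgebra.lift ℂ ((UniversalEnvelopingAlgebra.ι ℂ).comp evZero)

theorem evZeroU_ι (y : Cur) :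
    evZeroU (UniversalEnvelopingAlgebra.ι ℂ y) = inU (evZero y) := by
  simp [evZeroU, inU]

end

/-! ### The irreducible modules `V(ν)` -/

/-- The defining relations of `V(ν)`. -/
def irrRelations (ν : Wt) : Set USl3 :=
  {u | ∃ α, u = inU (xp α)} ∪
  {u | ∃ α, α ≠ PosRoot.th ∧ u = inU (hh α) - algebraMap ℂ USl3 (ν.eval α)} ∪
  {u | ∃ α, α ≠ PosRoot.th ∧ u = inU (xm α) ^ (ν.eval α + 1)}

/-- The irreducible `sl₃`-module `V(ν)` of highest weight `ν`: the cyclic module with the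
defining relations `irrRelations ν` on its generator. -/
abbrev V (ν : Wt) : Type := USl3 ⧸ Submodule.span USl3 (irrRelations ν)

/-- The `sl₃[t]`-module `ev₀ V(ν)`: the space `V(ν)`, on which `x ⊗ f` acts as `f(0) x`. -/
def EvV (ν : Wt) : Type := V ν

instance (ν : Wt) : AddCommGroup (EvV ν) := inferInstanceAs (AddCommGroup (V ν))

instance (ν : Wt) : Module UCur (EvV ν) := Module.compHom (V ν) evZeroU.toRingHom

/-- The highest weight generator `v_ν`. -/
def EvV.gen (ν : Wt) : EvV ν :=
  (Submodule.Quotient.mk 1 : USl3 ⧸ Submodule.span USl3 (irrRelations ν))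

/-! ### Chari-Venkatesh modules and the modules `F_{λ,μ}` -/

/-- The defining relations of the Chari-Venkatesh module `V(ξ)`, where the partitions `ξ α` of
`ν(h_α)` are given as weakly decreasing lists. -/
def cvRelations (ν : Wt) (ξ : PosRoot → List ℕ) : Set UCur :=
  {u | ∃ α s, u = tpow (xp α) s} ∪
  {u | ∃ α s, α ≠ PosRoot.th ∧
    u = tpow (hh α) s - algebraMap ℂ UCur (if s = 0 then (ν.eval α : ℂ) else 0)} ∪
  {u | ∃ α, α ≠ PosRoot.th ∧ u = tpow (xm α) 0 ^ (ν.eval α + 1)} ∪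
  {u | ∃ α, ∃ r s k : ℕ, 1 ≤ r ∧ 1 ≤ s ∧ 1 ≤ k ∧ 1 + r * k + ((ξ α).drop k).sum ≤ s + r ∧
    u = divPow (tpow (xp α) 1) s * divPow (tpow (xm α) 0) (r + s)}

/-- The Chari-Venkatesh module `V(ξ)`. -/
abbrev CV (ν : Wt) (ξ : PosRoot → List ℕ) : Type :=
  UCur ⧸ Submodule.span UCur (cvRelations ν ξ)

/-- The partitions `λ(h_α), μ(h_α)`, rearranged in weakly decreasing order. -/
def pairPartition (lam mu : Wt) (α : PosRoot) : List ℕ :=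
  [max (lam.eval α) (mu.eval α), min (lam.eval α) (mu.eval α)]

/-- The module `F_{λ,μ}`. -/
abbrev F (lam mu : Wt) : Type := CV (lam + mu) (pairPartition lam mu)

/-- The generator `v_{λ,μ}` of `F_{λ,μ}`. -/
def vF (lam mu : Wt) : F lam mu := Submodule.Quotient.mk 1

/-- The graded piece `F_{λ,μ}[r] = U(sl₃[t])[r] v_{λ,μ}`. -/
def gradeF (lam mu : Wt) (r : ℕ) : Set (F lam mu) :=
  {m | ∃ u ∈ gradeU r, m = u • vF lam mu}

/-- The pair of weights that defines `F⁺_{λ,μ}`. -/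
def plusPair (lam mu : Wt) : Wt × Wt :=
  if lam.2 < mu.2 then ((lam.1, lam.2 + (mu.2 - lam.2)), (mu.1, mu.2 - (mu.2 - lam.2)))
  else if 0 < mu.2 then ((lam.1, lam.2 + 1), (mu.1, mu.2 - 1))
  else ((lam.1 + 1, lam.2), (mu.1 - 1, mu.2))

/-- The module `F⁺_{λ,μ}`. -/
abbrev FPlus (lam mu : Wt) : Type := F (plusPair lam mu).1 (plusPair lam mu).2

/-- The generator of `F⁺_{λ,μ}`. -/
def vFPlus (lam mu : Wt) : FPlus lam mu := vF (plusPair lam mu).1 (plusPair lam mu).2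

/-- The vector `(x_{α₁}⁻ ⊗ t)^(a₁) (x_θ⁻ ⊗ t)^(b) (x_{α₂}⁻ ⊗ t)^(a₂) v_{λ,μ}`. -/
def w (lam mu : Wt) (a₁ b a₂ : ℕ) : F lam mu :=
  (divPow (tpow (xm .al1) 1) a₁ * divPow (tpow (xm .th) 1) b * divPow (tpow (xm .al2) 1) a₂) •
    vF lam mu

/-! ### The filtrations of the kernel of `F_{λ,μ} → F⁺_{λ,μ}` -/

/-- The filtration for a pair of first kind with `μ₁ = 0 < μ₂`, indexed by
`max (0, μ₂ - λ₁) ≤ j ≤ μ₂`, and zero beyond. -/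
def filtA (lam mu : Wt) (j : ℕ) : Submodule UCur (F lam mu) :=
  if j ≤ mu.2 then
    Submodule.span UCur {w lam mu 0 (mu.2 - j) j} ⊔ Submodule.span UCur {w lam mu 0 0 mu.2}
  else ⊥

/-- The filtration for a pair of first kind with `μ₂ = 0 < μ₁`, indexed by
`max (0, μ₁ - λ₂) ≤ j ≤ μ₁`, and zero beyond. -/
def filtB (lam mu : Wt) (j : ℕ) : Submodule UCur (F lam mu) :=
  if j ≤ mu.1 then
    Submodule.span UCur {w lam mu j (mu.1 - j) 0} ⊔ Submodule.span UCur {w lam mu mu.1 0 0}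
  else ⊥

/-- The index set `S_ninv(λ, μ)`. -/
def Sninv (lam mu : Wt) : Set (ℕ × ℕ) :=
  {a | a.2 < mu.2 ∧ a.1 ≤ mu.1 ∧
    (mu.2 : ℤ) - lam.1 ≤ (a.2 : ℤ) - a.1 ∧ (a.2 : ℤ) - a.1 ≤ (lam.2 : ℤ) - mu.1}

/-- The filtration for a pair of first kind with `μ₂ > 0`, indexed by `0 ≤ j ≤ |μ|`. -/
def filtNinv (lam mu : Wt) (j : ℕ) : Submodule UCur (F lam mu) :=
  Submodule.span UCur
      {x | ∃ a ∈ Sninv lam mu, j ≤ a.1 + a.2 ∧ x = w lam mu a.1 (mu.size - (a.1 + a.2)) a.2} ⊔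
    Submodule.span UCur {w lam mu 0 0 mu.2}

/-- The highest weight of the summand indexed by `a ∈ S_ninv(λ, μ)`. -/
def wtNinv (lam mu : Wt) (a : ℕ × ℕ) : Wt :=
  dom ((lam.1 : ℤ) - (mu.2 + a.1 - 2 * a.2)) ((lam.2 : ℤ) - (mu.1 + a.2 - 2 * a.1))

/-- The index set `_ℓS_inv(λ, μ)`. -/
def Sinv (lam mu : Wt) (l : ℕ) : Set (ℕ × ℕ) :=
  {a | a.1 ≤ mu.1 ∧ a.2 ≤ lam.2 ∧
    (mu.1 : ℤ) - mu.2 + l ≤ (a.1 : ℤ) - a.2 ∧ (a.1 : ℤ) - a.2 ≤ (lam.1 : ℤ) - lam.2 - l}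

/-- The filtration for a pair of second kind, indexed by `1 ≤ ℓ ≤ μ₂ - λ₂` and
`0 ≤ j ≤ μ₁ + λ₂`. -/
def filtInv (lam mu : Wt) (l j : ℕ) : Submodule UCur (F lam mu) :=
  if j = 0 then Submodule.span UCur {w lam mu 0 (mu.1 + lam.2 + l) 0}
  else
    Submodule.span UCur
        {x | ∃ a ∈ Sinv lam mu l, j ≤ a.1 + a.2 ∧
          x = w lam mu a.1 (mu.1 + lam.2 + l - (a.1 + a.2)) a.2} ⊔
      Submodule.span UCur {w lam mu 0 (mu.1 + lam.2 + l + 1) 0}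

/-- The term of the filtration for a pair of second kind that comes right after the one indexed
by `(ℓ, j)`; it is zero after the last one. -/
def filtInvNext (lam mu : Wt) (l j : ℕ) : Submodule UCur (F lam mu) :=
  if j < mu.1 + lam.2 then filtInv lam mu l (j + 1)
  else if l < mu.2 - lam.2 then filtInv lam mu (l + 1) 0
  else ⊥

/-- The highest weight of the summand indexed by `a ∈ _ℓS_inv(λ, μ)`. -/
def wtInv (lam mu : Wt) (l : ℕ) (a : ℕ × ℕ) : Wt :=
  dom ((lam.1 : ℤ) - (lam.2 + a.1 - 2 * a.2 + l)) ((mu.2 : ℤ) - (mu.1 + a.2 - 2 * a.1 + l))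

/-- The `sl₃[t]`-homomorphism `⨁ᵢ τ_m^* V(νᵢ) → A / B`, `A, B ⊆ F_{λ,μ}`, which sends the
highest weight generator of the `i`-th summand to the class of `x i` exists, is homogeneous
(its source is concentrated in degree `m`), and is an isomorphism. -/
def SumIso {lam mu : Wt} {I : Type} [DecidableEq I] (ν : I → Wt) (m : ℕ) (x : I → F lam mu)
    (A B : Submodule UCur (F lam mu)) : Prop :=
  ∃ φ : (⨁ i, EvV (ν i)) →ₗ[UCur] (A ⧸ B.submoduleOf A),
    (∀ i, ∃ y : A, (y : F lam mu) = x i ∧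
      φ (DirectSum.lof UCur I (fun i => EvV (ν i)) i (EvV.gen (ν i))) =
        Submodule.Quotient.mk y) ∧
    (∀ z, ∃ y : A, (y : F lam mu) ∈ gradeF lam mu m ∧ φ z = Submodule.Quotient.mk y) ∧
    Function.Bijective φ

/-- The `sl₃[t]`-homomorphism `τ_m^* F_{λ',μ'} → A`, `A ⊆ F_{λ,μ}`, which sends the generator
to `x` exists, is homogeneous, and is an isomorphism. -/
def FIso {lam mu : Wt} (lam' mu' : Wt) (m : ℕ) (x : F lam mu)
    (A : Submodule UCur (F lam mu)) : Prop :=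
  ∃ φ : F lam' mu' →ₗ[UCur] A,
    ((φ (vF lam' mu') : A) : F lam mu) = x ∧
    (∀ r, ∀ z ∈ gradeF lam' mu' r, ((φ z : A) : F lam mu) ∈ gradeF lam mu (r + m)) ∧
    Function.Bijective φ

/-- `K` is the kernel of the surjective homomorphism `φ(λ, μ) : F_{λ,μ} → F⁺_{λ,μ}` that sends
generator to generator (in particular, this homomorphism exists). -/
def IsKerPlus (lam mu : Wt) (K : Submodule UCur (F lam mu)) : Prop :=
  ∃ φ : F lam mu →ₗ[UCur] FPlus lam mu,
    φ (vF lam mu) = vFPlus lam mu ∧ Function.Surjective φ ∧ LinearMap.ker φ = K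

end

end SL3Current

open SL3Current

/-!
The operators `x_α⁻ ⊗ tˢ` with `s ≥ 2` kill the generator of `F_{λ,μ}` (`sq_vF`), so that `F_{λ,μ}`
is a module over `sl₃ ⊗ ℂ[t]/(t²)`, and its further relations reduce to
`(x_α⁻ ⊗ t)^(min(λ(h_α), μ(h_α)) + 1) v = 0` (`isTruncated_vF`, `exists_lift`). Modulo `t²` the
operators `x_α⁻ ⊗ t` commute, and on the vectors `w(a, b, c)` the raising operators `x_{α₁}⁺`,
`x_{α₂}⁺` act like `-z ∂/∂y` and `x ∂/∂y` on divided monomials (`e1_dw`, `e2_dw`).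

*Upper bounds.* The kernel of `F_{λ,μ} → F⁺_{λ,μ}` is generated by vectors `w(a, b, c)`, and apart
from the submodule generated by `w(0, 0, μ₂)`, a quotient of a smaller `F` (`exists_map_right`), it
is exhausted by those of one degree `a + b + c` (for the second kind, of several consecutive
degrees). The vectors of one degree form a *strip* (`IsStrip`): filtered by `a + c`, each of them is
a highest weight vector modulo the later ones, and if its weight is not dominant then `sl₂`-theory
(a vector of negative weight is recovered from its image under a power of `x⁺`) shows that it
already lies in the later terms (`IsStrip.w_mem`). So the sum of the `V(ν)` over the dominant
weights of the strip maps onto each quotient (`IsStrip.sumSurj`). Together with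
`2 dim V(ν) ≤ weyl ν`, from a spanning set of PBW monomials (`finrank_evV_le`), this bounds
`dim F_{λ,μ}` by induction. The sum of the Weyl polynomial over the dominant part of a strip equals
the sum over the whole rectangle, since the other terms cancel in pairs under the simple reflections
(`sum_rectSet`); the sum over the rectangle is a closed form, and the resulting polynomial
identities (`weyl_identity_first`, `weyl_identity_second`) give `dim F_{λ,μ} ≤ weyl λ * weyl μ / 4`.
Pairs of neither kind are reached by the diagram automorphism (`finrank_le_swap`) and by the
symmetry in `λ` and `μ` (`finrank_le_comm`).

*Lower bounds.* In the tensor product of `V(λ)` and `V(μ)`, with `t` acting by `0` on the first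
factor and by a parameter `X` on the second one, the `U`-module generated over `ℂ[X]` by the tensor
product of the generators is a lattice of full rank; its fibre at `X = 0` is a quotient of
`F_{λ,μ}`, whence `dim V(λ) * dim V(μ) ≤ dim F_{λ,μ}` (`finrank_mul_le`). Applied to `F_{λ,ω}` with
`ω` fundamental, where the upper bound is `dim V(λ + ω)` plus the dimensions of the other
constituents, this gives Weyl's formula `2 dim V(ν) = weyl ν` by induction (`weyl_le_evV`).

The two bounds therefore agree (`finrank_F`), so that none of the surjections onto the successive
quotients can have a kernel (`IsStrip.sumIso`).
-/

namespace SL3Current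

noncomputable section

/-! ### Brackets in `sl₃` -/

theorem xp_al1_val : (xp .al1).1 = !![0, 1, 0; 0, 0, 0; 0, 0, 0] := by
  ext i j; fin_cases i <;> fin_cases j <;> rfl

theorem xp_al2_val : (xp .al2).1 = !![0, 0, 0; 0, 0, 1; 0, 0, 0] := by
  ext i j; fin_cases i <;> fin_cases j <;> rfl

theorem xp_th_val : (xp .th).1 = !![0, 0, 1; 0, 0, 0; 0, 0, 0] := by
  ext i j; fin_cases i <;> fin_cases j <;> rfl

theorem xm_al1_val : (xm .al1).1 = !![0, 0, 0; 1, 0, 0; 0, 0, 0] := by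
  ext i j; fin_cases i <;> fin_cases j <;> rfl

theorem xm_al2_val : (xm .al2).1 = !![0, 0, 0; 0, 0, 0; 0, 1, 0] := by
  ext i j; fin_cases i <;> fin_cases j <;> rfl

theorem xm_th_val : (xm .th).1 = !![0, 0, 0; 0, 0, 0; 1, 0, 0] := by
  ext i j; fin_cases i <;> fin_cases j <;> rfl

theorem hh_al1_val : (hh .al1).1 = !![1, 0, 0; 0, -1, 0; 0, 0, 0] := by
  ext i j; fin_cases i <;> fin_cases j <;>
    simp [hh, Ring.lie_def, xp_al1_val, xm_al1_val]

theorem hh_al2_val : (hh .al2).1 = !![0, 0, 0; 0, 1, 0; 0, 0, -1] := by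
  ext i j; fin_cases i <;> fin_cases j <;>
    simp [hh, Ring.lie_def, xp_al2_val, xm_al2_val]

theorem hh_th : hh .th = hh .al1 + hh .al2 := by
  apply Subtype.ext
  ext i j; fin_cases i <;> fin_cases j <;>
    simp [hh, Ring.lie_def, xp_th_val, xm_th_val, xp_al1_val, xm_al1_val, xp_al2_val, xm_al2_val]

theorem lie_e1_f2 : ⁅xp .al1, xm .al2⁆ = 0 := by
  apply Subtype.ext
  ext i j
  fin_cases i <;> fin_cases j <;> simp [Ring.lie_def, xp_al1_val, xm_al2_val]

theorem lie_e1_fth : ⁅xp .al1, xm .th⁆ = -xm .al2 := by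
  apply Subtype.ext
  ext i j
  fin_cases i <;> fin_cases j <;> simp [Ring.lie_def, xp_al1_val, xm_th_val, xm_al2_val]

theorem lie_e2_f1 : ⁅xp .al2, xm .al1⁆ = 0 := by
  apply Subtype.ext
  ext i j
  fin_cases i <;> fin_cases j <;> simp [Ring.lie_def, xp_al2_val, xm_al1_val]

theorem lie_e2_fth : ⁅xp .al2, xm .th⁆ = xm .al1 := by
  apply Subtype.ext
  ext i j
  fin_cases i <;> fin_cases j <;> simp [Ring.lie_def, xp_al2_val, xm_th_val, xm_al1_val]

theorem lie_f1_f2 : ⁅xm .al1, xm .al2⁆ = -xm .th := by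
  apply Subtype.ext
  ext i j
  fin_cases i <;> fin_cases j <;> simp [Ring.lie_def, xm_th_val, xm_al2_val, xm_al1_val]

theorem lie_f1_fth : ⁅xm .al1, xm .th⁆ = 0 := by
  apply Subtype.ext
  ext i j
  fin_cases i <;> fin_cases j <;> simp [Ring.lie_def, xm_th_val, xm_al1_val]

theorem lie_f2_fth : ⁅xm .al2, xm .th⁆ = 0 := by
  apply Subtype.ext
  ext i j
  fin_cases i <;> fin_cases j <;> simp [Ring.lie_def, xm_th_val, xm_al2_val]

theorem lie_e1_e2 : ⁅xp .al1, xp .al2⁆ = xp .th := by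
  apply Subtype.ext
  ext i j
  fin_cases i <;> fin_cases j <;> simp [Ring.lie_def, xp_th_val, xp_al2_val, xp_al1_val]

/-- The value `α(h_β)` of a positive root on a coroot. -/
def cartan : PosRoot → PosRoot → ℤ
  | .al1, .al1 => 2
  | .al1, .al2 => -1
  | .al1, .th => 1
  | .al2, .al1 => -1
  | .al2, .al2 => 2
  | .al2, .th => 1
  | .th, .al1 => 1
  | .th, .al2 => 1
  | .th, .th => 2

theorem lie_h_f (α β : PosRoot) : ⁅hh β, xm α⁆ = (-(cartan α β : ℂ)) • xm α := by
  have h1 : ⁅hh .al1, xm α⁆ = (-(cartan α .al1 : ℂ)) • xm α := by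
    apply Subtype.ext
    cases α <;> ext i j <;> fin_cases i <;> fin_cases j <;>
      simp [Ring.lie_def, xm_th_val, xm_al2_val, xm_al1_val,
        hh_al1_val, cartan] <;> norm_num
  have h2 : ⁅hh .al2, xm α⁆ = (-(cartan α .al2 : ℂ)) • xm α := by
    apply Subtype.ext
    cases α <;> ext i j <;> fin_cases i <;> fin_cases j <;>
      simp [Ring.lie_def, xm_th_val, xm_al2_val, xm_al1_val,
        hh_al2_val, cartan] <;> norm_num
  cases β
  · exact h1
  · exact h2
  · rw [hh_th, add_lie, h1, h2, ← add_smul]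
    cases α <;> simp [cartan] <;> norm_num

theorem lie_h_e (α : PosRoot) : ⁅hh α, xp α⁆ = (2 : ℂ) • xp α := by
  apply Subtype.ext
  cases α <;> (try rw [hh_th]) <;> ext i j <;> fin_cases i <;> fin_cases j <;>
    simp [Ring.lie_def, xp_th_val, xp_al2_val, xp_al1_val,
      hh_al1_val, hh_al2_val] <;> norm_num

/-- `ad (x_α⁻)³ = 0`, since `x_α⁻` squares to zero as a matrix. -/
theorem ad_xm_cube (α : PosRoot) (x : Sl3) : ⁅xm α, ⁅xm α, ⁅xm α, x⁆⁆⁆ = 0 := by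
  have h : (xm α).1 * (xm α).1 = 0 := by
    cases α <;> ext i j <;> fin_cases i <;> fin_cases j <;>
      simp [xm_al1_val, xm_al2_val, xm_th_val, Matrix.mul_apply, Fin.sum_univ_three]
  apply Subtype.ext
  have h' : ∀ z, (xm α).1 * ((xm α).1 * z) = 0 := fun z => by rw [← mul_assoc, h, zero_mul]
  simp [Ring.lie_def, mul_sub, sub_mul, mul_assoc, h, h']

theorem sl3_eq (x : Sl3) : x = x.1 0 1 • xp .al1 + x.1 1 2 • xp .al2 + x.1 0 2 • xp .th +
    x.1 1 0 • xm .al1 + x.1 2 1 • xm .al2 + x.1 2 0 • xm .th + x.1 0 0 • hh .al1 +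
    (-x.1 2 2) • hh .al2 := by
  have ht : x.1 0 0 + x.1 1 1 + x.1 2 2 = 0 := by
    have : Matrix.trace x.1 = 0 := x.2
    simpa [Matrix.trace_fin_three] using this
  apply Subtype.ext
  ext i j
  change _ = (_ • (xp .al1).1 + _ • (xp .al2).1 + _ • (xp .th).1 + _ • (xm .al1).1 +
    _ • (xm .al2).1 + _ • (xm .th).1 + _ • (hh .al1).1 + _ • (hh .al2).1) i j
  simp only [xp_al1_val, xp_al2_val, xp_th_val,
    xm_al1_val, xm_al2_val, xm_th_val, hh_al1_val, hh_al2_val]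
  fin_cases i <;> fin_cases j <;> simp
  linear_combination ht

/-- A linear subspace of `sl₃` that contains the root vectors and simple coroots is everything. -/
theorem sl3_induction {S : Submodule ℂ Sl3} (hp : ∀ α, xp α ∈ S) (hm : ∀ α, xm α ∈ S)
    (hh' : ∀ α, α ≠ .th → hh α ∈ S) (x : Sl3) : x ∈ S := by
  rw [sl3_eq x]
  have h1 := hh' .al1 (by simp)
  have h2 := hh' .al2 (by simp)
  exact S.add_mem (S.add_mem (S.add_mem (S.add_mem (S.add_mem (S.add_mem (S.add_mem
    (S.smul_mem _ (hp _)) (S.smul_mem _ (hp _))) (S.smul_mem _ (hp _))) (S.smul_mem _ (hm _)))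
    (S.smul_mem _ (hm _))) (S.smul_mem _ (hm _))) (S.smul_mem _ h1)) (S.smul_mem _ h2)

/-- A linear subspace of `sl₃` closed under the bracket with its elements that contains the simple
root vectors is everything. -/
theorem sl3_generated {S : Submodule ℂ Sl3} (hS : ∀ x ∈ S, ∀ y ∈ S, ⁅x, y⁆ ∈ S)
    (hp : ∀ α, α ≠ .th → xp α ∈ S) (hm : ∀ α, α ≠ .th → xm α ∈ S) (x : Sl3) : x ∈ S := by
  have h1 := hp .al1 (by simp)
  have h2 := hp .al2 (by simp)
  have h3 := hm .al1 (by simp)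
  have h4 := hm .al2 (by simp)
  refine sl3_induction (fun α => ?_) (fun α => ?_) (fun α hα => hS _ (hp α hα) _ (hm α hα)) x
  · cases α
    · exact h1
    · exact h2
    · rw [← lie_e1_e2]; exact hS _ h1 _ h2
  · cases α
    · exact h3
    · exact h4
    · rw [← neg_neg (xm .th), ← lie_f1_f2]; exact S.neg_mem (hS _ h3 _ h4)

/-! ### The enveloping algebra of the current algebra -/

theorem tpow_add (x y : Sl3) (s : ℕ) : tpow (x + y) s = tpow x s + tpow y s := by
  simp [tpow, TensorProduct.tmul_add]
theorem tpow_smul (c : ℂ) (x : Sl3) (s : ℕ) : tpow (c • x) s = c • tpow x s := by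
  simp [tpow]
theorem tpow_neg (x : Sl3) (s : ℕ) : tpow (-x) s = -tpow x s := by
  rw [← neg_one_smul ℂ, tpow_smul, neg_one_smul]
theorem tpow_zero (s : ℕ) : tpow 0 s = 0 := by
  simp [tpow]

/-- `x ↦ x ⊗ tˢ` as a linear map. -/
def tpowₗ (s : ℕ) : Sl3 →ₗ[ℂ] UCur where
  toFun x := tpow x s
  map_add' x y := tpow_add x y s
  map_smul' c x := tpow_smul c x s

section

attribute [local instance 100] LieRing.ofAssociativeRing

theorem tpow_mul_comm (x y : Sl3) (r s : ℕ) :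
    tpow x r * tpow y s = tpow y s * tpow x r + tpow ⁅x, y⁆ (r + s) := by
  have h := (UniversalEnvelopingAlgebra.ι ℂ (L := Cur)).map_lie
    (((Polynomial.X : ℂ[X]) ^ r) ⊗ₜ[ℂ] x) (((Polynomial.X : ℂ[X]) ^ s) ⊗ₜ[ℂ] y)
  rw [LieAlgebra.ExtendScalars.bracket_tmul, LieRing.of_associative_ring_bracket, ← pow_add] at h
  unfold tpow
  rw [h]; abel

/-- `U(sl₃[t])` is generated, as an algebra, by the elements `x ⊗ tˢ`. -/
theorem adjoin_tpow : Algebra.adjoin ℂ {u : UCur | ∃ x s, u = tpow x s} = ⊤ := by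
  set S := Algebra.adjoin ℂ {u : UCur | ∃ x s, u = tpow x s}
  have hS : ∀ y : Cur, UniversalEnvelopingAlgebra.ι ℂ y ∈ S := by
    intro y
    induction y using TensorProduct.induction_on with
    | zero => simp
    | add a b ha hb => rw [map_add]; exact S.add_mem ha hb
    | tmul f x =>
      induction f using Polynomial.induction_on' with
      | add p q hp hq => rw [TensorProduct.add_tmul, map_add]; exact S.add_mem hp hq
      | monomial n c =>
        rw [← mul_one c, ← smul_eq_mul, ← Polynomial.smul_monomial, ← TensorProduct.smul_tmul',
          map_smul, Polynomial.monomial_one_right_eq_X_pow]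
        exact S.smul_mem (Algebra.subset_adjoin ⟨x, n, rfl⟩) c
  let g : UCur →ₐ[ℂ] S := UniversalEnvelopingAlgebra.lift ℂ
    { toFun := fun y => ⟨UniversalEnvelopingAlgebra.ι ℂ y, hS y⟩
      map_add' := fun a b => Subtype.ext (by simp)
      map_smul' := fun a b => Subtype.ext (by simp)
      map_lie' := fun {a b} => Subtype.ext (by
        simp [LieRing.of_associative_ring_bracket]) }
  have hg : S.val.comp g = AlgHom.id ℂ UCur := by
    apply UniversalEnvelopingAlgebra.hom_ext
    apply LieHom.ext
    intro y
    simp [g]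
  rw [eq_top_iff]
  intro u _
  have := DFunLike.congr_fun hg u
  simp only [AlgHom.comp_apply, AlgHom.id_apply] at this
  rw [← this]
  exact (g u).2

end

end

noncomputable section

/-! ### Commutation rules for linear operators -/

section Operators

variable {M : Type*} [AddCommGroup M] [Module ℂ M]

/-- If `[e, y] = z` commutes with `y`, then `e` acts on powers of `y` as a derivation. -/
theorem mul_pow_of_commute {e y z : Module.End ℂ M} (h : e * y = y * e + z) (hz : Commute z y)
    (n : ℕ) : e * y ^ n = y ^ n * e + (n : ℂ) • (y ^ (n - 1) * z) := by
  induction n with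
  | zero => simp
  | succ n ih =>
    rw [pow_succ, ← mul_assoc, ih, add_mul, mul_assoc, h]
    rcases n with _ | n
    · simp
    · simp only [Nat.add_sub_cancel, mul_add, smul_mul_assoc, mul_assoc, hz.eq]
      rw [← mul_assoc (y ^ n) y z, ← pow_succ, ← mul_assoc, ← pow_succ, add_assoc]
      congr 1
      push_cast
      module

theorem mul_pow_of_weight {h y : Module.End ℂ M} {k : ℂ} (hy : h * y = y * h + k • y) (n : ℕ) :
    h * y ^ n = y ^ n * h + ((n : ℂ) * k) • y ^ n := by
  induction n with
  | zero => simp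
  | succ n ih =>
    rw [pow_succ, ← mul_assoc, ih, add_mul, mul_assoc, hy, mul_add, ← mul_assoc, ← pow_succ,
      smul_mul_assoc, mul_smul_comm, ← pow_succ]
    push_cast
    module

/-! ### Representations of `sl₂` -/

theorem sl2_weight {f h : Module.End ℂ M} (hhf : h * f = f * h - (2 : ℂ) • f) {v : M} {c : ℂ}
    (hv : h v = c • v) (k : ℕ) : h ((f ^ k) v) = (c - 2 * k) • (f ^ k) v := by
  have := mul_pow_of_weight (h := h) (y := f) (k := -2) (by rw [hhf]; module) k
  have := DFunLike.congr_fun this v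
  simp only [Module.End.mul_apply, LinearMap.add_apply, LinearMap.smul_apply, hv, map_smul] at this
  rw [this]; module

theorem sl2_primitive {e f h : Module.End ℂ M} (hef : e * f = f * e + h)
    (hhf : h * f = f * h - (2 : ℂ) • f) {v : M} {c : ℂ} (he : e v = 0) (hv : h v = c • v) (k : ℕ) :
    e ((f ^ (k + 1)) v) = ((k + 1) * (c - k)) • (f ^ k) v := by
  induction k with
  | zero =>
    have := DFunLike.congr_fun hef v
    simp only [Module.End.mul_apply, LinearMap.add_apply, he, map_zero, hv] at this
    simp [this]
  | succ k ih =>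
    have := DFunLike.congr_fun hef ((f ^ (k + 1)) v)
    simp only [Module.End.mul_apply, LinearMap.add_apply, sl2_weight hhf hv, ih, map_smul] at this
    have h2 : f ((f ^ k) v) = (f ^ (k + 1)) v := by rw [pow_succ', Module.End.mul_apply]
    rw [pow_succ' f (k + 1), Module.End.mul_apply, this, h2]
    push_cast
    module

/-- A vector killed by `e`, of weight `n`, on which `f` is nilpotent is killed by `f ^ (n + 1)`. -/
theorem sl2_pow_eq_zero {e f h : Module.End ℂ M} (hef : e * f = f * e + h)
    (hhf : h * f = f * h - (2 : ℂ) • f) {v : M} {n : ℕ} (he : e v = 0) (hv : h v = (n : ℂ) • v)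
    {K : ℕ} (hK : (f ^ K) v = 0) : (f ^ (n + 1)) v = 0 := by
  by_contra hne
  have key : ∀ j, (f ^ (n + 1 + j)) v ≠ 0 := by
    intro j
    induction j with
    | zero => simpa using hne
    | succ j ih =>
      intro h0
      have := sl2_primitive hef hhf he hv (n + 1 + j)
      rw [show n + 1 + j + 1 = n + 1 + (j + 1) by ring, h0, map_zero, eq_comm,
        smul_eq_zero_iff_left ih] at this
      push_cast at this
      have h1 : ((n : ℂ) + 1 + j + 1) * (1 + j) = 0 := by linear_combination -this
      exact absurd h1 (by exact_mod_cast (by positivity : ((n + 1 + j + 1) * (1 + j) : ℕ) ≠ 0))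
  apply key K
  rw [pow_add, Module.End.mul_apply, hK, map_zero]

/-- In a representation on which `f` is locally nilpotent, `e ^ p` is injective on the vectors of
weight `-p`. -/
theorem sl2_eq_zero_of_neg {e f h : Module.End ℂ M} (hef : e * f = f * e + h)
    (hhe : h * e = e * h + (2 : ℂ) • e) (hhf : h * f = f * h - (2 : ℂ) • f) {u : M} {p : ℕ}
    (hu : h u = (-(p : ℂ)) • u) (he : (e ^ p) u = 0) {K : ℕ}
    (hK : (f ^ K) u = 0) : u = 0 := by
  classical
  by_contra hne
  have hex : ∃ K, (f ^ K) u = 0 := ⟨K, hK⟩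
  obtain ⟨K', hK'⟩ : ∃ K', Nat.find hex = K' + 1 := by
    refine Nat.exists_eq_succ_of_ne_zero fun h0 => hne ?_
    simpa [h0] using Nat.find_spec hex
  -- `y = f ^ K' u` is the last nonzero vector of the string; it is a lowest weight vector of weight
  -- `-(p + 2 * K')`
  have hy : (f ^ K') u ≠ 0 := Nat.find_min hex (by omega)
  have hfy : f ((f ^ K') u) = 0 := by
    rw [← Module.End.mul_apply, ← pow_succ', ← hK']; exact Nat.find_spec hex
  have hwt := sl2_weight hhf hu
  have hcomm : ∀ j, (e ^ (p + j)) ((f ^ j) u) = 0 := by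
    intro j
    induction j with
    | zero => simpa using he
    | succ j ih =>
      -- `e ^ (n + 1) f = f e ^ (n + 1) + e ^ n (…)` on weight vectors
      have gen : ∀ n (y : M) (c : ℂ), h y = c • y →
          ∃ d : ℂ, (e ^ (n + 1)) (f y) = f ((e ^ (n + 1)) y) + d • (e ^ n) y := by
        intro n y c hc
        induction n with
        | zero =>
          refine ⟨c, ?_⟩
          have := DFunLike.congr_fun hef y
          simpa [hc] using this
        | succ n ihn =>
          obtain ⟨d, hd⟩ := ihn
          have hw := mul_pow_of_weight (h := h) (y := e) (k := 2) hhe (n + 1)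
          have hw := DFunLike.congr_fun hw y
          simp only [Module.End.mul_apply, LinearMap.add_apply, LinearMap.smul_apply, hc,
            map_smul] at hw
          have h1 := DFunLike.congr_fun hef ((e ^ (n + 1)) y)
          simp only [Module.End.mul_apply, LinearMap.add_apply] at h1
          refine ⟨c + (n + 1 : ℕ) * 2 + d, ?_⟩
          rw [pow_succ' e (n + 1), Module.End.mul_apply, hd, map_add, h1, hw, map_smul,
            Module.End.mul_apply, ← Module.End.mul_apply e (e ^ n), ← pow_succ']
          module
      obtain ⟨d, hd⟩ := gen (p + j) _ _ (hwt j)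
      rw [pow_succ' f, Module.End.mul_apply, ← add_assoc, hd, ih, pow_succ' e, Module.End.mul_apply,
        ih]
      simp
  -- from a lowest weight vector of weight `-(p + 2 * K')` one can climb `p + 2 * K'` steps
  have key : ∀ k, k ≤ p + K' → (e ^ k) ((f ^ K') u) ≠ 0 := by
    intro k
    induction k with
    | zero => intro _; simpa using hy
    | succ k ih =>
      intro hk h0
      have := sl2_primitive (e := f) (f := e) (h := -h) (c := p + 2 * K') (by rw [hef]; abel)
        (by rw [neg_mul, hhe, mul_neg]; abel) hfy
        (by rw [LinearMap.neg_apply, hwt]; module) k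
      rw [h0, map_zero, eq_comm, smul_eq_zero_iff_left (ih (by omega))] at this
      have h2 : (p : ℂ) + 2 * K' - k ≠ 0 := by
        have : ((p + 2 * K' : ℕ) : ℂ) ≠ (k : ℕ) := by exact_mod_cast (by omega : p + 2 * K' ≠ k)
        push_cast at this
        exact sub_ne_zero.2 this
      rcases mul_eq_zero.1 this with h3 | h3
      · exact absurd h3 (by exact_mod_cast Nat.succ_ne_zero k)
      · exact h2 h3
  exact key _ le_rfl (hcomm K')

theorem mem_maxGenEigenspace_zero {f : Module.End ℂ M} {m : M} :
    m ∈ f.maxGenEigenspace 0 ↔ ∃ K, (f ^ K) m = 0 := by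
  simp [Module.End.mem_maxGenEigenspace]

/-- If `X' = [f, X]` preserves the space on which `f` is locally nilpotent, then so does `X`. -/
theorem maxGenEigenspace_zero_stable {f X X' : Module.End ℂ M} (h : f * X = X * f + X')
    (hX' : ∀ m ∈ f.maxGenEigenspace 0, X' m ∈ f.maxGenEigenspace 0) :
    ∀ m ∈ f.maxGenEigenspace 0, X m ∈ f.maxGenEigenspace 0 := by
  have key : ∀ K, ∀ m, (f ^ K) m = 0 → X m ∈ f.maxGenEigenspace 0 := by
    intro K
    induction K with
    | zero => intro m hm; simp at hm; simp [hm]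
    | succ K ih =>
      intro m hm
      have h1 : f (X m) ∈ f.maxGenEigenspace 0 := by
        have := DFunLike.congr_fun h m
        simp only [Module.End.mul_apply, LinearMap.add_apply] at this
        rw [this]
        exact Submodule.add_mem _ (ih _ (by rwa [pow_succ] at hm))
          (hX' _ (mem_maxGenEigenspace_zero.2 ⟨_, hm⟩))
      obtain ⟨L, hL⟩ := mem_maxGenEigenspace_zero.1 h1
      exact mem_maxGenEigenspace_zero.2 ⟨L + 1, by rwa [pow_succ]⟩
  intro m hm
  obtain ⟨K, hK⟩ := mem_maxGenEigenspace_zero.1 hm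
  exact key K m hK

end Operators

/-! ### Modules over the current algebra -/

section Modules

variable {M : Type*} [AddCommGroup M] [Module ℂ M] [Module UCur M] [IsScalarTower ℂ UCur M]

theorem smul_mem_of_tpow (N : Submodule ℂ M) (h : ∀ x s, ∀ m ∈ N, tpow x s • m ∈ N) (u : UCur) :
    ∀ m ∈ N, u • m ∈ N := by
  have hu : u ∈ Algebra.adjoin ℂ {u : UCur | ∃ x s, u = tpow x s} := by
    rw [adjoin_tpow]; trivial
  induction hu using Algebra.adjoin_induction with
  | mem u hu => obtain ⟨x, s, rfl⟩ := hu; exact h x s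
  | algebraMap c => intro m hm; rw [algebraMap_smul]; exact N.smul_mem c hm
  | add a b _ _ ha hb => intro m hm; rw [add_smul]; exact N.add_mem (ha m hm) (hb m hm)
  | mul a b _ _ ha hb => intro m hm; rw [mul_smul]; exact ha _ (hb m hm)

theorem tpow_smul_comm (x y : Sl3) (r s : ℕ) (m : M) :
    tpow x r • tpow y s • m = tpow y s • tpow x r • m + tpow ⁅x, y⁆ (r + s) • m := by
  rw [← mul_smul, tpow_mul_comm, add_smul, mul_smul]

variable (M) in
/-- The operator by which `x ⊗ tˢ` acts on a module. -/
def act (x : Sl3) (s : ℕ) : Module.End ℂ M := Algebra.lsmul ℂ ℂ M (tpow x s)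

@[simp] theorem act_apply (x : Sl3) (s : ℕ) (m : M) : act M x s m = tpow x s • m := rfl

theorem act_pow_apply (x : Sl3) (s n : ℕ) (m : M) : (act M x s ^ n) m = tpow x s ^ n • m := by
  rw [act, ← map_pow]; rfl

theorem act_mul (x y : Sl3) (r s : ℕ) :
    act M x r * act M y s = act M y s * act M x r + act M ⁅x, y⁆ (r + s) := by
  simp only [act, ← map_mul, tpow_mul_comm x y, map_add]

theorem act_smul (c : ℂ) (x : Sl3) (s : ℕ) : act M (c • x) s = c • act M x s := by
  simp only [act, tpow_smul, map_smul]

theorem act_neg (x : Sl3) (s : ℕ) : act M (-x) s = -act M x s := by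
  simp only [act, tpow_neg, map_neg]

theorem act_zero (s : ℕ) : act M 0 s = 0 := by
  simp only [act, tpow_zero, map_zero]

theorem act_commute {x y : Sl3} (h : ⁅x, y⁆ = 0) (r s : ℕ) : Commute (act M x r) (act M y s) := by
  rw [commute_iff_eq, act_mul, h, act_zero, add_zero]

theorem act_ef (α : PosRoot) : act M (xp α) 0 * act M (xm α) 0 =
    act M (xm α) 0 * act M (xp α) 0 + act M (hh α) 0 := act_mul _ _ 0 0

theorem act_he (α : PosRoot) : act M (hh α) 0 * act M (xp α) 0 =
    act M (xp α) 0 * act M (hh α) 0 + (2 : ℂ) • act M (xp α) 0 := by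
  rw [act_mul, lie_h_e, act_smul]

theorem act_hf (α β : PosRoot) (s : ℕ) : act M (hh β) 0 * act M (xm α) s =
    act M (xm α) s * act M (hh β) 0 + (-(cartan α β : ℂ)) • act M (xm α) s := by
  rw [act_mul, lie_h_f, act_smul, zero_add]

theorem cartan_self (α : PosRoot) : cartan α α = 2 := by cases α <;> rfl

theorem act_hf_self (α : PosRoot) : act M (hh α) 0 * act M (xm α) 0 =
    act M (xm α) 0 * act M (hh α) 0 - (2 : ℂ) • act M (xm α) 0 := by
  rw [act_hf, cartan_self]; push_cast; module

/-- If `x_α⁻` is nilpotent on the generator of a cyclic module, then it is locally nilpotent on the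
module, because `ad x_α⁻` is nilpotent. -/
theorem nilpotent_of_generator (α : PosRoot) {v : M} (hv : ∃ K, tpow (xm α) 0 ^ K • v = 0)
    (u : UCur) : ∃ K, tpow (xm α) 0 ^ K • (u • v) = 0 := by
  have h0 : ∀ x s, ∀ m ∈ (act M (xm α) 0).maxGenEigenspace 0,
      act M ⁅xm α, ⁅xm α, ⁅xm α, x⁆⁆⁆ s m ∈ (act M (xm α) 0).maxGenEigenspace 0 := by
    intro x s m _
    rw [ad_xm_cube, act_zero]; simp
  have h1 : ∀ (y : Sl3) (s : ℕ), act M (xm α) 0 * act M y s =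
      act M y s * act M (xm α) 0 + act M ⁅xm α, y⁆ s := by
    intro y s; rw [act_mul, zero_add]
  have h2 : ∀ x s, ∀ m ∈ (act M (xm α) 0).maxGenEigenspace 0,
      act M x s m ∈ (act M (xm α) 0).maxGenEigenspace 0 := fun x s =>
    maxGenEigenspace_zero_stable (h1 _ s) (maxGenEigenspace_zero_stable (h1 _ s)
      (maxGenEigenspace_zero_stable (h1 _ s) (h0 x s)))
  have := smul_mem_of_tpow _ h2 u v
    (mem_maxGenEigenspace_zero.2 (by simpa [act_pow_apply] using hv))
  simpa [mem_maxGenEigenspace_zero, act_pow_apply] using this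

/-- The ideal `sl₃ ⊗ tᵏℂ[t]` kills a cyclic module if it kills the generator. -/
theorem killed_of_generator {k : ℕ} {v : M} (hv : ∀ x s, k ≤ s → tpow x s • v = 0) (u : UCur) :
    ∀ x s, k ≤ s → tpow x s • (u • v) = 0 := by
  let N : Submodule ℂ M :=
    { carrier := {m | ∀ x s, k ≤ s → tpow x s • m = 0}
      add_mem' := fun {a b} ha hb x s hs => by rw [smul_add, ha x s hs, hb x s hs, add_zero]
      zero_mem' := fun x s _ => smul_zero _
      smul_mem' := fun c m hm x s hs => by rw [smul_comm, hm x s hs, smul_zero] }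
  refine smul_mem_of_tpow N (fun y r m hm x s hs => ?_) u v hv
  rw [tpow_smul_comm, hm x s hs, hm _ _ (by omega), smul_zero, add_zero]

theorem tpow_smul_eq_zero {s : ℕ} {v : M} (hp : ∀ α, tpow (xp α) s • v = 0)
    (hm : ∀ α, tpow (xm α) s • v = 0) (hh' : ∀ α, α ≠ .th → tpow (hh α) s • v = 0) (x : Sl3) :
    tpow x s • v = 0 := by
  let S : Submodule ℂ Sl3 :=
    { carrier := {x | tpow x s • v = 0}
      add_mem' := fun {a b} ha hb => by
        have ha : tpow a s • v = 0 := ha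
        have hb : tpow b s • v = 0 := hb
        change tpow (a + b) s • v = 0
        rw [tpow_add, add_smul, ha, hb, add_zero]
      zero_mem' := by change tpow 0 s • v = 0; rw [tpow_zero, zero_smul]
      smul_mem' := fun c m hm => by
        have hm : tpow m s • v = 0 := hm
        change tpow (c • m) s • v = 0
        rw [tpow_smul, smul_assoc, hm, smul_zero] }
  exact sl3_induction (S := S) hp hm hh' x

/-- A subspace stable under the simple root vectors is stable under `sl₃`. -/
theorem smul_mem_of_simple (N : Submodule ℂ M)
    (hp : ∀ α, α ≠ .th → ∀ m ∈ N, tpow (xp α) 0 • m ∈ N)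
    (hm : ∀ α, α ≠ .th → ∀ m ∈ N, tpow (xm α) 0 • m ∈ N) (x : Sl3) :
    ∀ m ∈ N, tpow x 0 • m ∈ N := by
  let S : Submodule ℂ Sl3 :=
    { carrier := {x | ∀ m ∈ N, tpow x 0 • m ∈ N}
      add_mem' := fun {a b} ha hb m hm => by
        rw [tpow_add, add_smul]; exact N.add_mem (ha m hm) (hb m hm)
      zero_mem' := fun m _ => by rw [tpow_zero, zero_smul]; exact N.zero_mem
      smul_mem' := fun c x hx m hm => by
        rw [tpow_smul, smul_assoc]; exact N.smul_mem c (hx m hm) }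
  refine sl3_generated (S := S) (fun x hx y hy m hmN => ?_) hp hm x
  have := tpow_smul_comm x y 0 0 m
  rw [add_zero, ← sub_eq_iff_eq_add'] at this
  rw [← this]
  exact N.sub_mem (hx _ (hy _ hmN)) (hy _ (hx _ hmN))

end Modules

end

noncomputable section

/-! ### A presentation of `F_{λ,μ}` over `sl₃ ⊗ ℂ[t]/(t²)` -/

section Presentation

variable {M : Type*} [AddCommGroup M] [Module UCur M]

/-- `v` is a highest weight vector of weight `ν` for the current algebra, killed by the positive
powers of `t` in the Cartan part and by the integrability relations. -/
structure IsHighest (v : M) (ν : Wt) : Prop where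
  pos : ∀ α s, tpow (xp α) s • v = 0
  car : ∀ α s, α ≠ .th → tpow (hh α) (s + 1) • v = 0
  wt : ∀ α, α ≠ .th → tpow (hh α) 0 • v = algebraMap ℂ UCur (ν.eval α) • v
  int : ∀ α, α ≠ .th → tpow (xm α) 0 ^ (ν.eval α + 1) • v = 0

/-- The relations of a highest weight vector together with `(x_α⁻ ⊗ tˢ) v = 0` for `s ≥ 2` and
`(x_α⁻ ⊗ t)^(m_α + 1) v = 0`. With `m_α` the smaller of `λ(h_α)` and `μ(h_α)`, they are equivalent
to the defining relations of `F_{λ,μ}`. -/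
structure IsTruncated (v : M) (ν : Wt) (m : PosRoot → ℕ) : Prop extends IsHighest v ν where
  sq : ∀ α s, 2 ≤ s → tpow (xm α) s • v = 0
  nil : ∀ α, tpow (xm α) 1 ^ (m α + 1) • v = 0

variable {v : M} {ν : Wt} {m : PosRoot → ℕ}

theorem IsHighest.car' (h : IsHighest v ν) (α : PosRoot) (s : ℕ) :
    tpow (hh α) (s + 1) • v = 0 := by
  by_cases hα : α = .th
  · rw [hα, hh_th, tpow_add, add_smul, h.car _ _ (by simp), h.car _ _ (by simp), add_zero]
  · exact h.car α s hα

theorem IsHighest.wt' [Module ℂ M] [IsScalarTower ℂ UCur M] (h : IsHighest v ν) (α : PosRoot) :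
    tpow (hh α) 0 • v = (ν.eval α : ℂ) • v := by
  by_cases hα : α = .th
  · rw [hα, hh_th, tpow_add, add_smul, h.wt _ (by simp), h.wt _ (by simp), algebraMap_smul,
      algebraMap_smul, ← add_smul]
    simp [Wt.eval]
  · rw [h.wt α hα, algebraMap_smul]

theorem IsHighest.sq_zero [Module ℂ M] [IsScalarTower ℂ UCur M] (h : IsHighest v ν)
    (hsq : ∀ α s, 2 ≤ s → tpow (xm α) s • v = 0)
    (x : Sl3) (s : ℕ) (hs : 2 ≤ s) : tpow x s • v = 0 := by
  obtain ⟨s, rfl⟩ := Nat.exists_eq_add_of_le' (by omega : 1 ≤ s)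
  exact tpow_smul_eq_zero (fun α => h.pos α _) (fun α => hsq α _ hs) (fun α _ => h.car' α s) x

variable [Module ℂ M] [IsScalarTower ℂ UCur M]

/-- The case `s = 1` of Garland's formula. -/
theorem garland_one (h : IsHighest v ν)
    (α : PosRoot) (n : ℕ) :
    tpow (xp α) 1 • tpow (xm α) 0 ^ (n + 2) • v =
      (-((n + 2 : ℂ) * (n + 1))) • tpow (xm α) 1 • tpow (xm α) 0 ^ n • v ∧
    tpow (hh α) 1 • tpow (xm α) 0 ^ (n + 1) • v =
      (-(2 * (n + 1) : ℂ)) • tpow (xm α) 1 • tpow (xm α) 0 ^ n • v := by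
  have hf1 : ∀ n : ℕ, tpow (xm α) 0 • tpow (xm α) 1 • tpow (xm α) 0 ^ n • v =
      tpow (xm α) 1 • tpow (xm α) 0 ^ (n + 1) • v := by
    intro n
    rw [tpow_smul_comm, lie_self, tpow_zero, zero_smul, add_zero, pow_succ', mul_smul]
  have hb : ∀ w : M, tpow ⁅hh α, xm α⁆ 1 • w = (-2 : ℂ) • tpow (xm α) 1 • w := by
    intro w
    rw [lie_h_f, cartan_self, tpow_smul, smul_assoc]; norm_num
  have hH : ∀ n : ℕ, tpow (hh α) 1 • tpow (xm α) 0 ^ (n + 1) • v =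
      (-(2 * (n + 1) : ℂ)) • tpow (xm α) 1 • tpow (xm α) 0 ^ n • v := by
    intro n
    induction n with
    | zero =>
      rw [zero_add, pow_one, tpow_smul_comm, h.car' α 0, smul_zero, add_zero, hb]; simp
    | succ n ih =>
      rw [pow_succ', mul_smul, tpow_smul_comm, ih, smul_comm, hf1, add_zero, hb]
      generalize tpow (xm α) 1 • tpow (xm α) 0 ^ (n + 1) • v = w
      push_cast
      module
  refine ⟨?_, hH n⟩
  induction n with
  | zero =>
    have e1 : tpow (xp α) 1 • tpow (xm α) 0 • v = 0 := by
      rw [tpow_smul_comm, h.pos, smul_zero, zero_add]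
      exact h.car' α 0
    have := hH 0
    rw [zero_add, pow_one] at this
    rw [zero_add, pow_two, mul_smul, tpow_smul_comm, e1, smul_zero, zero_add]
    refine this.trans ?_
    norm_num
  | succ n ih =>
    rw [pow_succ', mul_smul, tpow_smul_comm, ih, smul_comm, hf1]
    have := hH (n + 1)
    change _ + tpow (hh α) 1 • _ = _
    rw [this]
    generalize tpow (xm α) 1 • tpow (xm α) 0 ^ (n + 1) • v = w
    push_cast
    module

theorem tpow_ef_one (h : IsHighest v ν) (hsq : ∀ α s, 2 ≤ s → tpow (xm α) s • v = 0)
    (α : PosRoot) (u : UCur) :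
    tpow (xp α) 1 • tpow (xm α) 1 • u • v = tpow (xm α) 1 • tpow (xp α) 1 • u • v := by
  rw [tpow_smul_comm, killed_of_generator (h.sq_zero hsq) u _ _ le_rfl, add_zero]

/-- Garland's formula modulo `t²`, up to a nonzero scalar. -/
theorem garland (h : IsHighest v ν) (hsq : ∀ α s, 2 ≤ s → tpow (xm α) s • v = 0)
    (α : PosRoot) (s n : ℕ) :
    ∃ c : ℂ, tpow (xp α) 1 ^ s • tpow (xm α) 0 ^ (n + 2 * s) • v =
      c • tpow (xm α) 1 ^ s • tpow (xm α) 0 ^ n • v ∧ c ≠ 0 := by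
  induction s generalizing n with
  | zero => exact ⟨1, by simp, one_ne_zero⟩
  | succ s ih =>
    obtain ⟨c, hc, hc0⟩ := ih (n + 2)
    refine ⟨c * (-((n + 2 : ℂ) * (n + 1))), ?_, ?_⟩
    · have hcomm : ∀ k, tpow (xp α) 1 • tpow (xm α) 1 ^ k • tpow (xm α) 0 ^ (n + 2) • v =
          tpow (xm α) 1 ^ k • tpow (xp α) 1 • tpow (xm α) 0 ^ (n + 2) • v := by
        intro k
        induction k with
        | zero => simp
        | succ k ihk =>
          have := tpow_ef_one h hsq α (tpow (xm α) 1 ^ k * tpow (xm α) 0 ^ (n + 2))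
          rw [mul_smul] at this
          rw [pow_succ', mul_smul, mul_smul, this, ihk]
      rw [show n + 2 * (s + 1) = n + 2 + 2 * s by ring, pow_succ', mul_smul, hc, smul_comm, hcomm,
        (garland_one h α n).1, smul_comm _ (-((n + 2 : ℂ) * (n + 1))),
        ← mul_smul (tpow (xm α) 1 ^ s), ← pow_succ, smul_smul]
    · refine mul_ne_zero hc0 (neg_ne_zero.2 (mul_ne_zero ?_ ?_))
      · exact_mod_cast (by omega : n + 2 ≠ 0)
      · exact_mod_cast (by omega : n + 1 ≠ 0)

theorem garland_zero (h : IsHighest v ν) (hsq : ∀ α s, 2 ≤ s → tpow (xm α) s • v = 0)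
    (α : PosRoot) (s n : ℕ) (hn : n < 2 * s) :
    tpow (xp α) 1 ^ s • tpow (xm α) 0 ^ n • v = 0 := by
  have h1 : ∀ n < 2, tpow (xp α) 1 • tpow (xm α) 0 ^ n • v = 0 := by
    intro n hn
    interval_cases n
    · simp [h.pos]
    · rw [pow_one, tpow_smul_comm, h.pos, smul_zero, zero_add]
      exact h.car' α 0
  obtain ⟨k, r, hr, rfl⟩ : ∃ k r, r < 2 ∧ n = r + 2 * k := ⟨n / 2, n % 2, by omega, by omega⟩
  obtain ⟨j, rfl⟩ : ∃ j, s = j + 1 + k := ⟨s - k - 1, by omega⟩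
  obtain ⟨c, hc, -⟩ := garland h hsq α k r
  have hcomm : ∀ i, tpow (xp α) 1 • tpow (xm α) 1 ^ i • tpow (xm α) 0 ^ r • v = 0 := by
    intro i
    induction i with
    | zero => simpa using h1 r hr
    | succ i ihi =>
      have := tpow_ef_one h hsq α (tpow (xm α) 1 ^ i * tpow (xm α) 0 ^ r)
      rw [mul_smul] at this
      rw [pow_succ', mul_smul, this, ihi, smul_zero]
  rw [pow_add, mul_smul, hc, pow_succ, mul_smul, smul_comm _ c, hcomm, smul_zero, smul_zero]

end Presentation

section Universal

variable {lam mu : Wt}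

theorem smul_vF_of_mem {u : UCur} (hu : u ∈ cvRelations (lam + mu) (pairPartition lam mu)) :
    u • vF lam mu = 0 := by
  unfold vF
  rw [← Submodule.Quotient.mk_smul, smul_eq_mul, mul_one, Submodule.Quotient.mk_eq_zero]
  exact Submodule.subset_span hu

theorem smul_eq_zero_of_divPow {M : Type*} [AddCommGroup M] [Module ℂ M] [Module UCur M]
    [IsScalarTower ℂ UCur M] {x y : UCur} {s n : ℕ} {m : M} :
    (divPow x s * divPow y n) • m = 0 ↔ x ^ s • y ^ n • m = 0 := by
  have hs : (s.factorial : ℂ)⁻¹ ≠ 0 := inv_ne_zero (Nat.cast_ne_zero.2 s.factorial_ne_zero)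
  have hn : (n.factorial : ℂ)⁻¹ ≠ 0 := inv_ne_zero (Nat.cast_ne_zero.2 n.factorial_ne_zero)
  rw [divPow, divPow, smul_mul_smul_comm, mul_smul, smul_assoc, smul_assoc, mul_smul,
    smul_eq_zero_iff_right hs, smul_eq_zero_iff_right hn]

variable (lam mu) in
/-- The exponents `min (λ(h_α), μ(h_α))`. -/
def minExp (α : PosRoot) : ℕ := min (lam.eval α) (mu.eval α)

theorem isHighest_vF : IsHighest (vF lam mu) (lam + mu) where
  pos α s := smul_vF_of_mem (Or.inl (Or.inl (Or.inl ⟨α, s, rfl⟩)))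
  car α s hα := by
    have := smul_vF_of_mem (lam := lam) (mu := mu)
      (Or.inl (Or.inl (Or.inr ⟨α, s + 1, hα, rfl⟩)))
    simpa using this
  wt α hα := by
    have := smul_vF_of_mem (lam := lam) (mu := mu) (Or.inl (Or.inl (Or.inr ⟨α, 0, hα, rfl⟩)))
    rwa [if_pos rfl, sub_smul, sub_eq_zero] at this
  int α hα := smul_vF_of_mem (Or.inl (Or.inr ⟨α, hα, rfl⟩))

theorem cv_vF (α : PosRoot) (r s k : ℕ) (hr : 1 ≤ r) (hs : 1 ≤ s) (hk : 1 ≤ k)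
    (h : 1 + r * k + ((pairPartition lam mu α).drop k).sum ≤ s + r) :
    tpow (xp α) 1 ^ s • tpow (xm α) 0 ^ (r + s) • vF lam mu = 0 :=
  smul_eq_zero_of_divPow.1 (smul_vF_of_mem (Or.inr ⟨α, r, s, k, hr, hs, hk, h, rfl⟩))

/-- It is enough to take `s = 2`, the other cases follow by the action of `h_α ⊗ t`. -/
theorem sq_vF (α : PosRoot) (s : ℕ) (hs : 2 ≤ s) : tpow (xm α) s • vF lam mu = 0 := by
  have h := isHighest_vF (lam := lam) (mu := mu)
  set v := vF lam mu
  induction s, hs using Nat.le_induction with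
  | base =>
    -- the relation with `r = 1`, `s = k = 2` reads `12 (x_α⁻ ⊗ t²) v = 0`
    have h0 := cv_vF (lam := lam) (mu := mu) α 1 2 2 le_rfl (by omega) (by omega)
      (by simp [pairPartition])
    -- `A1`, `A2` give the action of `h ⊗ t` and `B1`, `B2`, `B3` that of `x⁺ ⊗ t` on powers of `x⁻ ⊗ 1`;
    -- `C1`, `C2` give that of `x⁺ ⊗ t` on products that contain `x⁻ ⊗ t`
    have c : ∀ (x y : Sl3) (r s : ℕ) (m : F lam mu), tpow x r • tpow y s • m =
      tpow y s • tpow x r • m + tpow ⁅x, y⁆ (r + s) • m := tpow_smul_comm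
    have hb : ∀ (s : ℕ) (w : F lam mu), tpow ⁅hh α, xm α⁆ s • w = (-2 : ℂ) • tpow (xm α) s • w := by
      intro s w
      rw [lie_h_f, cartan_self, tpow_smul, smul_assoc]; norm_num
    have ef : ∀ (s : ℕ), ⁅xp α, xm α⁆ = hh α := fun _ => rfl
    have H1 : tpow (hh α) 1 • v = 0 := h.car' α 0
    have H2 : tpow (hh α) 2 • v = 0 := h.car' α 1
    have ff : ∀ (w : F lam mu), tpow (xm α) 0 • tpow (xm α) 1 • w =
        tpow (xm α) 1 • tpow (xm α) 0 • w := by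
      intro w; rw [c, lie_self, tpow_zero, zero_smul, add_zero]
    have A1 : tpow (hh α) 1 • tpow (xm α) 0 • v = (-2 : ℂ) • tpow (xm α) 1 • v := by
      rw [c, H1, smul_zero, zero_add, hb]
    have A2 : tpow (hh α) 1 • tpow (xm α) 0 • tpow (xm α) 0 • v =
        (-4 : ℂ) • tpow (xm α) 0 • tpow (xm α) 1 • v := by
      rw [c, A1, hb, add_zero, smul_comm, ← ff]
      generalize tpow (xm α) 0 • tpow (xm α) 1 • v = w
      module
    have B1 : tpow (xp α) 1 • tpow (xm α) 0 • v = 0 := by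
      rw [c, h.pos, smul_zero, zero_add, ef 0]; exact H1
    have B2 : tpow (xp α) 1 • tpow (xm α) 0 • tpow (xm α) 0 • v =
        (-2 : ℂ) • tpow (xm α) 1 • v := by
      rw [c, B1, smul_zero, zero_add, ef 0]; exact A1
    have B3 : tpow (xp α) 1 • tpow (xm α) 0 • tpow (xm α) 0 • tpow (xm α) 0 • v =
        (-6 : ℂ) • tpow (xm α) 0 • tpow (xm α) 1 • v := by
      rw [c, B2, ef 0, add_zero, A2, smul_comm]
      generalize tpow (xm α) 0 • tpow (xm α) 1 • v = w
      module
    have C1 : tpow (xp α) 1 • tpow (xm α) 1 • v = 0 := by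
      rw [c, h.pos, smul_zero, zero_add, ef 0]; exact H2
    have C2 : tpow (xp α) 1 • tpow (xm α) 0 • tpow (xm α) 1 • v =
        (-2 : ℂ) • tpow (xm α) 2 • v := by
      rw [c, C1, smul_zero, zero_add, ef 0, c, add_zero, H1, smul_zero, zero_add, hb]
    have D : tpow (xp α) 1 ^ 2 • tpow (xm α) 0 ^ (1 + 2) • v = (12 : ℂ) • tpow (xm α) 2 • v := by
      simp only [show 1 + 2 = 2 + 1 by rfl, pow_succ, pow_zero, one_mul, mul_smul, B3]
      rw [smul_comm, C2]
      generalize tpow (xm α) 2 • v = w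
      module
    rw [D] at h0
    exact (smul_eq_zero_iff_right (by norm_num)).1 h0
  | succ s hs ih =>
    -- `[h_α ⊗ t, x_α⁻ ⊗ tˢ] = -2 x_α⁻ ⊗ tˢ⁺¹`
    have := tpow_smul_comm (hh α) (xm α) 1 s v
    rw [ih, smul_zero, h.car' α 0, smul_zero, zero_add, lie_h_f, cartan_self, tpow_smul,
      smul_assoc, eq_comm, smul_eq_zero_iff_right (by norm_num)] at this
    rwa [Nat.add_comm s 1]

/-- The generator of `F_{λ,μ}` satisfies the relations of the presentation modulo `t²`. The relation
`(x_α⁻ ⊗ t)^(m + 1) v = 0` is the one with `r = s = m + 1` and `k = 1`, by Garland's formula. -/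
theorem isTruncated_vF : IsTruncated (vF lam mu) (lam + mu) (minExp lam mu) := by
  refine ⟨isHighest_vF, sq_vF, fun α => ?_⟩
  obtain ⟨c, hc, hc0⟩ := garland isHighest_vF (sq_vF (lam := lam) (mu := mu)) α
    (minExp lam mu α + 1) 0
  have := cv_vF (lam := lam) (mu := mu) α (minExp lam mu α + 1) (minExp lam mu α + 1) 1 (by omega)
    (by omega) le_rfl (by simp [pairPartition, minExp]; omega)
  rw [show minExp lam mu α + 1 + (minExp lam mu α + 1) = 0 + 2 * (minExp lam mu α + 1) by ring, hc,
    smul_eq_zero_iff_right hc0, pow_zero, one_smul] at this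
  exact this

/-- The universal property of `F_{λ,μ}` in terms of the presentation modulo `t²`. -/
theorem exists_lift {M : Type*} [AddCommGroup M] [Module ℂ M] [Module UCur M]
    [IsScalarTower ℂ UCur M] {v : M} {ν : Wt} {m : PosRoot → ℕ} (h : IsTruncated v ν m)
    (hν : ν = lam + mu) (hm : ∀ α, m α ≤ minExp lam mu α) :
    ∃ φ : F lam mu →ₗ[UCur] M, φ (vF lam mu) = v := by
  subst hν
  refine ⟨Submodule.liftQ _ (LinearMap.toSpanSingleton UCur M v) ?_, ?_⟩
  · rw [Submodule.span_le]
    rintro u (((⟨α, s, rfl⟩ | ⟨α, s, hα, rfl⟩) | ⟨α, hα, rfl⟩) | ⟨α, r, s, k, hr, hs, hk, hle, rfl⟩)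
    · exact h.pos α s
    · simp only [SetLike.mem_coe, LinearMap.mem_ker, LinearMap.toSpanSingleton_apply, sub_smul]
      rcases s with _ | s
      · rw [if_pos rfl, h.wt α hα, sub_self]
      · rw [h.car α s hα]; simp
    · exact h.int α hα
    · simp only [SetLike.mem_coe, LinearMap.mem_ker, LinearMap.toSpanSingleton_apply]
      rw [smul_eq_zero_of_divPow]
      rcases lt_or_ge r s with hrs | hrs
      · exact garland_zero h.toIsHighest h.sq α s _ (by omega)
      · obtain ⟨n, rfl⟩ := Nat.exists_eq_add_of_le' hrs
        obtain ⟨c, hc, -⟩ := garland h.toIsHighest h.sq α s n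
        -- the right side of the inequality is at least `1 + 2r ≥ 1 + r + s` when `k ≥ 2`
        have hk1 : k = 1 := by
          by_contra hne
          have := Nat.mul_le_mul_left (n + s) (show 2 ≤ k by omega)
          have := Nat.zero_le ((pairPartition lam mu α).drop k).sum
          nlinarith
        subst hk1
        have hms : m α + 1 ≤ s := by
          have := hm α
          simp [pairPartition] at hle
          unfold minExp at this
          omega
        have hz : tpow (xm α) 1 ^ s • v = 0 := by
          obtain ⟨d, rfl⟩ := Nat.exists_eq_add_of_le' hms
          rw [pow_add, mul_smul, h.nil, smul_zero]
        have hcomm : Commute (tpow (xm α) 1) (tpow (xm α) 0) := by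
          rw [commute_iff_eq, tpow_mul_comm, lie_self, tpow_zero, add_zero]
        rw [show n + s + s = n + 2 * s by ring, hc, ← mul_smul (_ ^ s),
          (hcomm.pow_pow s n).eq, mul_smul, hz, smul_zero, smul_zero]
  · simp [vF]

end Universal

end

noncomputable section

/-! ### The vectors `(x_{α₁}⁻ ⊗ t)^(a) (x_θ⁻ ⊗ t)^(b) (x_{α₂}⁻ ⊗ t)^(c) v` -/

section Monomials

variable {M : Type*} [AddCommGroup M] [Module UCur M]

/-- The vector `(x_{α₁}⁻ ⊗ t)^(a) (x_θ⁻ ⊗ t)^(b) (x_{α₂}⁻ ⊗ t)^(c) v`. -/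
def dw (v : M) (a b c : ℕ) : M :=
  (divPow (tpow (xm .al1) 1) a * divPow (tpow (xm .th) 1) b * divPow (tpow (xm .al2) 1) c) • v

variable [Module ℂ M] [IsScalarTower ℂ UCur M]

variable (M) in
/-- The ideal `sl₃ ⊗ t²ℂ[t]` acts by zero. -/
def IsSquareZero : Prop := ∀ x s, 2 ≤ s → ∀ m : M, tpow x s • m = 0

theorem IsSquareZero.commute (hk : IsSquareZero M) (x y : Sl3) {r s : ℕ} (h : 2 ≤ r + s) :
    Commute (act M x r) (act M y s) := by
  rw [commute_iff_eq, act_mul]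
  have : act M ⁅x, y⁆ (r + s) = 0 := by ext m; exact hk _ _ h m
  rw [this, add_zero]

theorem IsSquareZero.act_pow (hk : IsSquareZero M) (x y : Sl3) {s : ℕ} (hs : 1 ≤ s) (n : ℕ)
    (m : M) : act M x s ((act M y 1 ^ n) m) = (act M y 1 ^ n) (act M x s m) :=
  DFunLike.congr_fun ((hk.commute x y (by omega)).pow_right n).eq m

theorem pow_succ_apply (f : Module.End ℂ M) (n : ℕ) (m : M) : f ((f ^ n) m) = (f ^ (n + 1)) m := by
  rw [pow_succ', Module.End.mul_apply]

/-- The undivided form of `dw` as an operator. -/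
theorem dw_eq (v : M) (a b c : ℕ) :
    dw v a b c = ((a.factorial : ℂ)⁻¹ * (b.factorial : ℂ)⁻¹ * (c.factorial : ℂ)⁻¹) •
      (act M (xm .al1) 1 ^ a) ((act M (xm .th) 1 ^ b) ((act M (xm .al2) 1 ^ c) v)) := by
  simp only [dw, divPow, act_pow_apply, smul_mul_smul_comm, smul_assoc, mul_smul]
  simp only [← mul_smul]
  congr 1; ring

theorem factorial_inv_succ (n : ℕ) :
    ((n.factorial : ℂ))⁻¹ = (n + 1) * ((n + 1).factorial : ℂ)⁻¹ := by
  rw [Nat.factorial_succ]; push_cast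
  have : (n : ℂ) + 1 ≠ 0 := Nat.cast_add_one_ne_zero n
  rw [mul_inv, ← mul_assoc, mul_inv_cancel₀ this, one_mul]

variable {v : M} {ν : Wt} {m : PosRoot → ℕ}

theorem tpow_dw (hk : IsSquareZero M) (x : Sl3) {s : ℕ} (hs : 1 ≤ s) (a b c : ℕ) :
    tpow x s • dw v a b c = dw (tpow x s • v) a b c := by
  rw [dw_eq, dw_eq, smul_comm, ← act_apply, hk.act_pow _ _ hs, hk.act_pow _ _ hs,
    hk.act_pow _ _ hs, act_apply]

theorem dw_zero_right (a b c : ℕ) : dw (0 : M) a b c = 0 := by simp [dw]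

theorem f1_dw (a b c : ℕ) :
    tpow (xm .al1) 1 • dw v a b c = ((a : ℂ) + 1) • dw v (a + 1) b c := by
  rw [dw_eq, dw_eq, smul_comm, ← act_apply, pow_succ_apply, smul_smul, factorial_inv_succ a]
  congr 1; ring

theorem fth_dw (hk : IsSquareZero M) (a b c : ℕ) :
    tpow (xm .th) 1 • dw v a b c = ((b : ℂ) + 1) • dw v a (b + 1) c := by
  rw [dw_eq, dw_eq, smul_comm, ← act_apply, hk.act_pow _ _ le_rfl, pow_succ_apply, smul_smul,
    factorial_inv_succ b]
  congr 1; ring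

theorem f2_dw (hk : IsSquareZero M) (a b c : ℕ) :
    tpow (xm .al2) 1 • dw v a b c = ((c : ℂ) + 1) • dw v a b (c + 1) := by
  rw [dw_eq, dw_eq, smul_comm, ← act_apply, hk.act_pow _ _ le_rfl, hk.act_pow _ _ le_rfl,
    pow_succ_apply, smul_smul, factorial_inv_succ c]
  congr 1; ring

/-- On the vectors `dw v a b c`, the operator `x_{α₁}⁺` is, up to sign, `z ∂/∂y`. -/
theorem e1_dw (hk : IsSquareZero M) (h : IsHighest v ν) (a b c : ℕ) :
    tpow (xp .al1) 0 • dw v a (b + 1) c = (-((c : ℂ) + 1)) • dw v a b (c + 1) ∧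
    tpow (xp .al1) 0 • dw v a 0 c = 0 := by
  set X := act M (xm .al1) 1
  set Y := act M (xm .th) 1
  set Z := act M (xm .al2) 1
  have hX : ∀ n : ℕ, act M (xp .al1) 0 * X ^ n = X ^ n * act M (xp .al1) 0 +
      (n : ℂ) • (X ^ (n - 1) * act M (hh .al1) 1) := fun n =>
    mul_pow_of_commute (act_mul _ _ 0 1) (hk.commute _ _ le_rfl) n
  have hY : ∀ n : ℕ, act M (xp .al1) 0 * Y ^ n = Y ^ n * act M (xp .al1) 0 +
      (n : ℂ) • (Y ^ (n - 1) * (-Z)) := fun n =>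
    mul_pow_of_commute (by rw [act_mul (xp .al1) (xm .th), lie_e1_fth, act_neg, zero_add])
      (hk.commute _ _ le_rfl).neg_left n
  have hZ : ∀ n : ℕ, act M (xp .al1) 0 * Z ^ n = Z ^ n * act M (xp .al1) 0 := fun n =>
    ((act_commute lie_e1_f2 0 1).pow_right n).eq
  have hH : ∀ b : ℕ, act M (hh .al1) 1 ((Y ^ b) ((Z ^ c) v)) = 0 := by
    intro b
    rw [hk.act_pow _ _ le_rfl, hk.act_pow _ _ le_rfl, act_apply, h.car' _ 0, map_zero, map_zero]
  have he : act M (xp .al1) 0 ((Z ^ c) v) = 0 := by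
    rw [← Module.End.mul_apply, hZ, Module.End.mul_apply, act_apply, h.pos, map_zero]
  have key : ∀ b : ℕ, act M (xp .al1) 0 ((X ^ a) ((Y ^ b) ((Z ^ c) v))) =
      (-(b : ℂ)) • (X ^ a) ((Y ^ (b - 1)) ((Z ^ (c + 1)) v)) := by
    intro b
    rw [← Module.End.mul_apply, hX, LinearMap.add_apply, Module.End.mul_apply,
      ← Module.End.mul_apply (act M _ 0), hY, LinearMap.add_apply, Module.End.mul_apply, he,
      LinearMap.smul_apply, LinearMap.smul_apply, Module.End.mul_apply (X ^ (a - 1)), hH,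
      Module.End.mul_apply, LinearMap.neg_apply, ← Module.End.mul_apply Z, ← pow_succ']
    simp
  constructor
  · rw [dw_eq, smul_comm, ← act_apply, key, dw_eq, smul_smul, smul_smul, factorial_inv_succ c,
      Nat.add_sub_cancel, factorial_inv_succ b]
    push_cast
    congr 1; ring
  · rw [dw_eq, smul_comm, ← act_apply, key]; simp

/-- On the vectors `dw v a b c`, the operator `x_{α₂}⁺` is `x ∂/∂y`. -/
theorem e2_dw (hk : IsSquareZero M) (h : IsHighest v ν) (a b c : ℕ) :
    tpow (xp .al2) 0 • dw v a (b + 1) c = ((a : ℂ) + 1) • dw v (a + 1) b c ∧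
    tpow (xp .al2) 0 • dw v a 0 c = 0 := by
  set X := act M (xm .al1) 1
  set Y := act M (xm .th) 1
  set Z := act M (xm .al2) 1
  have hX : ∀ n : ℕ, act M (xp .al2) 0 * X ^ n = X ^ n * act M (xp .al2) 0 := fun n =>
    ((act_commute lie_e2_f1 0 1).pow_right n).eq
  have hY : ∀ n : ℕ, act M (xp .al2) 0 * Y ^ n = Y ^ n * act M (xp .al2) 0 +
      (n : ℂ) • (Y ^ (n - 1) * X) := fun n =>
    mul_pow_of_commute (by rw [act_mul (xp .al2) (xm .th), lie_e2_fth, zero_add])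
      (hk.commute _ _ le_rfl) n
  have hZ : ∀ n : ℕ, act M (xp .al2) 0 * Z ^ n = Z ^ n * act M (xp .al2) 0 +
      (n : ℂ) • (Z ^ (n - 1) * act M (hh .al2) 1) := fun n =>
    mul_pow_of_commute (act_mul _ _ 0 1) (hk.commute _ _ le_rfl) n
  have he : act M (xp .al2) 0 ((Z ^ c) v) = 0 := by
    rw [← Module.End.mul_apply, hZ, LinearMap.add_apply, LinearMap.smul_apply,
      Module.End.mul_apply, Module.End.mul_apply, act_apply, h.pos, act_apply, h.car' _ 0]
    simp
  have key : ∀ b : ℕ, act M (xp .al2) 0 ((X ^ a) ((Y ^ b) ((Z ^ c) v))) =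
      (b : ℂ) • (X ^ (a + 1)) ((Y ^ (b - 1)) ((Z ^ c) v)) := by
    intro b
    rw [← Module.End.mul_apply, hX, Module.End.mul_apply, ← Module.End.mul_apply (act M _ 0), hY,
      LinearMap.add_apply, Module.End.mul_apply, he, map_zero, zero_add, LinearMap.smul_apply,
      ((hk.commute _ _ le_rfl : Commute Y X).pow_left (b - 1)).eq, map_smul, Module.End.mul_apply,
      ← Module.End.mul_apply (X ^ a), ← pow_succ]
  constructor
  · rw [dw_eq, smul_comm, ← act_apply, key, dw_eq, smul_smul, smul_smul, factorial_inv_succ a,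
      Nat.add_sub_cancel, factorial_inv_succ b]
    push_cast
    congr 1; ring
  · rw [dw_eq, smul_comm, ← act_apply, key]; simp

theorem h_dw (h : IsHighest v ν) (α : PosRoot) (a b c : ℕ) :
    tpow (hh α) 0 • dw v a b c = (((ν.eval α : ℤ) - a * cartan .al1 α - b * cartan .th α -
      c * cartan .al2 α : ℤ) : ℂ) • dw v a b c := by
  have hF : ∀ (β : PosRoot) (n : ℕ) (w : M) (k : ℂ), act M (hh α) 0 w = k • w →
      act M (hh α) 0 ((act M (xm β) 1 ^ n) w) =
        (k - n * cartan β α) • (act M (xm β) 1 ^ n) w := by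
    intro β n w k hw
    rw [← Module.End.mul_apply, mul_pow_of_weight (act_hf β α 1) n, LinearMap.add_apply,
      Module.End.mul_apply, hw, LinearMap.smul_apply, map_smul]
    module
  rw [dw_eq, smul_comm, ← act_apply,
    hF _ a _ _ (hF _ b _ _ (hF _ c _ _ (by rw [act_apply, h.wt' α]))), smul_comm]
  push_cast
  congr 1
  ring_nf

theorem dw_mem_of_e1 (hk : IsSquareZero M) (h : IsHighest v ν) (N : Submodule UCur M)
    {a b c : ℕ} (k : ℕ) (hN : dw v a (b + k) c ∈ N) : dw v a b (c + k) ∈ N := by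
  induction k generalizing c with
  | zero => exact hN
  | succ k ih =>
    have h1 := N.smul_mem (tpow (xp .al1) 0) hN
    rw [← add_assoc, (e1_dw hk h a (b + k) c).1] at h1
    have h2 := N.smul_of_tower_mem (-((c : ℂ) + 1))⁻¹ h1
    rw [smul_smul, inv_mul_cancel₀ (neg_ne_zero.2 (Nat.cast_add_one_ne_zero c)), one_smul] at h2
    rw [show c + (k + 1) = c + 1 + k by ring]
    exact ih h2

theorem dw_mem_of_e2 (hk : IsSquareZero M) (h : IsHighest v ν) (N : Submodule UCur M)
    {a b c : ℕ} (k : ℕ) (hN : dw v a (b + k) c ∈ N) : dw v (a + k) b c ∈ N := by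
  induction k generalizing a with
  | zero => exact hN
  | succ k ih =>
    have h1 := N.smul_mem (tpow (xp .al2) 0) hN
    rw [← add_assoc, (e2_dw hk h a (b + k) c).1] at h1
    have h2 := N.smul_of_tower_mem ((a : ℂ) + 1)⁻¹ h1
    rw [smul_smul, inv_mul_cancel₀ (Nat.cast_add_one_ne_zero a), one_smul] at h2
    rw [show a + (k + 1) = a + 1 + k by ring]
    exact ih h2

theorem dw_mem (hk : IsSquareZero M) (h : IsHighest v ν) (N : Submodule UCur M)
    {n : ℕ} (hN : dw v 0 n 0 ∈ N) (a b c : ℕ) (habc : a + b + c = n) : dw v a b c ∈ N := by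
  have h1 : dw v 0 (a + b + c) 0 ∈ N := by rwa [habc]
  have h2 := dw_mem_of_e1 hk h N c h1
  rw [zero_add, add_comm a b] at h2
  have h3 := dw_mem_of_e2 hk h N a h2
  rwa [zero_add] at h3

theorem pow_smul_eq_zero {u : UCur} {k n : ℕ} (hz : u ^ k • v = 0) (hn : k ≤ n) :
    u ^ n • v = 0 := by
  obtain ⟨d, rfl⟩ := Nat.exists_eq_add_of_le' hn
  rw [pow_add, mul_smul, hz, smul_zero]

theorem dw_eq_zero_left (hk : IsSquareZero M) (h : IsTruncated v ν m) {a : ℕ} (b c : ℕ)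
    (ha : m .al1 < a) : dw v a b c = 0 := by
  have hz := pow_smul_eq_zero (h.nil .al1) ha
  rw [← act_pow_apply] at hz
  rw [dw_eq, ← Module.End.mul_apply (_ ^ a), ((hk.commute _ _ le_rfl).pow_pow a b).eq,
    Module.End.mul_apply, ← Module.End.mul_apply (_ ^ a),
    ((hk.commute _ _ le_rfl).pow_pow a c).eq, Module.End.mul_apply, hz]
  simp

theorem dw_eq_zero_right (h : IsTruncated v ν m) (a b : ℕ) {c : ℕ}
    (hc : m .al2 < c) : dw v a b c = 0 := by
  have hz := pow_smul_eq_zero (h.nil .al2) hc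
  rw [← act_pow_apply] at hz
  rw [dw_eq, hz]
  simp

theorem dw_eq_zero_of_degree (hk : IsSquareZero M) (h : IsTruncated v ν m) {a b c : ℕ}
    (habc : m .th < a + b + c) : dw v a b c = 0 := by
  have hz := pow_smul_eq_zero (h.nil .th) habc
  rw [← act_pow_apply] at hz
  have := dw_mem hk h.toIsHighest (⊥ : Submodule UCur M) (n := a + b + c)
    (by rw [dw_eq]; simp [hz]) a b c rfl
  simpa using this

/-- A vector of weight `-p` on which `x_α⁻` is nilpotent lies in every submodule that contains
its image under `(x_α⁺)^p`. -/
theorem mem_of_neg_weight (N : Submodule UCur M) (α : PosRoot) {u : M} {p : ℕ}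
    (hu : tpow (hh α) 0 • u = (-(p : ℂ)) • u) (he : tpow (xp α) 0 ^ p • u ∈ N)
    (hf : ∃ K, tpow (xm α) 0 ^ K • u = 0) : u ∈ N := by
  obtain ⟨K, hK⟩ := hf
  rw [← Submodule.Quotient.mk_eq_zero]
  refine sl2_eq_zero_of_neg (act_ef (M := M ⧸ N) α) (act_he α) (act_hf_self α) (p := p) (K := K)
    ?_ ?_ ?_
  · rw [act_apply, ← Submodule.Quotient.mk_smul, hu, Submodule.Quotient.mk_smul]
  · rw [act_pow_apply, ← Submodule.Quotient.mk_smul, Submodule.Quotient.mk_eq_zero]; exact he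
  · rw [act_pow_apply, ← Submodule.Quotient.mk_smul, hK, Submodule.Quotient.mk_zero]

theorem e1_pow_dw (hk : IsSquareZero M) (h : IsHighest v ν) (a b c k : ℕ) :
    ∃ d : ℂ, tpow (xp .al1) 0 ^ k • dw v a (b + k) c = d • dw v a b (c + k) := by
  induction k generalizing c with
  | zero => exact ⟨1, by simp⟩
  | succ k ih =>
    obtain ⟨d, hd⟩ := ih (c + 1)
    refine ⟨-((c : ℂ) + 1) * d, ?_⟩
    rw [pow_succ, mul_smul, ← add_assoc, (e1_dw hk h a (b + k) c).1, smul_comm, hd, smul_smul,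
      show c + (k + 1) = c + 1 + k by ring]

theorem e2_pow_dw (hk : IsSquareZero M) (h : IsHighest v ν) (a b c k : ℕ) :
    ∃ d : ℂ, tpow (xp .al2) 0 ^ k • dw v a (b + k) c = d • dw v (a + k) b c := by
  induction k generalizing a with
  | zero => exact ⟨1, by simp⟩
  | succ k ih =>
    obtain ⟨d, hd⟩ := ih (a + 1)
    refine ⟨((a : ℂ) + 1) * d, ?_⟩
    rw [pow_succ, mul_smul, ← add_assoc, (e2_dw hk h a (b + k) c).1, smul_comm, hd, smul_smul,
      show a + (k + 1) = a + 1 + k by ring]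

/-- If `dw v a n 0` has the negative `α₁`-weight `-p`, then a submodule that contains
`dw v a (n - p) p` contains the whole `α₁`-string `dw v a (n - k) k`. -/
theorem dw_mem_of_al1 (hk : IsSquareZero M) (h : IsHighest v ν)
    (hf : ∀ x : M, ∃ K, tpow (xm .al1) 0 ^ K • x = 0) (N : Submodule UCur M) {a n p : ℕ}
    (hwt : (ν.1 : ℤ) - 2 * a - n = -p) (hpn : p ≤ n) (hN : dw v a (n - p) p ∈ N) {k : ℕ}
    (hkn : k ≤ n) : dw v a (n - k) k ∈ N := by
  have h1 : dw v a n 0 ∈ N := by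
    refine mem_of_neg_weight N .al1 (p := p) ?_ ?_ (hf _)
    · rw [h_dw h]
      simp only [cartan, Wt.eval]
      rw [show (ν.1 : ℤ) - a * 2 - n * 1 - (0 : ℕ) * -1 = -p by rw [← hwt]; push_cast; ring]
      push_cast; rfl
    · obtain ⟨d, hd⟩ := e1_pow_dw hk h a (n - p) 0 p
      rw [Nat.sub_add_cancel hpn, zero_add] at hd
      rw [hd]
      exact N.smul_of_tower_mem d hN
  have := dw_mem_of_e1 hk h N (a := a) (b := n - k) (c := 0) k (by rwa [Nat.sub_add_cancel hkn])
  rwa [zero_add] at this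

/-- If `dw v 0 n c` has the negative `α₂`-weight `-p`, then a submodule that contains
`dw v p (n - p) c` contains the whole `α₂`-string `dw v k (n - k) c`. -/
theorem dw_mem_of_al2 (hk : IsSquareZero M) (h : IsHighest v ν)
    (hf : ∀ x : M, ∃ K, tpow (xm .al2) 0 ^ K • x = 0) (N : Submodule UCur M) {c n p : ℕ}
    (hwt : (ν.2 : ℤ) - 2 * c - n = -p) (hpn : p ≤ n) (hN : dw v p (n - p) c ∈ N) {k : ℕ}
    (hkn : k ≤ n) : dw v k (n - k) c ∈ N := by
  have h1 : dw v 0 n c ∈ N := by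
    refine mem_of_neg_weight N .al2 (p := p) ?_ ?_ (hf _)
    · rw [h_dw h]
      simp only [cartan, Wt.eval]
      rw [show (ν.2 : ℤ) - (0 : ℕ) * -1 - n * 1 - c * 2 = -p by rw [← hwt]; push_cast; ring]
      push_cast; rfl
    · obtain ⟨d, hd⟩ := e2_pow_dw hk h 0 (n - p) c p
      rw [Nat.sub_add_cancel hpn, zero_add] at hd
      rw [hd]
      exact N.smul_of_tower_mem d hN
  have := dw_mem_of_e2 hk h N (a := 0) (b := n - k) (c := c) k (by rwa [Nat.sub_add_cancel hkn])
  rwa [zero_add] at this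

end Monomials

end

noncomputable section

/-! ### Homogeneous elements -/

theorem gradeU_mul {r s : ℕ} {a b : UCur} (ha : a ∈ gradeU r) (hb : b ∈ gradeU s) :
    a * b ∈ gradeU (r + s) := by
  have : gradeU r * gradeU s ≤ gradeU (r + s) := by
    unfold gradeU
    rw [Submodule.span_mul_span, Submodule.span_le]
    rintro _ ⟨_, ⟨l, hl, rfl⟩, _, ⟨l', hl', rfl⟩, rfl⟩
    exact Submodule.subset_span ⟨l ++ l', by simp [hl, hl'], by simp⟩
  exact this (Submodule.mul_mem_mul ha hb)

theorem one_mem_gradeU : (1 : UCur) ∈ gradeU 0 :=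
  Submodule.subset_span ⟨[], by simp, by simp⟩

theorem tpow_mem_gradeU (x : Sl3) (s : ℕ) : tpow x s ∈ gradeU s :=
  Submodule.subset_span ⟨[(x, s)], by simp, by simp⟩

theorem divPow_mem_gradeU (x : Sl3) (n : ℕ) : divPow (tpow x 1) n ∈ gradeU n := by
  refine Submodule.smul_mem _ _ ?_
  induction n with
  | zero => simpa using one_mem_gradeU
  | succ n ih => rw [pow_succ]; exact gradeU_mul ih (tpow_mem_gradeU x 1)

theorem w_mem_gradeF (lam mu : Wt) {a b c n : ℕ} (h : a + b + c = n) :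
    w lam mu a b c ∈ gradeF lam mu n :=
  ⟨_, h ▸ gradeU_mul (gradeU_mul (divPow_mem_gradeU _ a) (divPow_mem_gradeU _ b))
    (divPow_mem_gradeU _ c), rfl⟩

theorem smul_mem_gradeF {lam mu : Wt} {r s : ℕ} {u : UCur} {x : F lam mu} (hu : u ∈ gradeU r)
    (hx : x ∈ gradeF lam mu s) : u • x ∈ gradeF lam mu (r + s) := by
  obtain ⟨u', hu', rfl⟩ := hx
  exact ⟨u * u', gradeU_mul hu hu', by rw [mul_smul]⟩

theorem add_mem_gradeF {lam mu : Wt} {r : ℕ} {x y : F lam mu} (hx : x ∈ gradeF lam mu r)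
    (hy : y ∈ gradeF lam mu r) : x + y ∈ gradeF lam mu r := by
  obtain ⟨u, hu, rfl⟩ := hx
  obtain ⟨u', hu', rfl⟩ := hy
  exact ⟨u + u', Submodule.add_mem _ hu hu', by rw [add_smul]⟩

/-! ### The evaluation modules `V(ν)` -/

theorem evZeroU_tpow_zero (x : Sl3) : evZeroU (tpow x 0) = inU x := by
  rw [tpow, evZeroU_ι, evZero_tmul]; simp

theorem evZeroU_tpow_succ (x : Sl3) (s : ℕ) : evZeroU (tpow x (s + 1)) = 0 := by
  rw [tpow, evZeroU_ι, evZero_tmul]; simp [inU]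

section

attribute [local instance 100] LieRing.ofAssociativeRing

/-- The inclusion `U(sl₃) → U(sl₃[t])`. -/
def inclU : USl3 →ₐ[ℂ] UCur :=
  UniversalEnvelopingAlgebra.lift ℂ
    { toFun := fun x => tpow x 0
      map_add' := fun x y => tpow_add x y 0
      map_smul' := fun c x => tpow_smul c x 0
      map_lie' := fun {x y} => by
        rw [LieRing.of_associative_ring_bracket, tpow_mul_comm, add_zero, add_sub_cancel_left] }

theorem inclU_inU (x : Sl3) : inclU (inU x) = tpow x 0 := by
  simp [inclU, inU]

theorem usl3_hom_ext {A : Type*} [Ring A] [Algebra ℂ A] {f g : USl3 →ₐ[ℂ] A}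
    (h : ∀ x, f (inU x) = g (inU x)) : f = g := by
  apply UniversalEnvelopingAlgebra.hom_ext
  apply LieHom.ext
  exact h

theorem evZeroU_inclU (u : USl3) : evZeroU (inclU u) = u := by
  have : evZeroU.comp inclU = AlgHom.id ℂ USl3 :=
    usl3_hom_ext fun x => by simp [inclU_inU, evZeroU_tpow_zero]
  exact DFunLike.congr_fun this u

theorem inclU_mem_gradeU (u : USl3) : inclU u ∈ gradeU 0 := by
  let S : Subalgebra ℂ UCur :=
    { gradeU 0 with
      mul_mem' := fun {a b} ha hb => gradeU_mul (r := 0) (s := 0) ha hb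
      algebraMap_mem' := fun c => by
        rw [Algebra.algebraMap_eq_smul_one]
        exact Submodule.smul_mem _ c one_mem_gradeU }
  let g : USl3 →ₐ[ℂ] S := UniversalEnvelopingAlgebra.lift ℂ
    { toFun := fun x => ⟨tpow x 0, tpow_mem_gradeU x 0⟩
      map_add' := fun x y => Subtype.ext (tpow_add x y 0)
      map_smul' := fun c x => Subtype.ext (tpow_smul c x 0)
      map_lie' := fun {x y} => Subtype.ext (by
        change tpow ⁅x, y⁆ 0 = tpow x 0 * tpow y 0 - tpow y 0 * tpow x 0
        rw [tpow_mul_comm, add_zero, add_sub_cancel_left]) }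
  have : S.val.comp g = inclU := usl3_hom_ext fun x => by
    rw [inclU_inU]
    simp [g, inU]
  rw [← this]
  exact (g u).2

end

instance (ν : Wt) : Module ℂ (EvV ν) := inferInstanceAs (Module ℂ (V ν))

/-- The identity of the underlying spaces of `EvV ν` and `V ν`. -/
def evVEquiv (ν : Wt) : EvV ν ≃ₗ[ℂ] V ν := LinearEquiv.refl ℂ (V ν)

theorem evVEquiv_smul (ν : Wt) (u : UCur) (m : EvV ν) :
    evVEquiv ν (u • m) = evZeroU u • evVEquiv ν m := rfl

theorem evVEquiv_gen (ν : Wt) : evVEquiv ν (EvV.gen ν) = Submodule.Quotient.mk 1 := rfl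

instance (ν : Wt) : IsScalarTower ℂ UCur (EvV ν) where
  smul_assoc c u m := by
    apply (evVEquiv ν).injective
    rw [evVEquiv_smul, map_smul, map_smul, evVEquiv_smul, smul_assoc]

theorem evV_exists_smul (ν : Wt) (m : EvV ν) : ∃ u ∈ gradeU 0, m = u • EvV.gen ν := by
  obtain ⟨u, hu⟩ := Submodule.Quotient.mk_surjective _ (evVEquiv ν m)
  refine ⟨inclU u, inclU_mem_gradeU u, (evVEquiv ν).injective ?_⟩
  rw [evVEquiv_smul, evZeroU_inclU, evVEquiv_gen, ← Submodule.Quotient.mk_smul, smul_eq_mul,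
    mul_one, hu]

theorem evV_killed (ν : Wt) (x : Sl3) (s : ℕ) (hs : 1 ≤ s) (m : EvV ν) : tpow x s • m = 0 := by
  obtain ⟨s, rfl⟩ := Nat.exists_eq_add_of_le' hs
  apply (evVEquiv ν).injective
  rw [evVEquiv_smul, evZeroU_tpow_succ, zero_smul, map_zero]

theorem isHighest_gen (ν : Wt) : IsHighest (EvV.gen ν) ν := by
  have key : ∀ u : UCur, evZeroU u ∈ irrRelations ν → u • EvV.gen ν = 0 := by
    intro u hu
    apply (evVEquiv ν).injective
    rw [evVEquiv_smul, evVEquiv_gen, map_zero, ← Submodule.Quotient.mk_smul, smul_eq_mul, mul_one,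
      Submodule.Quotient.mk_eq_zero]
    exact Submodule.subset_span hu
  refine ⟨fun α s => ?_, fun α s _ => ?_, fun α hα => ?_, fun α hα => ?_⟩
  · rcases s with _ | s
    · exact key _ (Or.inl (Or.inl ⟨α, evZeroU_tpow_zero _⟩))
    · exact evV_killed ν _ _ (by omega) _
  · exact evV_killed ν _ _ (by omega) _
  · have := key (tpow (hh α) 0 - algebraMap ℂ UCur (ν.eval α))
      (Or.inl (Or.inr ⟨α, hα, by rw [map_sub, evZeroU_tpow_zero, AlgHom.commutes]⟩))
    rwa [sub_smul, sub_eq_zero] at this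
  · exact key _ (Or.inr ⟨α, hα, by rw [map_pow, evZeroU_tpow_zero]⟩)

/-- The universal property of `V(ν)`, regarded as a module over the current algebra. -/
theorem exists_evV_lift {M : Type*} [AddCommGroup M] [Module ℂ M] [Module UCur M]
    [IsScalarTower ℂ UCur M] (hk : ∀ x s, 1 ≤ s → ∀ m : M, tpow x s • m = 0) {v : M} {ν : Wt}
    (h : IsHighest v ν) : ∃ φ : EvV ν →ₗ[UCur] M, φ (EvV.gen ν) = v := by
  have hincl : ∀ (u : UCur) (m : M), inclU (evZeroU u) • m = u • m := by
    intro u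
    have hu : u ∈ Algebra.adjoin ℂ {u : UCur | ∃ x s, u = tpow x s} := by
      rw [adjoin_tpow]; trivial
    induction hu using Algebra.adjoin_induction with
    | mem u hu =>
      obtain ⟨x, s, rfl⟩ := hu
      intro m
      rcases s with _ | s
      · rw [evZeroU_tpow_zero, inclU_inU]
      · rw [evZeroU_tpow_succ, map_zero, zero_smul, hk _ _ (by omega)]
    | algebraMap c => intro m; rw [AlgHom.commutes, AlgHom.commutes]
    | add a b _ _ ha hb => intro m; simp only [map_add, add_smul, ha, hb]
    | mul a b _ _ ha hb => intro m; simp only [map_mul, mul_smul, ha, hb]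
  let _ : Module USl3 M := Module.compHom M inclU.toRingHom
  have hdef : ∀ (u : USl3) (m : M), u • m = inclU u • m := fun _ _ => rfl
  let φ : V ν →ₗ[USl3] M :=
    Submodule.liftQ _ (LinearMap.toSpanSingleton USl3 M v) (by
      rw [Submodule.span_le]
      rintro u ((⟨α, rfl⟩ | ⟨α, hα, rfl⟩) | ⟨α, hα, rfl⟩) <;>
        simp only [SetLike.mem_coe, LinearMap.mem_ker, LinearMap.toSpanSingleton_apply, hdef]
      · rw [inclU_inU, h.pos]
      · rw [map_sub, inclU_inU, AlgHom.commutes, sub_smul, h.wt α hα, sub_self]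
      · rw [map_pow, inclU_inU, h.int α hα])
  refine ⟨{ toFun := fun m => φ (evVEquiv ν m)
            map_add' := fun m n => by rw [map_add, map_add]
            map_smul' := fun u m => ?_ }, ?_⟩
  · rw [evVEquiv_smul, φ.map_smul, hdef, hincl, RingHom.id_apply]
  · change φ (Submodule.Quotient.mk 1) = v
    simp [φ]

/-! ### Subquotients of `F_{λ,μ}` generated by highest weight vectors -/

section Subquotients

variable {lam mu : Wt}

/-- The surjectivity part of `SumIso`: the homomorphism `⨁ᵢ τ_m^* V(νᵢ) → A / B` exists, is
homogeneous, and is onto. -/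
def SumSurj {I : Type} [DecidableEq I] (ν : I → Wt) (m : ℕ) (x : I → F lam mu)
    (A B : Submodule UCur (F lam mu)) : Prop :=
  ∃ φ : (⨁ i, EvV (ν i)) →ₗ[UCur] (A ⧸ B.submoduleOf A),
    (∀ i, ∃ y : A, (y : F lam mu) = x i ∧
      φ (DirectSum.lof UCur I (fun i => EvV (ν i)) i (EvV.gen (ν i))) =
        Submodule.Quotient.mk y) ∧
    (∀ z, ∃ y : A, (y : F lam mu) ∈ gradeF lam mu m ∧ φ z = Submodule.Quotient.mk y) ∧
    Function.Surjective φ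

theorem F_exists_smul (y : F lam mu) : ∃ u : UCur, y = u • vF lam mu := by
  obtain ⟨u, rfl⟩ := Submodule.Quotient.mk_surjective _ y
  exact ⟨u, by rw [vF, ← Submodule.Quotient.mk_smul, smul_eq_mul, mul_one]⟩

theorem F_isSquareZero : IsSquareZero (F lam mu) := by
  intro x s hs y
  obtain ⟨u, rfl⟩ := F_exists_smul y
  exact killed_of_generator (isHighest_vF.sq_zero sq_vF) u x s hs

theorem F_nilpotent (α : PosRoot) (hα : α ≠ .th) (y : F lam mu) :
    ∃ K, tpow (xm α) 0 ^ K • y = 0 := by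
  obtain ⟨u, rfl⟩ := F_exists_smul y
  exact nilpotent_of_generator α ⟨_, isHighest_vF.int α hα⟩ u

theorem w_eq_dw (a b c : ℕ) : w lam mu a b c = dw (vF lam mu) a b c := rfl

theorem sumSurj_of_highest {I : Type} [DecidableEq I] {ν : I → Wt} {m : ℕ} {x : I → F lam mu}
    {A B : Submodule UCur (F lam mu)} (hA : A = Submodule.span UCur (Set.range x) ⊔ B)
    (he : ∀ i α, α ≠ .th → tpow (xp α) 0 • x i ∈ B)
    (ht : ∀ i y s, 1 ≤ s → tpow y s • x i ∈ B)
    (hw : ∀ i α, α ≠ .th → tpow (hh α) 0 • x i = ((ν i).eval α : ℂ) • x i)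
    (hx : ∀ i, x i ∈ gradeF lam mu m) : SumSurj ν m x A B := by
  have hxA : ∀ i, x i ∈ A := fun i => by
    rw [hA]; exact Submodule.mem_sup_left (Submodule.subset_span ⟨i, rfl⟩)
  set Q := A ⧸ B.submoduleOf A
  let q : I → Q := fun i => Submodule.Quotient.mk ⟨x i, hxA i⟩
  have hmk : ∀ (y : A), (Submodule.Quotient.mk y : Q) = 0 ↔ (y : F lam mu) ∈ B := by
    intro y
    rw [Submodule.Quotient.mk_eq_zero]; rfl
  have hsm : ∀ (u : UCur) (i : I),
      u • q i = Submodule.Quotient.mk ⟨u • x i, A.smul_mem u (hxA i)⟩ :=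
    fun u i => rfl
  -- the classes `q i` generate the subquotient, and each of them is a highest weight vector of an
  -- evaluation module
  have hgen : Submodule.span UCur (Set.range q) = ⊤ := by
    rw [eq_top_iff]
    rintro z -
    obtain ⟨⟨y, hy⟩, rfl⟩ := Submodule.Quotient.mk_surjective _ z
    have hy' := hy
    rw [hA, Submodule.mem_sup] at hy'
    obtain ⟨y1, hy1, y2, hy2, h12⟩ := hy'
    have hspan : Submodule.span UCur (Set.range x) ≤ A := by rw [hA]; exact le_sup_left
    have key : ∀ (y1 : F lam mu) (h1 : y1 ∈ Submodule.span UCur (Set.range x)),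
        (Submodule.Quotient.mk ⟨y1, hspan h1⟩ : Q) ∈ Submodule.span UCur (Set.range q) := by
      intro y1 h1
      induction h1 using Submodule.span_induction with
      | mem y h => obtain ⟨i, rfl⟩ := h; exact Submodule.subset_span ⟨i, rfl⟩
      | zero => exact Submodule.zero_mem _
      | add a b ha hb iha ihb => exact Submodule.add_mem _ iha ihb
      | smul u a ha iha => exact Submodule.smul_mem _ u iha
    have : (Submodule.Quotient.mk ⟨y, hy⟩ : Q) = Submodule.Quotient.mk ⟨y1, hspan hy1⟩ := by
      rw [← sub_eq_zero, ← Submodule.Quotient.mk_sub, hmk]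
      simpa [← h12] using hy2
    rw [this]
    exact key y1 hy1
  have hkill : ∀ y s, 1 ≤ s → ∀ z : Q, tpow y s • z = 0 := by
    intro y s hs z
    have hz : z ∈ Submodule.span UCur (Set.range q) := by rw [hgen]; trivial
    suffices ∀ z ∈ Submodule.span UCur (Set.range q), ∀ y s, 1 ≤ s → tpow y s • z = 0 from
      this z hz y s hs
    intro z hz
    induction hz using Submodule.span_induction with
    | mem z h =>
      obtain ⟨i, rfl⟩ := h
      intro y s hs
      rw [hsm, hmk]
      exact ht i y s hs
    | zero => intro y s _; exact smul_zero _
    | add a b _ _ iha ihb => intro y s hs; rw [smul_add, iha y s hs, ihb y s hs, add_zero]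
    | smul u a _ iha => intro y s hs; exact killed_of_generator iha u y s hs
  have hhigh : ∀ i, IsHighest (q i) (ν i) := by
    intro i
    have he' : ∀ α, α ≠ .th → tpow (xp α) 0 • q i = 0 := fun α hα => by
      rw [hsm, hmk]; exact he i α hα
    have hw' : ∀ α, α ≠ .th → tpow (hh α) 0 • q i = ((ν i).eval α : ℂ) • q i := fun α hα => by
      rw [hsm]
      have := hw i α hα
      simp only [this]
      rfl
    refine ⟨fun α s => ?_, fun α s _ => hkill _ _ (by omega) _, fun α hα => ?_, fun α hα => ?_⟩
    · rcases s with _ | s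
      · by_cases hα : α = .th
        · rw [hα, ← lie_e1_e2]
          have := tpow_smul_comm (xp .al1) (xp .al2) 0 0 (q i)
          rw [he' .al1 (by simp), he' .al2 (by simp), smul_zero, smul_zero, zero_add] at this
          exact this.symm
        · exact he' α hα
      · exact hkill _ _ (by omega) _
    · rw [hw' α hα, algebraMap_smul]
    -- integrability: in `F_{λ,μ}` the operator `x_α⁻` is locally nilpotent, and `sl₂`-theory gives
    -- the exact exponent
    · obtain ⟨K, hK⟩ := F_nilpotent α hα (x i)
      have := sl2_pow_eq_zero (act_ef (M := Q) α) (act_hf_self α) (v := q i) (n := (ν i).eval α)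
        (K := K) (he' α hα) (hw' α hα) (by
          rw [act_pow_apply, hsm, hmk]
          simp only [hK]
          exact B.zero_mem)
      rwa [act_pow_apply] at this
  choose ψ hψ using fun i => exists_evV_lift hkill (hhigh i)
  refine ⟨DirectSum.toModule UCur I Q ψ, fun i => ⟨⟨x i, hxA i⟩, rfl, ?_⟩, fun z => ?_, ?_⟩
  · rw [DirectSum.toModule_lof, hψ]
  · induction z using DirectSum.induction_on with
    | zero => exact ⟨0, ⟨0, Submodule.zero_mem _, by simp⟩, by rw [map_zero]; rfl⟩
    | of i e =>
      obtain ⟨u, hu, rfl⟩ := evV_exists_smul (ν i) e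
      refine ⟨⟨u • x i, A.smul_mem u (hxA i)⟩, ?_, ?_⟩
      · have := smul_mem_gradeF hu (hx i)
        rwa [zero_add] at this
      · rw [← hsm, ← hψ, ← map_smul]
        exact DirectSum.toModule_lof UCur i _
    | add a b ha hb =>
      obtain ⟨y1, h1, h1'⟩ := ha
      obtain ⟨y2, h2, h2'⟩ := hb
      exact ⟨y1 + y2, add_mem_gradeF h1 h2, by rw [map_add, h1', h2']; rfl⟩
  · rw [← LinearMap.range_eq_top, eq_top_iff, ← hgen, Submodule.span_le]
    rintro _ ⟨i, rfl⟩
    exact ⟨DirectSum.lof UCur I _ i (EvV.gen (ν i)), by rw [DirectSum.toModule_lof, hψ]⟩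

/-- A homomorphism of the shape of `IsKerPlus` to `F_{λ',μ'}`, where `λ' + μ' = λ + μ` and the
exponents of `F_{λ',μ'}` are smaller, exists; its kernel is generated by the additional
relations of `F_{λ',μ'}`. -/
theorem exists_quotient_map {lam' mu' : Wt} (hsum : lam + mu = lam' + mu')
    (hmin : ∀ α, minExp lam' mu' α ≤ minExp lam mu α) :
    ∃ φ : F lam mu →ₗ[UCur] F lam' mu', φ (vF lam mu) = vF lam' mu' ∧ Function.Surjective φ ∧
      LinearMap.ker φ = Submodule.span UCur
        (Set.range fun α => tpow (xm α) 1 ^ (minExp lam' mu' α + 1) • vF lam mu) := by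
  obtain ⟨φ, hφ⟩ := exists_lift (lam := lam) (mu := mu) (isTruncated_vF (lam := lam') (mu := mu'))
    hsum.symm hmin
  refine ⟨φ, hφ, ?_, le_antisymm ?_ ?_⟩
  · intro y
    obtain ⟨u, rfl⟩ := F_exists_smul y
    exact ⟨u • vF lam mu, by rw [map_smul, hφ]⟩
  · set K := Submodule.span UCur
        (Set.range fun α => tpow (xm α) 1 ^ (minExp lam' mu' α + 1) • vF lam mu)
    have hT := isTruncated_vF (lam := lam) (mu := mu)
    have hm : IsTruncated (K.mkQ (vF lam mu)) (lam + mu) (minExp lam' mu') :=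
      { pos := fun α s => by rw [← map_smul, hT.pos, map_zero]
        car := fun α s hα => by rw [← map_smul, hT.car α s hα, map_zero]
        wt := fun α hα => by rw [← map_smul, hT.wt α hα, map_smul]
        int := fun α hα => by rw [← map_smul, hT.int α hα, map_zero]
        sq := fun α s hs => by rw [← map_smul, hT.sq α s hs, map_zero]
        nil := fun α => by
          rw [← map_smul, Submodule.mkQ_apply, Submodule.Quotient.mk_eq_zero]
          exact Submodule.subset_span ⟨α, rfl⟩ }
    obtain ⟨ψ, hψ⟩ := exists_lift (lam := lam') (mu := mu') hm hsum fun α => le_rfl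
    intro y hy
    obtain ⟨u, rfl⟩ := F_exists_smul y
    rw [LinearMap.mem_ker, map_smul, hφ] at hy
    have := congrArg ψ hy
    rw [map_smul, hψ, map_zero, ← map_smul, Submodule.mkQ_apply,
      Submodule.Quotient.mk_eq_zero] at this
    exact this
  · rw [Submodule.span_le]
    rintro _ ⟨α, rfl⟩
    change φ _ = 0
    rw [map_smul, hφ]
    exact isTruncated_vF.nil α

end Subquotients

end

noncomputable section

/-! ### An upper bound for the dimension of `V(ν)` -/

section UpperBound

variable {M : Type*} [AddCommGroup M] [Module ℂ M] [Module UCur M] [IsScalarTower ℂ UCur M]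

theorem sl2_e_pow {e f h : Module.End ℂ M} (hef : e * f = f * e + h)
    (hhf : h * f = f * h - (2 : ℂ) • f) {w : M} {k : ℂ} (hw : h w = k • w) (n : ℕ) :
    e ((f ^ n) w) = (f ^ n) (e w) + (n * (k - n + 1)) • (f ^ (n - 1)) w := by
  induction n with
  | zero => simp
  | succ n ih =>
    have := DFunLike.congr_fun hef ((f ^ n) w)
    simp only [Module.End.mul_apply, LinearMap.add_apply, sl2_weight hhf hw, ih, map_add,
      map_smul] at this
    rw [pow_succ', Module.End.mul_apply, this, Nat.add_sub_cancel, Module.End.mul_apply]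
    rcases n with _ | n
    · simp
    · rw [Nat.add_sub_cancel, pow_succ_apply f n w]
      push_cast
      module

/-- The vector `(x_{α₁}⁻)^p (x_θ⁻)^r (x_{α₂}⁻)^q v`. -/
def pbw (v : M) (p r q : ℕ) : M :=
  (act M (xm .al1) 0 ^ p) ((act M (xm .th) 0 ^ r) ((act M (xm .al2) 0 ^ q) v))

/-- The span of the vectors `pbw v p r q` of degree `p + r + q < n`. -/
def pbwLT (v : M) (n : ℕ) : Submodule ℂ M :=
  Submodule.span ℂ {x | ∃ p r q, p + r + q < n ∧ x = pbw v p r q}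

theorem pbw_mem {v : M} {p r q n : ℕ} (h : p + r + q < n) : pbw v p r q ∈ pbwLT v n :=
  Submodule.subset_span ⟨p, r, q, h, rfl⟩

theorem f1_pbw (v : M) (p r q : ℕ) : act M (xm .al1) 0 (pbw v p r q) = pbw v (p + 1) r q := by
  rw [pbw, pow_succ_apply, pbw]

theorem f2_pbw (v : M) (p r q : ℕ) : act M (xm .al2) 0 (pbw v p r q) =
    pbw v p r (q + 1) + (p : ℂ) • pbw v (p - 1) (r + 1) q := by
  have h12 : act M (xm .al2) 0 * act M (xm .al1) 0 =
      act M (xm .al1) 0 * act M (xm .al2) 0 + act M (xm .th) 0 := by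
    rw [act_mul, ← lie_skew, lie_f1_f2, neg_neg]
  have hc1 : Commute (act M (xm .th) 0) (act M (xm .al1) 0) := (act_commute lie_f1_fth 0 0).symm
  have hc2 : Commute (act M (xm .al2) 0) (act M (xm .th) 0) := act_commute lie_f2_fth 0 0
  rw [pbw, ← Module.End.mul_apply, mul_pow_of_commute h12 hc1, LinearMap.add_apply,
    Module.End.mul_apply, ← Module.End.mul_apply (act M (xm .al2) 0), (hc2.pow_right r).eq,
    Module.End.mul_apply, pow_succ_apply, LinearMap.smul_apply, Module.End.mul_apply,
    pow_succ_apply, pbw, pbw]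

variable {v : M} {ν : Wt}

theorem e2_pbw (h : IsHighest v ν) (p r q : ℕ) : act M (xp .al2) 0 (pbw v p r q) =
    (r : ℂ) • pbw v (p + 1) (r - 1) q + ((q : ℂ) * (ν.2 - q + 1)) • pbw v p r (q - 1) := by
  have hc1 : Commute (act M (xp .al2) 0) (act M (xm .al1) 0) := act_commute lie_e2_f1 0 0
  have hc2 : Commute (act M (xm .al1) 0) (act M (xm .th) 0) := act_commute lie_f1_fth 0 0
  have h2 : act M (xp .al2) 0 * act M (xm .th) 0 =
      act M (xm .th) 0 * act M (xp .al2) 0 + act M (xm .al1) 0 := by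
    rw [act_mul, lie_e2_fth]
  have h3 := sl2_e_pow (act_ef (M := M) .al2) (act_hf_self .al2) (w := v) (k := ν.2)
    (by rw [act_apply, h.wt']; rfl) q
  rw [act_apply (xp .al2) 0 v, h.pos, map_zero, zero_add] at h3
  rw [pbw, ← Module.End.mul_apply, (hc1.pow_right p).eq, Module.End.mul_apply,
    ← Module.End.mul_apply (act M (xp .al2) 0), mul_pow_of_commute h2 hc2, LinearMap.add_apply,
    Module.End.mul_apply, h3, LinearMap.smul_apply, (hc2.pow_right (r - 1)).symm.eq,
    Module.End.mul_apply, map_add, map_smul, map_smul, map_smul,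
    ← Module.End.mul_apply (act M (xm .al1) 0 ^ p) (act M (xm .al1) 0),
    ← pow_succ, pbw, pbw, add_comm]

theorem e1_pbw (h : IsHighest v ν) (p r q : ℕ) : ∃ d : ℂ, act M (xp .al1) 0 (pbw v p r q) =
    (-(r : ℂ)) • pbw v p (r - 1) (q + 1) + (p * d) • pbw v (p - 1) r q := by
  have hc1 : Commute (act M (xp .al1) 0) (act M (xm .al2) 0) := act_commute lie_e1_f2 0 0
  have hc2 : Commute (act M (xm .al2) 0) (act M (xm .th) 0) := act_commute lie_f2_fth 0 0
  have h2 : act M (xp .al1) 0 * act M (xm .th) 0 =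
      act M (xm .th) 0 * act M (xp .al1) 0 + -act M (xm .al2) 0 := by
    rw [act_mul, lie_e1_fth, act_neg]
  have hF : ∀ (β : PosRoot) (n : ℕ) (w : M) (k : ℂ), act M (hh .al1) 0 w = k • w →
      act M (hh .al1) 0 ((act M (xm β) 0 ^ n) w) =
        (k - n * cartan β .al1) • (act M (xm β) 0 ^ n) w := by
    intro β n w k hw
    rw [← Module.End.mul_apply, mul_pow_of_weight (act_hf β .al1 0) n, LinearMap.add_apply,
      Module.End.mul_apply, hw, LinearMap.smul_apply, map_smul]
    module
  have h3 := sl2_e_pow (act_ef (M := M) .al1) (act_hf_self .al1)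
    (hF .th r _ _ (hF .al2 q v _ (by rw [act_apply, h.wt' .al1]))) p
  refine ⟨(ν.eval .al1 : ℂ) - q * cartan .al2 .al1 - r * cartan .th .al1 - p + 1, h3.trans ?_⟩
  congr 1
  rw [← Module.End.mul_apply (act M (xp .al1) 0), mul_pow_of_commute h2 hc2.neg_left,
    LinearMap.add_apply, Module.End.mul_apply, ← Module.End.mul_apply (act M (xp .al1) 0),
    (hc1.pow_right q).eq, Module.End.mul_apply, act_apply, h.pos, map_zero, map_zero, zero_add,
    LinearMap.smul_apply, map_smul, Module.End.mul_apply, LinearMap.neg_apply, pow_succ_apply,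
    map_neg, map_neg, pbw, smul_neg, neg_smul]

theorem f_pbwLT (n : ℕ) {x : M} (hx : x ∈ pbwLT v n) (α : PosRoot) (hα : α ≠ .th) :
    act M (xm α) 0 x ∈ pbwLT v (n + 1) := by
  have : pbwLT v n ≤ (pbwLT v (n + 1)).comap (act M (xm α) 0) := by
    refine Submodule.span_le.2 ?_
    rintro _ ⟨p, r, q, hlt, rfl⟩
    rw [SetLike.mem_coe, Submodule.mem_comap]
    cases α with
    | al1 => rw [f1_pbw]; exact pbw_mem (by omega)
    | al2 =>
      rw [f2_pbw]
      refine Submodule.add_mem _ (pbw_mem (by omega)) ?_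
      rcases p with _ | p
      · simp
      · exact Submodule.smul_mem _ _ (pbw_mem (by omega))
    | th => exact absurd rfl hα
  exact this hx

theorem e_pbwLT (h : IsHighest v ν) (n : ℕ) {x : M} (hx : x ∈ pbwLT v n) (α : PosRoot)
    (hα : α ≠ .th) : act M (xp α) 0 x ∈ pbwLT v n := by
  have : pbwLT v n ≤ (pbwLT v n).comap (act M (xp α) 0) := by
    refine Submodule.span_le.2 ?_
    rintro _ ⟨p, r, q, hlt, rfl⟩
    rw [SetLike.mem_coe, Submodule.mem_comap]
    cases α with
    | al1 =>
      obtain ⟨d, hd⟩ := e1_pbw h p r q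
      rw [hd]
      refine Submodule.add_mem _ ?_ (Submodule.smul_mem _ _ (pbw_mem (by omega)))
      rcases r with _ | r
      · simp
      · exact Submodule.smul_mem _ _ (pbw_mem (by omega))
    | al2 =>
      rw [e2_pbw h]
      refine Submodule.add_mem _ ?_ (Submodule.smul_mem _ _ (pbw_mem (by omega)))
      rcases r with _ | r
      · simp
      · exact Submodule.smul_mem _ _ (pbw_mem (by omega))
    | th => exact absurd rfl hα
  exact this hx

theorem pow_f2_eq_zero (h : IsHighest v ν) {q : ℕ} (hq : ν.2 < q) :
    (act M (xm .al2) 0 ^ q) v = 0 := by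
  rw [act_pow_apply]
  exact pow_smul_eq_zero (h.int .al2 (by simp)) hq

/-- `(x_θ⁻)^n v = 0` for `n > ν(h_θ)`: the vector has negative `α₁`-weight, and the corresponding
power of `x_{α₁}⁺` turns it into a multiple of `(x_θ⁻)^{ν₁} (x_{α₂}⁻)^{n - ν₁} v = 0`. -/
theorem pow_fth_eq_zero (h : IsHighest v ν) {n : ℕ} (hn : ν.1 + ν.2 < n) : pbw v 0 n 0 = 0 := by
  have key : ∀ k r q, ∃ d : ℂ, (act M (xp .al1) 0 ^ k) (pbw v 0 (r + k) q) =
      d • pbw v 0 r (q + k) := by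
    intro k
    induction k with
    | zero => intro r q; exact ⟨1, by simp⟩
    | succ k ih =>
      intro r q
      obtain ⟨d, hd⟩ := e1_pbw h 0 (r + k + 1) q
      obtain ⟨d', hd'⟩ := ih r (q + 1)
      refine ⟨-((r + k + 1 : ℕ) : ℂ) * d', ?_⟩
      rw [pow_succ, Module.End.mul_apply, ← add_assoc, hd, Nat.add_sub_cancel]
      simp only [Nat.cast_zero, zero_mul, zero_smul, add_zero, map_smul]
      rw [hd', smul_smul, show q + (k + 1) = q + 1 + k by ring]
  have hmem : pbw v 0 n 0 ∈ (⊥ : Submodule UCur M) := by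
    refine mem_of_neg_weight ⊥ .al1 (p := n - ν.1) ?_ ?_ ?_
    · have hw := mul_pow_of_weight (act_hf (M := M) .th .al1 0) n
      have hw := DFunLike.congr_fun hw v
      simp only [Module.End.mul_apply, LinearMap.add_apply, LinearMap.smul_apply, act_apply,
        h.wt', map_smul] at hw
      have : pbw v 0 n 0 = (act M (xm .th) 0 ^ n) v := by simp [pbw]
      rw [this, hw, ← add_smul, Nat.cast_sub (by omega)]
      simp only [Wt.eval, cartan]
      congr 1
      push_cast
      ring
    · obtain ⟨d, hd⟩ := key (n - ν.1) ν.1 0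
      rw [Nat.add_sub_cancel' (by omega : ν.1 ≤ n), act_pow_apply] at hd
      rw [hd, pbw, zero_add, pow_f2_eq_zero h (by omega)]
      simp
    · have : pbw v 0 n 0 = tpow (xm .th) 0 ^ n • v := by simp [pbw, act_pow_apply]
      rw [this]
      exact nilpotent_of_generator .al1 ⟨_, h.int .al1 (by simp)⟩ _
  simpa using hmem

/-- Straightening: a monomial of degree larger than `ν(h_θ)` is a combination of monomials of
lower degree. -/
theorem pbw_mem_of_degree (h : IsHighest v ν) (p r q : ℕ) (hd : ν.1 + ν.2 < p + r + q) :
    pbw v p r q ∈ pbwLT v (p + r + q) := by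
  have h1 : ∀ p r, ν.1 + ν.2 < p + r → pbw v p r 0 ∈ pbwLT v (p + r) := by
    intro p
    induction p with
    | zero => intro r hr; rw [pow_fth_eq_zero h (by omega)]; exact Submodule.zero_mem _
    | succ p ih =>
      -- `x_{α₂}⁺` replaces one `x_θ⁻` by `x_{α₁}⁻`
      intro r hr
      have h2 := e_pbwLT h _ (ih (r + 1) (by omega)) .al2 (by simp)
      rw [e2_pbw h] at h2
      simp only [Nat.add_sub_cancel, Nat.cast_zero, zero_mul, zero_smul, add_zero] at h2
      have h3 := Submodule.smul_mem _ (((r + 1 : ℕ) : ℂ)⁻¹) h2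
      rw [smul_smul, inv_mul_cancel₀ (Nat.cast_ne_zero.2 (Nat.succ_ne_zero r)), one_smul] at h3
      rwa [show p + 1 + r = p + (r + 1) by ring]
  induction q generalizing r with
  | zero => exact h1 p r hd
  | succ q ih =>
    -- `x_{α₁}⁺` replaces one `x_θ⁻` by `x_{α₂}⁻`, up to terms of lower degree
    have h2 := e_pbwLT h _ (ih (r + 1) (by omega)) .al1 (by simp)
    obtain ⟨d, hd'⟩ := e1_pbw h p (r + 1) q
    rw [hd', Nat.add_sub_cancel] at h2
    have h4 : (p * d : ℂ) • pbw v (p - 1) (r + 1) q ∈ pbwLT v (p + (r + 1) + q) := by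
      rcases p with _ | p
      · simp
      · exact Submodule.smul_mem _ _ (pbw_mem (by omega))
    have h3 := Submodule.smul_mem _ ((-((r + 1 : ℕ) : ℂ))⁻¹)
      ((Submodule.add_mem_iff_left _ h4).1 h2)
    rw [smul_smul, inv_mul_cancel₀ (neg_ne_zero.2 (Nat.cast_ne_zero.2 (Nat.succ_ne_zero r))),
      one_smul] at h3
    rwa [show p + r + (q + 1) = p + (r + 1) + q by ring]

/-- Straightening: `(x_{α₁}⁻)^p` with `p > ν₁` may be moved to the right, modulo lower degree. -/
theorem pbw_mem_of_left (h : IsHighest v ν) (p r q : ℕ) (hp : ν.1 < p) :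
    pbw v p r q ∈ pbwLT v (p + r + q) := by
  induction q with
  | zero =>
    have hc : Commute (act M (xm .al1) 0) (act M (xm .th) 0) := act_commute lie_f1_fth 0 0
    have : pbw v p r 0 = 0 := by
      rw [pbw, pow_zero, Module.End.one_apply, ← Module.End.mul_apply, (hc.pow_pow p r).eq,
        Module.End.mul_apply, act_pow_apply _ _ p,
        pow_smul_eq_zero (h.int .al1 (by simp)) hp, map_zero]
    rw [this]; exact Submodule.zero_mem _
  | succ q ih =>
    have h1 := f_pbwLT _ ih .al2 (by simp)
    rw [f2_pbw] at h1
    refine (Submodule.add_mem_iff_left _ ?_).1 h1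
    rcases p with _ | p
    · simp
    · exact Submodule.smul_mem _ _ (pbw_mem (by omega))

/-- The exponents of the Feigin–Fourier–Littelmann basis of `V(ν)`:
`p ≤ ν₁`, `q ≤ ν₂` and `p + q + r ≤ ν₁ + ν₂`. -/
def fflExponents (ν : Wt) : Finset ((_ : ℕ × ℕ) × ℕ) :=
  (Finset.range (ν.1 + 1) ×ˢ Finset.range (ν.2 + 1)).sigma
    fun pq => Finset.range (ν.1 + ν.2 + 1 - pq.1 - pq.2)

theorem card_fflExponents (ν : Wt) :
    2 * (fflExponents ν).card = (ν.1 + 1) * (ν.2 + 1) * (ν.1 + ν.2 + 2) := by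
  have h1 : ∀ (C : ℤ) (n : ℕ), 2 * ∑ q ∈ Finset.range n, (C - q) = n * (2 * C - n + 1) := by
    intro C n
    induction n with
    | zero => simp
    | succ n ih => rw [Finset.sum_range_succ, mul_add, ih]; push_cast; ring
  have h2 : ∀ (C : ℤ) (k n : ℕ), 2 * ∑ p ∈ Finset.range n, ∑ q ∈ Finset.range k, (C - p - q) =
      n * k * (2 * C - k - n + 2) := by
    intro C k n
    induction n with
    | zero => simp
    | succ n ih => rw [Finset.sum_range_succ, mul_add, ih, h1]; push_cast; ring
  have h3 : ((fflExponents ν).card : ℤ) = ∑ p ∈ Finset.range (ν.1 + 1),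
      ∑ q ∈ Finset.range (ν.2 + 1), (((ν.1 + ν.2 + 1 : ℕ) : ℤ) - p - q) := by
    rw [fflExponents, Finset.card_sigma, Finset.sum_product]
    push_cast
    refine Finset.sum_congr rfl fun p hp => Finset.sum_congr rfl fun q hq => ?_
    rw [Finset.mem_range] at hp hq
    rw [Finset.card_range]
    omega
  have h4 := h2 ((ν.1 + ν.2 + 1 : ℕ) : ℤ) (ν.2 + 1) (ν.1 + 1)
  rw [← h3] at h4
  have : (2 * (fflExponents ν).card : ℤ) = (ν.1 + 1) * (ν.2 + 1) * (ν.1 + ν.2 + 2) := by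
    rw [h4]; push_cast; ring
  exact_mod_cast this

/-- A cyclic module generated by a highest weight vector of weight `ν` on which `sl₃ ⊗ tℂ[t]`
acts by zero has at most the dimension given by Weyl's formula. -/
theorem finrank_le_of_isHighest (h : IsHighest v ν) (hgen : ∀ m : M, ∃ u : UCur, m = u • v)
    (hk : ∀ x s, 1 ≤ s → ∀ m : M, tpow x s • m = 0) :
    Module.Finite ℂ M ∧
      2 * Module.finrank ℂ M ≤ (ν.1 + 1) * (ν.2 + 1) * (ν.1 + ν.2 + 2) := by
  classical
  set S : Finset M := (fflExponents ν).image fun t => pbw v t.1.1 t.2 t.1.2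
  -- by induction on the degree, the straightening rules reduce every monomial to those in `S`
  have hS : ∀ n, pbwLT v n ≤ Submodule.span ℂ (S : Set M) := by
    intro n
    induction n with
    | zero =>
      refine Submodule.span_le.2 ?_
      rintro _ ⟨p, r, q, hlt, rfl⟩
      omega
    | succ n ih =>
      refine Submodule.span_le.2 ?_
      rintro _ ⟨p, r, q, hlt, rfl⟩
      rcases Nat.lt_or_ge (p + r + q) n with hn | hn
      · exact ih (pbw_mem hn)
      · obtain rfl : n = p + r + q := by omega
        by_cases hp : ν.1 < p
        · exact ih (pbw_mem_of_left h p r q hp)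
        by_cases hq : ν.2 < q
        · rw [pbw, pow_f2_eq_zero h hq]; simp
        by_cases hd : ν.1 + ν.2 < p + r + q
        · exact ih (pbw_mem_of_degree h p r q hd)
        refine Submodule.subset_span (Finset.mem_image.2 ⟨⟨(p, q), r⟩, ?_, rfl⟩)
        simp only [fflExponents, Finset.mem_sigma, Finset.mem_product, Finset.mem_range]
        omega
  have hmem : ∀ p r q, pbw v p r q ∈ Submodule.span ℂ (S : Set M) := fun p r q =>
    hS (p + r + q + 1) (pbw_mem (by omega))
  -- the span of `S` is the span of all monomials, and so it is stable under `sl₃`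
  have hSle : Submodule.span ℂ (S : Set M) ≤ pbwLT v (ν.1 + ν.2 + 1) := by
    refine Submodule.span_le.2 fun x hx => ?_
    obtain ⟨t, ht, rfl⟩ := Finset.mem_image.1 hx
    simp only [fflExponents, Finset.mem_sigma, Finset.mem_product, Finset.mem_range] at ht
    exact pbw_mem (by omega)
  have htop : Submodule.span ℂ (S : Set M) = ⊤ := by
    rw [eq_top_iff]
    rintro m -
    obtain ⟨u, rfl⟩ := hgen m
    refine smul_mem_of_tpow _ (fun x s m hm => ?_) u v (by simpa [pbw] using hmem 0 0 0)
    rcases s with _ | s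
    · exact smul_mem_of_simple _
        (fun α hα m hm => hS _ (e_pbwLT h _ (hSle hm) α hα))
        (fun α hα m hm => hS _ (f_pbwLT _ (hSle hm) α hα)) x m hm
    · rw [hk _ _ (by omega)]; exact Submodule.zero_mem _
  have hfin : Module.Finite ℂ M := ⟨⟨S, htop⟩⟩
  refine ⟨hfin, ?_⟩
  rw [← card_fflExponents]
  refine Nat.mul_le_mul_left 2 ?_
  rw [← finrank_top ℂ M, ← htop]
  exact (finrank_span_finset_le_card S).trans Finset.card_image_le

end UpperBound

instance finite_evV (ν : Wt) : Module.Finite ℂ (EvV ν) :=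
  (finrank_le_of_isHighest (isHighest_gen ν)
    (fun m => let ⟨u, _, hu⟩ := evV_exists_smul ν m; ⟨u, hu⟩) (evV_killed ν)).1

theorem finrank_evV (ν : Wt) : Module.finrank ℂ (EvV ν) = Module.finrank ℂ (V ν) := rfl

theorem finrank_evV_le (ν : Wt) :
    2 * Module.finrank ℂ (EvV ν) ≤ (ν.1 + 1) * (ν.2 + 1) * (ν.1 + ν.2 + 2) :=
  (finrank_le_of_isHighest (isHighest_gen ν)
    (fun m => let ⟨u, _, hu⟩ := evV_exists_smul ν m; ⟨u, hu⟩) (evV_killed ν)).2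

end

noncomputable section

/-! ### A lower bound for the dimension of `F_{λ,μ}`: the fusion product -/

section Fusion

theorem ef_gen (ν : Wt) (α : PosRoot) (s j : ℕ) :
    ((j < s ∨ ν.eval α < s) → tpow (xp α) 0 ^ s • tpow (xm α) 0 ^ j • EvV.gen ν = 0) ∧
    ∃ c : ℂ, tpow (xp α) 0 ^ s • tpow (xm α) 0 ^ (j + s) • EvV.gen ν =
      c • tpow (xm α) 0 ^ j • EvV.gen ν := by
  have h := isHighest_gen ν
  have hprim : ∀ k : ℕ, tpow (xp α) 0 • tpow (xm α) 0 ^ (k + 1) • EvV.gen ν =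
      ((k + 1) * ((ν.eval α : ℂ) - k)) • tpow (xm α) 0 ^ k • EvV.gen ν := by
    intro k
    have := sl2_primitive (act_ef (M := EvV ν) α) (act_hf_self α) (v := EvV.gen ν) (h.pos α 0)
      (h.wt' α) k
    rwa [act_pow_apply, act_pow_apply] at this
  have hlt : ∀ s j, j < s → tpow (xp α) 0 ^ s • tpow (xm α) 0 ^ j • EvV.gen ν = 0 := by
    intro s
    induction s with
    | zero => intro j hj; omega
    | succ s ih =>
      intro j hj
      rcases j with _ | j
      · rw [pow_zero, one_smul, pow_succ, mul_smul, h.pos, smul_zero]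
      · rw [pow_succ, mul_smul, hprim, smul_comm, ih j (by omega), smul_zero]
  refine ⟨fun hs => ?_, ?_⟩
  · rcases Nat.lt_or_ge j s with hj | hj
    · exact hlt s j hj
    · have hs : ν.eval α < j := by omega
      have : tpow (xm α) 0 ^ j • EvV.gen ν = 0 := by
        cases α with
        | al1 => exact pow_smul_eq_zero (h.int .al1 (by simp)) hs
        | al2 => exact pow_smul_eq_zero (h.int .al2 (by simp)) hs
        | th => simpa [pbw, act_pow_apply] using pow_fth_eq_zero h hs
      rw [this, smul_zero]
  · induction s with
    | zero => exact ⟨1, by simp⟩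
    | succ s ih =>
      obtain ⟨c, hc⟩ := ih
      refine ⟨((j + s : ℕ) + 1) * ((ν.eval α : ℂ) - (j + s : ℕ)) * c, ?_⟩
      rw [pow_succ, mul_smul, ← add_assoc, hprim, smul_comm, hc, smul_smul]

variable (lam mu : Wt)

/-- The space `ℂ[X] ⊗ V(λ) ⊗ V(μ)`: a family of `sl₃[t]`-modules with parameter `X`, in which `t`
acts on the first factor by `0` and on the second one by `X`. -/
abbrev FusionSpace : Type := ℂ[X] ⊗[ℂ] (EvV lam ⊗[ℂ] EvV mu)

/-- The action of the enveloping algebra on the first factor. -/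
def actL : UCur →ₐ[ℂ] Module.End ℂ[X] (FusionSpace lam mu) :=
  (Module.End.baseChangeHom ℂ ℂ[X] (EvV lam ⊗[ℂ] EvV mu)).comp
    ((Module.End.rTensorAlgHom ℂ (EvV lam) (EvV mu)).comp (Algebra.lsmul ℂ ℂ (EvV lam)))

/-- The action of the enveloping algebra on the second factor. -/
def actR : UCur →ₐ[ℂ] Module.End ℂ[X] (FusionSpace lam mu) :=
  (Module.End.baseChangeHom ℂ ℂ[X] (EvV lam ⊗[ℂ] EvV mu)).comp
    ((Module.End.lTensorAlgHom ℂ (EvV mu) (EvV lam)).comp (Algebra.lsmul ℂ ℂ (EvV mu)))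

theorem actL_tmul (u : UCur) (p : ℂ[X]) (a : EvV lam) (b : EvV mu) :
    actL lam mu u (p ⊗ₜ (a ⊗ₜ b)) = p ⊗ₜ ((u • a) ⊗ₜ b) := rfl

theorem actR_tmul (u : UCur) (p : ℂ[X]) (a : EvV lam) (b : EvV mu) :
    actR lam mu u (p ⊗ₜ (a ⊗ₜ b)) = p ⊗ₜ (a ⊗ₜ (u • b)) := rfl

theorem actL_commute_actR (u u' : UCur) : Commute (actL lam mu u) (actR lam mu u') := by
  refine TensorProduct.AlgebraTensorModule.ext fun p y => ?_
  induction y using TensorProduct.induction_on with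
  | zero => simp
  | add a b ha hb => rw [TensorProduct.tmul_add, map_add, map_add, ha, hb]
  | tmul a b => simp only [Module.End.mul_apply, actL_tmul, actR_tmul]

theorem actL_tpow_succ (x : Sl3) (s : ℕ) : actL lam mu (tpow x (s + 1)) = 0 := by
  have : Algebra.lsmul ℂ ℂ (EvV lam) (tpow x (s + 1)) = 0 := by
    ext m; exact evV_killed lam x _ (by omega) m
  simp [actL, this]

section

attribute [local instance 100] LieRing.ofAssociativeRing

/-- The action of the current algebra on the fusion space: `x ⊗ f` acts as
`f(0) (x ⊗ 1) + f(X) (1 ⊗ x)`. -/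
def fusionLie : Cur →ₗ⁅ℂ⁆ Module.End ℂ[X] (FusionSpace lam mu) :=
  { ((actL lam mu).toLinearMap ∘ₗ (UniversalEnvelopingAlgebra.ι ℂ (L := Cur) : Cur →ₗ[ℂ] UCur)) +
      (LinearMap.liftBaseChange ℂ[X]
        ((actR lam mu).toLinearMap ∘ₗ tpowₗ 0)).restrictScalars ℂ with
    map_lie' := by
      intro x y
      have hR : ∀ x y : Cur, LinearMap.liftBaseChange ℂ[X]
          ((actR lam mu).toLinearMap ∘ₗ tpowₗ 0)
            (@Bracket.bracket Cur Cur LieRing.toBracket x y) =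
          LinearMap.liftBaseChange ℂ[X] ((actR lam mu).toLinearMap ∘ₗ tpowₗ 0) x *
          LinearMap.liftBaseChange ℂ[X] ((actR lam mu).toLinearMap ∘ₗ tpowₗ 0) y -
          LinearMap.liftBaseChange ℂ[X] ((actR lam mu).toLinearMap ∘ₗ tpowₗ 0) y *
          LinearMap.liftBaseChange ℂ[X] ((actR lam mu).toLinearMap ∘ₗ tpowₗ 0) x := by
        intro x y
        induction x using TensorProduct.induction_on with
        | zero =>
          refine (congrArg _ (zero_lie (L := Cur) (M := Cur) y)).trans ?_
          simp only [map_zero, zero_mul, mul_zero]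
          exact (sub_zero (0 : Module.End ℂ[X] (FusionSpace lam mu))).symm
        | add a b ha hb =>
          refine (congrArg _ (add_lie (L := Cur) (M := Cur) a b y)).trans ?_
          rw [map_add, ha, hb, map_add]
          noncomm_ring
        | tmul f a =>
          induction y using TensorProduct.induction_on with
          | zero =>
            refine (congrArg _ (lie_zero (L := Cur) (M := Cur) (f ⊗ₜ[ℂ] a))).trans ?_
            simp only [map_zero, zero_mul, mul_zero]
            exact (sub_zero (0 : Module.End ℂ[X] (FusionSpace lam mu))).symm
          | add c d hc hd =>
            refine (congrArg _ (lie_add (L := Cur) (M := Cur) (f ⊗ₜ[ℂ] a) c d)).trans ?_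
            rw [map_add, hc, hd, map_add]
            noncomm_ring
          | tmul g b =>
            rw [LieAlgebra.ExtendScalars.bracket_tmul]
            simp only [LinearMap.liftBaseChange_tmul, LinearMap.comp_apply, AlgHom.toLinearMap_apply,
              smul_mul_smul_comm]
            have e : tpowₗ 0 ⁅a, b⁆ = tpowₗ 0 a * tpowₗ 0 b - tpowₗ 0 b * tpowₗ 0 a := by
              change tpow ⁅a, b⁆ 0 = tpow a 0 * tpow b 0 - tpow b 0 * tpow a 0
              rw [tpow_mul_comm a b, add_zero, add_sub_cancel_left]
            rw [mul_comm g f, e, map_sub, map_mul, map_mul]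
            exact smul_sub _ _ _
      have hC : ∀ (u : UCur) (y : Cur), Commute (actL lam mu u)
          (LinearMap.liftBaseChange ℂ[X] ((actR lam mu).toLinearMap ∘ₗ tpowₗ 0) y) := by
        intro u y
        induction y using TensorProduct.induction_on with
        | zero => simp
        | add c d hc hd => rw [map_add]; exact hc.add_right hd
        | tmul g b =>
          rw [LinearMap.liftBaseChange_tmul]
          exact (actL_commute_actR lam mu u (tpow b 0)).smul_right g
      simp only [AddHom.toFun_eq_coe, LinearMap.coe_toAddHom, LinearMap.add_apply,
        LinearMap.comp_apply, LinearMap.restrictScalars_apply, hR, AlgHom.toLinearMap_apply,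
        LieHom.coe_toLinearMap, LieHom.map_lie, LieRing.of_associative_ring_bracket, map_sub,
        map_mul, mul_add, add_mul]
      rw [(hC (UniversalEnvelopingAlgebra.ι ℂ x) y).eq, (hC (UniversalEnvelopingAlgebra.ι ℂ y) x).eq]
      abel }

/-- The action of `U(sl₃[t])` on the fusion space. -/
def fusionAct : UCur →ₐ[ℂ] Module.End ℂ[X] (FusionSpace lam mu) :=
  UniversalEnvelopingAlgebra.lift ℂ (fusionLie lam mu)

theorem fusionAct_tpow (x : Sl3) (s : ℕ) : fusionAct lam mu (tpow x s) =
    actL lam mu (tpow x s) + (Polynomial.X : ℂ[X]) ^ s • actR lam mu (tpow x 0) := by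
  have : fusionAct lam mu (tpow x s) = fusionLie lam mu (((Polynomial.X : ℂ[X]) ^ s) ⊗ₜ[ℂ] x) := by
    rw [fusionAct, tpow, UniversalEnvelopingAlgebra.lift_ι_apply]
  rw [this]
  change actL lam mu (tpow x s) + LinearMap.liftBaseChange ℂ[X]
    ((actR lam mu).toLinearMap ∘ₗ tpowₗ 0) (((Polynomial.X : ℂ[X]) ^ s) ⊗ₜ[ℂ] x) = _
  rw [LinearMap.liftBaseChange_tmul]
  rfl

end

theorem fusionAct_zero (x : Sl3) : fusionAct lam mu (tpow x 0) =
    actL lam mu (tpow x 0) + actR lam mu (tpow x 0) := by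
  rw [fusionAct_tpow, pow_zero, one_smul]

theorem fusionAct_succ (x : Sl3) (s : ℕ) : fusionAct lam mu (tpow x (s + 1)) =
    (Polynomial.X : ℂ[X]) ^ (s + 1) • actR lam mu (tpow x 0) := by
  rw [fusionAct_tpow, actL_tpow_succ, zero_add]

/-- The product of the highest weight generators. -/
def fusionGen : FusionSpace lam mu := 1 ⊗ₜ (EvV.gen lam ⊗ₜ EvV.gen mu)

/-- The `ℂ[X]`-lattice generated by the action of `U(sl₃[t])` on the generator. Its fibre at
`X = 0` is the fusion product of `V(λ)` and `V(μ)`. -/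
def fusionLattice : Submodule ℂ[X] (FusionSpace lam mu) :=
  Submodule.span ℂ[X] (Set.range fun u : UCur => fusionAct lam mu u (fusionGen lam mu))

variable {lam mu}

theorem fusionAct_mem (u : UCur) {n : FusionSpace lam mu} (hn : n ∈ fusionLattice lam mu) :
    fusionAct lam mu u n ∈ fusionLattice lam mu := by
  induction hn using Submodule.span_induction with
  | mem n h =>
    obtain ⟨u', rfl⟩ := h
    exact Submodule.subset_span ⟨u * u', by simp only [map_mul, Module.End.mul_apply]⟩
  | zero => rw [map_zero]; exact Submodule.zero_mem _
  | add a b _ _ ha hb => rw [map_add]; exact Submodule.add_mem _ ha hb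
  | smul p a _ ha => rw [map_smul]; exact Submodule.smul_mem _ p ha

theorem fusionGen_mem : fusionGen lam mu ∈ fusionLattice lam mu :=
  Submodule.subset_span ⟨1, by simp⟩

theorem actLR_pow_gen (x y : Sl3) (i j : ℕ) :
    (actL lam mu (tpow x 0) ^ i) ((actR lam mu (tpow y 0) ^ j) (fusionGen lam mu)) =
      1 ⊗ₜ ((tpow x 0 ^ i • EvV.gen lam) ⊗ₜ (tpow y 0 ^ j • EvV.gen mu)) := by
  rw [← map_pow, ← map_pow, fusionGen, actR_tmul, actL_tmul]

/-- The powers of `x_α⁻` on the generator, by the binomial formula. -/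
theorem fusionAct_pow_gen (α : PosRoot) (n : ℕ) :
    fusionAct lam mu (tpow (xm α) 0 ^ n) (fusionGen lam mu) =
      ∑ i ∈ Finset.range (n + 1), (n.choose i : ℂ[X]) •
        (1 ⊗ₜ ((tpow (xm α) 0 ^ i • EvV.gen lam) ⊗ₜ (tpow (xm α) 0 ^ (n - i) • EvV.gen mu)) :
          FusionSpace lam mu) := by
  rw [map_pow, fusionAct_zero, (actL_commute_actR lam mu _ _).add_pow, LinearMap.sum_apply]
  refine Finset.sum_congr rfl fun i _ => ?_
  rw [(Nat.cast_commute _ _).symm.eq, Module.End.mul_apply, Module.End.mul_apply, actLR_pow_gen]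
  simp [Nat.cast_smul_eq_nsmul]

theorem smul_actR_mem {α : PosRoot} (j : ℕ) :
    (Polynomial.X : ℂ[X]) ^ j • (actR lam mu (tpow (xm α) 0) ^ j) (fusionGen lam mu) ∈
      fusionLattice lam mu := by
  have h := fusionAct_mem (tpow (xm α) 1 ^ j) (fusionGen_mem (lam := lam) (mu := mu))
  rw [map_pow, fusionAct_succ, zero_add, pow_one, smul_pow] at h
  exact h

theorem X_smul_actL_mem (x : Sl3) {n : FusionSpace lam mu} (hn : n ∈ fusionLattice lam mu) :
    (Polynomial.X : ℂ[X]) • actL lam mu (tpow x 0) n ∈ fusionLattice lam mu := by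
  have h0 := Submodule.smul_mem _ (Polynomial.X : ℂ[X]) (fusionAct_mem (tpow x 0) hn)
  have h1 := fusionAct_mem (tpow x 1) hn
  rw [fusionAct_succ, zero_add, pow_one] at h1
  rw [fusionAct_zero] at h0
  have := Submodule.sub_mem _ h0 h1
  rwa [LinearMap.add_apply, smul_add, LinearMap.smul_apply, add_sub_cancel_right] at this

theorem smul_actLR_mem (α : PosRoot) (i j : ℕ) :
    (Polynomial.X : ℂ[X]) ^ (i + j) •
      (1 ⊗ₜ ((tpow (xm α) 0 ^ i • EvV.gen lam) ⊗ₜ (tpow (xm α) 0 ^ j • EvV.gen mu)) :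
        FusionSpace lam mu) ∈ fusionLattice lam mu := by
  rw [← actLR_pow_gen]
  induction i with
  | zero => simpa using smul_actR_mem j
  | succ i ih =>
    have := X_smul_actL_mem (xm α) ih
    rwa [map_smul, smul_smul, ← Module.End.mul_apply, ← pow_succ', ← pow_succ',
      show i + j + 1 = i + 1 + j by ring] at this

/-- The multiples of `X` in the lattice. -/
def fusionFibre (lam mu : Wt) : Submodule ℂ[X] (FusionSpace lam mu) :=
  (fusionLattice lam mu).map (LinearMap.lsmul ℂ[X] (FusionSpace lam mu) Polynomial.X)

theorem X_smul_mem {n : FusionSpace lam mu} (hn : n ∈ fusionLattice lam mu) :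
    (Polynomial.X : ℂ[X]) • n ∈ fusionFibre lam mu := ⟨n, hn, rfl⟩

theorem fusionAct_mem_fibre (u : UCur) {n : FusionSpace lam mu} (hn : n ∈ fusionFibre lam mu) :
    fusionAct lam mu u n ∈ fusionFibre lam mu := by
  obtain ⟨y, hy, rfl⟩ := hn
  rw [LinearMap.lsmul_apply, map_smul]
  exact X_smul_mem (fusionAct_mem u hy)

theorem actR_pow_e_gen (α : PosRoot) (s i j : ℕ) :
    (actR lam mu (tpow (xp α) 0) ^ s)
      (1 ⊗ₜ ((tpow (xm α) 0 ^ i • EvV.gen lam) ⊗ₜ (tpow (xm α) 0 ^ j • EvV.gen mu))) =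
    1 ⊗ₜ ((tpow (xm α) 0 ^ i • EvV.gen lam) ⊗ₜ
      (tpow (xp α) 0 ^ s • tpow (xm α) 0 ^ j • EvV.gen mu)) := by
  rw [← map_pow, actR_tmul]

theorem actL_pow_e_gen (α : PosRoot) (s i j : ℕ) :
    (actL lam mu (tpow (xp α) 0) ^ s)
      (1 ⊗ₜ ((tpow (xm α) 0 ^ i • EvV.gen lam) ⊗ₜ (tpow (xm α) 0 ^ j • EvV.gen mu))) =
    1 ⊗ₜ ((tpow (xp α) 0 ^ s • tpow (xm α) 0 ^ i • EvV.gen lam) ⊗ₜ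
      (tpow (xm α) 0 ^ j • EvV.gen mu)) := by
  rw [← map_pow, actL_tmul]

/-- `x_α⁺ ⊗ t = (x_α⁺ ⊗ (t - X)) + X (x_α⁺ ⊗ 1)`, and `x_α⁺ ⊗ (t - X)` acts on the first factor
only, so that it may replace `x_α⁺ ⊗ t` modulo the multiples of `X`. -/
theorem fusionAct_e_pow (x : Sl3) (s : ℕ) {n : FusionSpace lam mu}
    (hn : n ∈ fusionLattice lam mu) :
    (-(Polynomial.X : ℂ[X])) ^ s • (actL lam mu (tpow x 0) ^ s) n ∈ fusionLattice lam mu ∧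
    fusionAct lam mu (tpow x 1 ^ s) n -
      (-(Polynomial.X : ℂ[X])) ^ s • (actL lam mu (tpow x 0) ^ s) n ∈ fusionFibre lam mu := by
  induction s with
  | zero => simpa using hn
  | succ s ih =>
    obtain ⟨h1, h2⟩ := ih
    set n' := (-(Polynomial.X : ℂ[X])) ^ s • (actL lam mu (tpow x 0) ^ s) n
    have e : (-(Polynomial.X : ℂ[X])) ^ (s + 1) • (actL lam mu (tpow x 0) ^ (s + 1)) n =
        -((Polynomial.X : ℂ[X]) • actL lam mu (tpow x 0) n') := by
      rw [map_smul, smul_smul, ← Module.End.mul_apply, ← pow_succ', ← neg_smul, ← neg_mul,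
        ← pow_succ']
    rw [e]
    refine ⟨Submodule.neg_mem _ (X_smul_actL_mem x h1), ?_⟩
    have h3 := fusionAct_mem_fibre (tpow x 1) h2
    have h4 := X_smul_mem (fusionAct_mem (tpow x 0) h1)
    have := Submodule.add_mem _ h3 h4
    rw [map_sub, ← Module.End.mul_apply, ← map_mul, ← pow_succ', fusionAct_zero,
      LinearMap.add_apply, smul_add] at this
    have h5 : fusionAct lam mu (tpow x 1) n' =
        (Polynomial.X : ℂ[X]) • actR lam mu (tpow x 0) n' := by
      rw [fusionAct_succ, zero_add, pow_one, LinearMap.smul_apply]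
    rw [h5] at this
    convert this using 1
    abel

/-- The defining relations of `F_{λ,μ}` hold in the fusion product. -/
theorem fusion_relations {u : UCur} (hu : u ∈ cvRelations (lam + mu) (pairPartition lam mu)) :
    fusionAct lam mu u (fusionGen lam mu) ∈ fusionFibre lam mu := by
  have hA := isHighest_gen lam
  have hB := isHighest_gen mu
  have hL : ∀ x, actL lam mu (tpow x 0) (fusionGen lam mu) =
    1 ⊗ₜ ((tpow x 0 • EvV.gen lam) ⊗ₜ EvV.gen mu) := fun _ => rfl
  have hR : ∀ x, actR lam mu (tpow x 0) (fusionGen lam mu) =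
    1 ⊗ₜ (EvV.gen lam ⊗ₜ (tpow x 0 • EvV.gen mu)) := fun _ => rfl
  rcases hu with ((⟨α, s, rfl⟩ | ⟨α, s, hα, rfl⟩) | ⟨α, hα, rfl⟩) |
    ⟨α, r, s, k, hr, hs, hk, hle, rfl⟩
  · rw [fusionAct_tpow, LinearMap.add_apply, LinearMap.smul_apply, hR, hB.pos]
    rcases s with _ | s
    · rw [hL, hA.pos]; simp
    · rw [actL_tpow_succ]; simp
  · rcases s with _ | s
    · rw [if_pos rfl, map_sub, LinearMap.sub_apply, fusionAct_zero, LinearMap.add_apply, hL, hR,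
        hA.wt' α, hB.wt' α, AlgHom.commutes, Module.algebraMap_end_apply, fusionGen]
      have : (((lam + mu).eval α : ℕ) : ℂ) = (lam.eval α : ℂ) + mu.eval α := by
        cases α <;> simp [Wt.eval]
        ring
      rw [this]
      simp only [← TensorProduct.smul_tmul', TensorProduct.tmul_smul, add_smul, sub_self]
      exact Submodule.zero_mem _
    · rw [if_neg (Nat.succ_ne_zero s), map_zero, sub_zero, fusionAct_succ, LinearMap.smul_apply,
        pow_succ', mul_smul]
      refine X_smul_mem ?_
      rw [hR, hB.wt' α, TensorProduct.tmul_smul, TensorProduct.tmul_smul]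
      exact Submodule.smul_mem _ _ (Submodule.smul_of_tower_mem _ _ fusionGen_mem)
  · rw [fusionAct_pow_gen]
    refine Submodule.sum_mem _ fun i hi => ?_
    have : (lam + mu).eval α = lam.eval α + mu.eval α := by
      cases α <;> simp [Wt.eval]
      ring
    rcases Nat.lt_or_ge (lam.eval α) i with h | h
    · rw [pow_smul_eq_zero (hA.int α hα) h]; simp
    · rw [pow_smul_eq_zero (hB.int α hα) (by omega)]; simp
  · have hred : fusionAct lam mu (divPow (tpow (xp α) 1) s * divPow (tpow (xm α) 0) (r + s))
        (fusionGen lam mu) = ((s.factorial : ℂ)⁻¹ * ((r + s).factorial : ℂ)⁻¹) •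
        fusionAct lam mu (tpow (xp α) 1 ^ s)
          (fusionAct lam mu (tpow (xm α) 0 ^ (r + s)) (fusionGen lam mu)) := by
      rw [divPow, divPow, smul_mul_smul_comm, map_smul, LinearMap.smul_apply, map_mul,
        Module.End.mul_apply]
    rw [hred]
    refine Submodule.smul_of_tower_mem _ _ ?_
    have hmem := fusionAct_mem (tpow (xm α) 0 ^ (r + s)) (fusionGen_mem (lam := lam) (mu := mu))
    have hE : ∀ n : FusionSpace lam mu, fusionAct lam mu (tpow (xp α) 1 ^ s) n =
        (Polynomial.X : ℂ[X]) ^ s • (actR lam mu (tpow (xp α) 0) ^ s) n := by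
      intro n
      rw [map_pow, fusionAct_succ, zero_add, pow_one, smul_pow, LinearMap.smul_apply]
    -- `(x_α⁺ ⊗ t)^s` agrees with `X^s (1 ⊗ x_α⁺)^s`, and modulo `X` also with
    -- `(-X)^s (x_α⁺ ⊗ 1)^s`; one of the two vanishes if `s` exceeds `λ(h_α)` or `μ(h_α)`
    by_cases hmin : min (lam.eval α) (mu.eval α) < s
    · rcases min_lt_iff.1 hmin with h | h
      · have := (fusionAct_e_pow (xp α) s hmem).2
        have h0 : (actL lam mu (tpow (xp α) 0) ^ s)
            (fusionAct lam mu (tpow (xm α) 0 ^ (r + s)) (fusionGen lam mu)) = 0 := by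
          rw [fusionAct_pow_gen, map_sum]
          refine Finset.sum_eq_zero fun i _ => ?_
          rw [map_smul, actL_pow_e_gen, (ef_gen lam α s i).1 (Or.inr h)]
          simp
        rwa [h0, smul_zero, sub_zero] at this
      · rw [hE, fusionAct_pow_gen, map_sum, Finset.sum_eq_zero fun i _ => ?_, smul_zero]
        · exact Submodule.zero_mem _
        · rw [map_smul, actR_pow_e_gen, (ef_gen mu α s _).1 (Or.inr h)]
          simp
    · have hk1 : k ≠ 1 := by
        rintro rfl
        simp [pairPartition] at hle
        omega
      -- otherwise `r < s`, and since `X^r` already maps the terms of total exponent `r` into the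
      -- lattice, at least one factor `X` is left
      have hrs : r < s := by
        have := Nat.mul_le_mul_left r (show 2 ≤ k by omega)
        have := Nat.zero_le ((pairPartition lam mu α).drop k).sum
        nlinarith
      rw [hE, fusionAct_pow_gen, map_sum, Finset.smul_sum]
      refine Submodule.sum_mem _ fun i _ => ?_
      rw [map_smul, smul_comm]
      refine Submodule.smul_mem _ _ ?_
      rw [actR_pow_e_gen]
      rcases Nat.lt_or_ge (r + s - i) s with h | h
      · rw [(ef_gen mu α s _).1 (Or.inl h)]; simp
      · obtain ⟨j, hj⟩ := Nat.exists_eq_add_of_le' h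
        obtain ⟨c, hc⟩ := (ef_gen mu α s j).2
        obtain ⟨d, rfl⟩ := Nat.exists_eq_add_of_lt hrs
        rw [hj, hc, TensorProduct.tmul_smul, TensorProduct.tmul_smul, smul_comm]
        refine Submodule.smul_of_tower_mem _ _ ?_
        rw [show r + d + 1 = 1 + (d + r) by ring, pow_add, pow_one, mul_smul]
        refine X_smul_mem ?_
        rw [pow_add, mul_smul]
        refine Submodule.smul_mem _ _ ?_
        have := smul_actLR_mem (lam := lam) (mu := mu) α i j
        rwa [show i + j = r by omega] at this

/-- Generically in `X`, the generator generates the whole space. -/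
theorem exists_X_pow_smul_mem (n : FusionSpace lam mu) :
    ∃ k : ℕ, (Polynomial.X : ℂ[X]) ^ k • n ∈ fusionLattice lam mu := by
  let S : Submodule ℂ[X] (FusionSpace lam mu) :=
    { carrier := {n | ∃ k : ℕ, (Polynomial.X : ℂ[X]) ^ k • n ∈ fusionLattice lam mu}
      add_mem' := by
        rintro a b ⟨k, hk⟩ ⟨l, hl⟩
        refine ⟨k + l, ?_⟩
        rw [smul_add]
        refine Submodule.add_mem _ ?_ ?_
        · rw [add_comm, pow_add, mul_smul]; exact Submodule.smul_mem _ _ hk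
        · rw [pow_add, mul_smul]; exact Submodule.smul_mem _ _ hl
      zero_mem' := ⟨0, by simp⟩
      smul_mem' := by
        rintro p a ⟨k, hk⟩
        exact ⟨k, by rw [smul_comm]; exact Submodule.smul_mem _ p hk⟩ }
  -- `X (1 ⊗ x)` is the action of `x ⊗ t`, and `X (x ⊗ 1)` the one of `x ⊗ (X - t)`
  have hact : ∀ (x : Sl3) n, n ∈ S → actL lam mu (tpow x 0) n ∈ S ∧
      actR lam mu (tpow x 0) n ∈ S := by
    rintro x n ⟨k, hk⟩
    refine ⟨⟨k + 1, ?_⟩, ⟨k + 1, ?_⟩⟩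
    · have := X_smul_actL_mem x hk
      rwa [map_smul, smul_smul, ← pow_succ'] at this
    · have := fusionAct_mem (tpow x 1) hk
      rwa [fusionAct_succ, zero_add, pow_one, LinearMap.smul_apply, map_smul, smul_smul,
        ← pow_succ'] at this
  have hgen : fusionGen lam mu ∈ S := ⟨0, by simpa using fusionGen_mem⟩
  have hu : ∀ (u : UCur) n, n ∈ S → actL lam mu u n ∈ S ∧ actR lam mu u n ∈ S := by
    intro u
    have hu : u ∈ Algebra.adjoin ℂ {u : UCur | ∃ x s, u = tpow x s} := by
      rw [adjoin_tpow]; trivial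
    induction hu using Algebra.adjoin_induction with
    | mem u hu =>
      obtain ⟨x, s, rfl⟩ := hu
      intro n hn
      rcases s with _ | s
      · exact hact x n hn
      · have h1 := actL_tpow_succ lam mu x s
        have h2 : actR lam mu (tpow x (s + 1)) = 0 := by
          have : Algebra.lsmul ℂ ℂ (EvV mu) (tpow x (s + 1)) = 0 := by
            ext m; exact evV_killed mu x _ (by omega) m
          simp [actR, this]
        rw [h1, h2]
        exact ⟨S.zero_mem, S.zero_mem⟩
    | algebraMap c =>
      intro n hn
      rw [AlgHom.commutes, AlgHom.commutes, Module.algebraMap_end_apply]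
      exact ⟨S.smul_of_tower_mem c hn, S.smul_of_tower_mem c hn⟩
    | add a b _ _ ha hb =>
      intro n hn
      rw [map_add, map_add, LinearMap.add_apply, LinearMap.add_apply]
      exact ⟨S.add_mem (ha n hn).1 (hb n hn).1, S.add_mem (ha n hn).2 (hb n hn).2⟩
    | mul a b _ _ ha hb =>
      intro n hn
      rw [map_mul, map_mul, Module.End.mul_apply, Module.End.mul_apply]
      exact ⟨(ha _ (hb n hn).1).1, (ha _ (hb n hn).2).2⟩
  have htop : n ∈ S := by
    induction n using TensorProduct.induction_on with
    | zero => exact S.zero_mem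
    | add a b ha hb => exact S.add_mem ha hb
    | tmul p y =>
      rw [← mul_one p, ← smul_eq_mul, ← TensorProduct.smul_tmul']
      refine S.smul_mem p ?_
      induction y using TensorProduct.induction_on with
      | zero => rw [TensorProduct.tmul_zero]; exact S.zero_mem
      | add a b ha hb => rw [TensorProduct.tmul_add]; exact S.add_mem ha hb
      | tmul a b =>
        obtain ⟨u, -, rfl⟩ := evV_exists_smul lam a
        obtain ⟨u', -, rfl⟩ := evV_exists_smul mu b
        have := (hu u _ (hu u' _ hgen).2).1
        rwa [fusionGen, actR_tmul, actL_tmul] at this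
  exact htop

variable (lam mu) in
/-- One power of `X` works for all vectors, since the space has a finite basis over `ℂ[X]`. -/
theorem exists_X_pow_smul_le :
    ∃ k : ℕ, ∀ n : FusionSpace lam mu, (Polynomial.X : ℂ[X]) ^ k • n ∈ fusionLattice lam mu := by
  let b := Module.finBasis ℂ[X] (FusionSpace lam mu)
  choose k hk using fun i => exists_X_pow_smul_mem (b i)
  refine ⟨∑ i, k i, fun n => ?_⟩
  rw [← b.sum_repr n, Finset.smul_sum]
  refine Submodule.sum_mem _ fun i hi => ?_
  rw [smul_comm]
  refine Submodule.smul_mem _ _ ?_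
  rw [← Finset.sum_erase_add _ _ hi, pow_add, mul_smul]
  exact Submodule.smul_mem _ _ (hk i)

/-- A basis of a `ℂ[X]`-lattice `L` stays independent in the fibre `L / X L`. -/
theorem le_finrank_of_fibre {N U M : Type*} [AddCommGroup N] [Module ℂ[X] N] [Module ℂ N]
    [IsScalarTower ℂ ℂ[X] N] [AddCommGroup U] [Module ℂ U] [AddCommGroup M] [Module ℂ M]
    [Module.Finite ℂ M] (L : Submodule ℂ[X] N) {r : ℕ} (b : Module.Basis (Fin r) ℂ[X] L)
    (ψ : U →ₗ[ℂ] N) (q : U →ₗ[ℂ] M)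
    (hq : ∀ u, q u = 0 → ∃ y ∈ L, (Polynomial.X : ℂ[X]) • y = ψ u)
    (hψ : ∀ n ∈ L, ∃ u, ∃ y ∈ L, (Polynomial.X : ℂ[X]) • y = n - ψ u) :
    r ≤ Module.finrank ℂ M := by
  -- lift the classes of the basis vectors to `U`; a linear relation between their images in `M` gives
  -- a relation between basis vectors with right side divisible by `X`
  choose u y hy hu using fun i => hψ (b i) (b i).2
  have hli : LinearIndependent ℂ fun i => q (u i) := by
    rw [Fintype.linearIndependent_iff]
    intro c hc i
    obtain ⟨z, hz, hzu⟩ := hq (∑ i, c i • u i) (by simpa using hc)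
    have h1 : (Polynomial.X : ℂ[X]) • ((⟨z, hz⟩ : L) + ∑ i, c i • (⟨y i, hy i⟩ : L)) =
        ∑ i, (Polynomial.C (c i)) • b i := by
      apply Subtype.ext
      simp only [smul_add, Finset.smul_sum, Submodule.coe_add, Submodule.coe_sum,
        Submodule.coe_smul, ← Polynomial.algebraMap_eq, algebraMap_smul, Submodule.coe_smul_of_tower]
      rw [hzu, map_sum, ← Finset.sum_add_distrib]
      refine Finset.sum_congr rfl fun i _ => ?_
      rw [smul_comm, hu, map_smul, ← smul_add, add_sub_cancel]
    have h2 := congrArg (fun z => b.repr z i) h1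
    simp only [map_smul, Module.Basis.repr_sum_self] at h2
    have h3 := congrArg (fun p => Polynomial.coeff p 0) h2
    simpa using h3.symm
  simpa using hli.fintype_card_le_finrank

/-- The dimension of `F_{λ,μ}` is at least that of the fusion product of `V(λ)` and `V(μ)`. -/
theorem finrank_mul_le [Module.Finite ℂ (F lam mu)] :
    Module.finrank ℂ (EvV lam) * Module.finrank ℂ (EvV mu) ≤ Module.finrank ℂ (F lam mu) := by
  obtain ⟨r, b⟩ := Submodule.basisOfPid (Module.finBasis ℂ[X] (FusionSpace lam mu))
    (fusionLattice lam mu)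
  -- the lattice has full rank
  have hr : Module.finrank ℂ (EvV lam) * Module.finrank ℂ (EvV mu) ≤ r := by
    obtain ⟨k, hk⟩ := exists_X_pow_smul_le lam mu
    have h1 : Module.finrank ℂ[X] (FusionSpace lam mu) =
        Module.finrank ℂ (EvV lam) * Module.finrank ℂ (EvV mu) := by
      rw [Module.finrank_baseChange, Module.finrank_tensorProduct]
    have hfin : Module.Finite ℂ[X] (fusionLattice lam mu) := Module.Finite.of_basis b
    have h2 : Module.finrank ℂ[X] (fusionLattice lam mu) = r := by
      rw [Module.finrank_eq_card_basis b, Fintype.card_fin]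
    rw [← h1, ← h2]
    refine LinearMap.finrank_le_finrank_of_injective
      (f := (LinearMap.lsmul ℂ[X] (FusionSpace lam mu) (Polynomial.X ^ k)).codRestrict
        (fusionLattice lam mu) hk) ?_
    intro x y hxy
    have := congrArg Subtype.val hxy
    exact smul_right_injective (FusionSpace lam mu) (pow_ne_zero k Polynomial.X_ne_zero) this
  let ψ : UCur →ₗ[ℂ] FusionSpace lam mu :=
    { toFun := fun u => fusionAct lam mu u (fusionGen lam mu)
      map_add' := fun u u' => by simp
      map_smul' := fun c u => by simp }
  refine hr.trans (le_finrank_of_fibre (fusionLattice lam mu) b ψ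
    ((Submodule.mkQ (Submodule.span UCur
      (cvRelations (lam + mu) (pairPartition lam mu)))).restrictScalars ℂ) ?_ ?_)
  · intro u hu
    replace hu : u ∈ Submodule.span UCur (cvRelations (lam + mu) (pairPartition lam mu)) :=
      (Submodule.Quotient.mk_eq_zero _).1 hu
    change fusionAct lam mu u (fusionGen lam mu) ∈ fusionFibre lam mu
    induction hu using Submodule.span_induction with
    | mem u h => exact fusion_relations h
    | zero => rw [map_zero]; exact Submodule.zero_mem _
    | add a b _ _ ha hb => rw [map_add]; exact Submodule.add_mem _ ha hb
    | smul u' a _ ha =>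
      rw [smul_eq_mul, map_mul, Module.End.mul_apply]
      exact fusionAct_mem_fibre u' ha
  · intro n hn
    change ∃ u, n - fusionAct lam mu u (fusionGen lam mu) ∈ fusionFibre lam mu
    induction hn using Submodule.span_induction with
    | mem n h => obtain ⟨u, rfl⟩ := h; exact ⟨u, by simp⟩
    | zero => exact ⟨0, by simp⟩
    | add a b ha hb iha ihb =>
      obtain ⟨u, hu⟩ := iha
      obtain ⟨u', hu'⟩ := ihb
      refine ⟨u + u', ?_⟩
      rw [map_add, LinearMap.add_apply, add_sub_add_comm]
      exact Submodule.add_mem _ hu hu'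
    | smul p a ha iha =>
      obtain ⟨u, hu⟩ := iha
      -- modulo `X`, a polynomial acts by its constant term
      refine ⟨p.coeff 0 • u, ?_⟩
      have : p • a = (Polynomial.X : ℂ[X]) • (p.divX • a) + p.coeff 0 • a := by
        conv_lhs => rw [← Polynomial.divX_mul_X_add p]
        rw [add_smul, mul_comm, mul_smul, ← Polynomial.algebraMap_eq, algebraMap_smul]
      rw [this, map_smul, LinearMap.smul_apply, add_sub_assoc]
      refine Submodule.add_mem _ (X_smul_mem (Submodule.smul_mem _ _ ha)) ?_
      have h := Submodule.smul_of_tower_mem _ (p.coeff 0) hu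
      rwa [smul_sub] at h

end Fusion

end

noncomputable section

/-! ### Dimension polynomials -/

/-- Twice the Weyl dimension polynomial of `sl₃`. -/
def weyl (a b : ℤ) : ℤ := (a + 1) * (b + 1) * (a + b + 2)

/-- A sum of polynomial values of degree at most three, by finite differences. -/
theorem sum_range_cubic (P : ℤ → ℤ)
    (hP : ∀ x, P (x + 4) = 4 * P (x + 3) - 6 * P (x + 2) + 4 * P (x + 1) - P x) (n : ℕ) :
    24 * ∑ i ∈ Finset.range n, P i = 24 * n * P 0 + 12 * n * (n - 1) * (P 1 - P 0) +
      4 * n * (n - 1) * (n - 2) * (P 2 - 2 * P 1 + P 0) +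
      n * (n - 1) * (n - 2) * (n - 3) * (P 3 - 3 * P 2 + 3 * P 1 - P 0) := by
  have key : ∀ n : ℕ, 6 * P n = 6 * P 0 + 6 * n * (P 1 - P 0) +
      3 * n * (n - 1) * (P 2 - 2 * P 1 + P 0) +
      n * (n - 1) * (n - 2) * (P 3 - 3 * P 2 + 3 * P 1 - P 0) := by
    intro n
    induction n using Nat.strong_induction_on with
    | _ n ih =>
      match n with
      | 0 => push_cast; ring
      | 1 => push_cast; ring
      | 2 => push_cast; ring
      | 3 => push_cast; ring
      | n + 4 =>
        have h0 := ih n (by omega)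
        have h1 := ih (n + 1) (by omega)
        have h2 := ih (n + 2) (by omega)
        have h3 := ih (n + 3) (by omega)
        push_cast at h0 h1 h2 h3 ⊢
        linear_combination 6 * hP n + 4 * h3 - 6 * h2 + 4 * h1 - h0
  induction n with
  | zero => simp
  | succ n ih =>
    rw [Finset.sum_range_succ, mul_add, ih]
    push_cast
    linear_combination 4 * key n

theorem sum_range_weyl (A B : ℤ) (n : ℕ) :
    2 * ∑ j ∈ Finset.range n, weyl (A + 2 * j) (B - j) =
      n * (n + A) * (2 * (B + 1) * (A + B + 2) + (A + 1) - n * (n + A)) := by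
  induction n with
  | zero => simp
  | succ n ih =>
    rw [Finset.sum_range_succ, mul_add, ih, weyl]
    push_cast
    ring

theorem sum_range_eq_zero_of_antisymm (c : ℕ) (h : ℕ → ℤ) (hh : ∀ i < c, h (c - 1 - i) = -h i) :
    ∑ i ∈ Finset.range c, h i = 0 := by
  have h1 := Finset.sum_range_reflect h c
  rw [Finset.sum_congr rfl fun i hi => hh i (Finset.mem_range.1 hi), Finset.sum_neg_distrib] at h1
  omega

/-- The sum of Weyl dimensions that occurs in the kernels, over a rectangle of size `k × n`. -/
def rectSum (k n : ℕ) (X Y : ℤ) : ℤ :=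
  ∑ i ∈ Finset.range k, ∑ j ∈ Finset.range n, weyl (X - n - i + 2 * j) (Y - 1 + 2 * i - j)

/-- The part of the rectangle in which the weights are dominant. -/
def rectSet (k n : ℕ) (X Y : ℤ) : Finset (ℕ × ℕ) :=
  (Finset.range k ×ˢ Finset.range n).filter fun a =>
    n - X + a.1 ≤ a.2 ∧ (a.2 : ℤ) + 1 - Y ≤ a.1

/-- Outside of `rectSet` the terms cancel in pairs, by the antisymmetry of the Weyl dimension
polynomial under the two simple reflections. -/
theorem sum_rectSet (k n : ℕ) (X Y : ℤ) (hX : k ≤ X + 1) (hY : n ≤ Y + k) (hXY : n - X ≤ Y) :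
    ∑ a ∈ rectSet k n X Y, weyl (X - n - a.1 + 2 * a.2) (Y - 1 + 2 * a.1 - a.2) =
      rectSum k n X Y := by
  set h : ℕ → ℕ → ℤ := fun i j => weyl (X - n - i + 2 * j) (Y - 1 + 2 * i - j) with hdef
  -- for fixed `i`, the reflection of the first weight coordinate is `j ↦ n - X + i - 1 - j`
  have h1 : ∀ i ∈ Finset.range k, ∑ j ∈ Finset.range n,
      (if (j : ℤ) < n - X + i then h i j else 0) = 0 := by
    intro i hi
    rw [Finset.mem_range] at hi
    rw [← Finset.sum_filter]
    have : (Finset.range n).filter (fun j : ℕ => (j : ℤ) < n - X + i) =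
        Finset.range (n - X + i).toNat := by
      ext j; simp only [Finset.mem_filter, Finset.mem_range]; omega
    rw [this]
    refine sum_range_eq_zero_of_antisymm _ _ fun j hj => ?_
    have e : (((n - X + i).toNat - 1 - j : ℕ) : ℤ) = n - X + i - 1 - j := by omega
    simp only [hdef, weyl, e]
    ring
  -- for fixed `j`, the reflection of the second weight coordinate is `i ↦ j + 1 - Y - 1 - i`
  have h2 : ∀ j ∈ Finset.range n, ∑ i ∈ Finset.range k,
      (if (i : ℤ) < j + 1 - Y then h i j else 0) = 0 := by
    intro j hj
    rw [Finset.mem_range] at hj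
    rw [← Finset.sum_filter]
    have : (Finset.range k).filter (fun i : ℕ => (i : ℤ) < j + 1 - Y) =
        Finset.range (j + 1 - Y).toNat := by
      ext i; simp only [Finset.mem_filter, Finset.mem_range]; omega
    rw [this]
    refine sum_range_eq_zero_of_antisymm _ _ fun i hi => ?_
    have e : (((j + 1 - Y).toNat - 1 - i : ℕ) : ℤ) = j + 1 - Y - 1 - i := by omega
    simp only [hdef, weyl, e]
    ring
  -- the two conditions that define `rectSet` cannot fail at the same time, because `n - X ≤ Y`
  have h3 : rectSum k n X Y = ∑ i ∈ Finset.range k, ∑ j ∈ Finset.range n,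
      ((if (n - X + i ≤ j ∧ (j : ℤ) + 1 - Y ≤ i) then h i j else 0) +
        ((if (j : ℤ) < n - X + i then h i j else 0) +
          (if (i : ℤ) < j + 1 - Y then h i j else 0))) := by
    refine Finset.sum_congr rfl fun i _ => Finset.sum_congr rfl fun j _ => ?_
    change h i j = _
    split_ifs <;> omega
  rw [h3]
  simp only [Finset.sum_add_distrib]
  rw [Finset.sum_eq_zero h1, Finset.sum_comm (s := Finset.range k) (t := Finset.range n)
    (f := fun i j => if (i : ℤ) < j + 1 - Y then h i j else 0), Finset.sum_eq_zero h2, rectSet,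
    Finset.sum_filter, Finset.sum_product]
  simp [hdef]

theorem rectSum_eq (k n : ℕ) (X Y : ℤ) :
    2 * rectSum k n X Y = ∑ i ∈ Finset.range k,
      n * (X - i) * (2 * (Y + 2 * i) * (X - n + Y + 1 + i) + (X - n - i + 1) - n * (X - i)) := by
  rw [rectSum, Finset.mul_sum]
  refine Finset.sum_congr rfl fun i _ => ?_
  rw [sum_range_weyl]
  ring

/-- A closed form of `48 * rectSum k n X Y`. -/
def rectPoly (k n X Y : ℤ) : ℤ :=
  let P : ℤ → ℤ := fun i =>
    n * (X - i) * (2 * (Y + 2 * i) * (X - n + Y + 1 + i) + (X - n - i + 1) - n * (X - i))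
  24 * k * P 0 + 12 * k * (k - 1) * (P 1 - P 0) +
      4 * k * (k - 1) * (k - 2) * (P 2 - 2 * P 1 + P 0) +
      k * (k - 1) * (k - 2) * (k - 3) * (P 3 - 3 * P 2 + 3 * P 1 - P 0)

theorem rectSum_eq_rectPoly (k n : ℕ) (X Y : ℤ) :
    48 * rectSum k n X Y = rectPoly k n X Y := by
  have := sum_range_cubic (fun i : ℤ => n * (X - i) *
    (2 * (Y + 2 * i) * (X - n + Y + 1 + i) + (X - n - i + 1) - n * (X - i))) (by intro x; ring) k
  rw [← rectSum_eq] at this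
  rw [rectPoly, ← this]
  ring

theorem weyl_identity_right (l1 l2 : ℤ) (m : ℕ) :
    weyl l1 l2 * weyl 0 (m + 1) =
      weyl l1 (l2 + 1) * weyl 0 m + 2 * rectSum 1 (m + 2) (l1 + 1) (l2 + 1) := by
  rw [rectSum_eq]
  simp only [weyl, Finset.sum_range_one]
  push_cast
  ring

theorem weyl_identity_left (l1 l2 : ℤ) (m : ℕ) :
    weyl l1 l2 * weyl (m + 1) 0 =
      weyl (l1 + 1) l2 * weyl m 0 + 2 * rectSum (m + 2) 1 (l1 + 1) (l2 - m) := by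
  have h := rectSum_eq_rectPoly (m + 2) 1 (l1 + 1) (l2 - m)
  have : 24 * (weyl l1 l2 * weyl (m + 1) 0) =
      24 * (weyl (l1 + 1) l2 * weyl m 0 + 2 * rectSum (m + 2) 1 (l1 + 1) (l2 - m)) := by
    rw [mul_add 24, ← mul_assoc 24 2, show (24 : ℤ) * 2 = 48 by norm_num, h]
    simp only [weyl, rectPoly]
    push_cast
    ring
  omega

theorem weyl_identity_first (l1 l2 : ℤ) (m1 m2 : ℕ) :
    weyl l1 l2 * weyl m1 (m2 + 1) =
      weyl l1 (l2 + 1) * weyl m1 m2 + weyl (l1 + (m2 + 1)) (l2 - (m2 + 1)) * weyl m1 0 +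
        2 * rectSum (m1 + 1) (m2 + 1) l1 (l2 - m1 + 1) := by
  have h := rectSum_eq_rectPoly (m1 + 1) (m2 + 1) l1 (l2 - m1 + 1)
  have : 24 * (weyl l1 l2 * weyl m1 (m2 + 1)) =
      24 * (weyl l1 (l2 + 1) * weyl m1 m2 + weyl (l1 + (m2 + 1)) (l2 - (m2 + 1)) * weyl m1 0 +
        2 * rectSum (m1 + 1) (m2 + 1) l1 (l2 - m1 + 1)) := by
    rw [mul_add 24 _ (2 * _), ← mul_assoc 24 2, show (24 : ℤ) * 2 = 48 by norm_num, h]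
    simp only [weyl, rectPoly]
    push_cast
    ring
  omega

theorem weyl_identity_second (l1 : ℤ) (l2 m1 L : ℕ) :
    weyl l1 l2 * weyl m1 (l2 + L) =
      weyl l1 (l2 + L) * weyl m1 l2 + 2 * ∑ l ∈ Finset.range L,
        rectSum (m1 + 1) (l2 + 1) (l1 - l) ((l2 + L : ℤ) - m1 - l) := by
  have h := sum_range_cubic (fun l : ℤ => rectPoly (m1 + 1) (l2 + 1) (l1 - l)
    ((l2 + L : ℤ) - m1 - l)) (by intro x; simp only [rectPoly]; ring) L
  have h1 : 48 * ∑ l ∈ Finset.range L, rectSum (m1 + 1) (l2 + 1) (l1 - l) ((l2 + L : ℤ) - m1 - l) =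
      ∑ l ∈ Finset.range L, rectPoly (m1 + 1) (l2 + 1) (l1 - l) ((l2 + L : ℤ) - m1 - l) := by
    rw [Finset.mul_sum]
    refine Finset.sum_congr rfl fun l _ => ?_
    rw [rectSum_eq_rectPoly]
    push_cast
    rfl
  rw [← h1] at h
  set T := ∑ l ∈ Finset.range L, rectSum (m1 + 1) (l2 + 1) (l1 - l) ((l2 + L : ℤ) - m1 - l)
  have : 576 * (weyl l1 l2 * weyl m1 (l2 + L)) =
      576 * (weyl l1 (l2 + L) * weyl m1 l2 + 2 * T) := by
    rw [mul_add 576, show 576 * (2 * T) = 24 * (48 * T) by ring, h]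
    simp only [weyl, rectPoly]
    ring
  omega

end

noncomputable section

/-! ### Strips -/

variable {lam mu : Wt}

theorem mem_of_eq_zero {N : Submodule UCur (F lam mu)} {x : F lam mu} (h : x = 0) : x ∈ N :=
  h ▸ N.zero_mem

theorem w_zero_of_left {a : ℕ} (b c : ℕ) (ha : minExp lam mu .al1 < a) : w lam mu a b c = 0 :=
  dw_eq_zero_left F_isSquareZero isTruncated_vF b c ha

theorem w_zero_of_right (a b : ℕ) {c : ℕ} (hc : minExp lam mu .al2 < c) : w lam mu a b c = 0 :=
  dw_eq_zero_right isTruncated_vF a b hc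

theorem w_zero_of_degree {a b c : ℕ} (h : minExp lam mu .th < a + b + c) : w lam mu a b c = 0 :=
  dw_eq_zero_of_degree F_isSquareZero isTruncated_vF h

theorem w_mem_of_right (N : Submodule UCur (F lam mu)) {c : ℕ} (h : w lam mu 0 0 c ∈ N)
    (a b : ℕ) : w lam mu a b c ∈ N := by
  have h0 : w lam mu 0 0 c = divPow (tpow (xm .al2) 1) c • vF lam mu := by simp [w, divPow]
  rw [w, mul_smul, ← h0]
  exact N.smul_mem _ h

theorem w_mem_of_theta (N : Submodule UCur (F lam mu)) {n : ℕ} (h : w lam mu 0 n 0 ∈ N)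
    {a b c : ℕ} (habc : a + b + c = n) : w lam mu a b c ∈ N :=
  dw_mem F_isSquareZero isHighest_vF N h a b c habc

/-- If the three multiples of `w(a, b, c)` by the `x_α⁻ ⊗ t` lie in a submodule, then all of
`sl₃ ⊗ tℂ[t]` maps `w(a, b, c)` into it. -/
theorem tpow_w_mem (N : Submodule UCur (F lam mu)) {a b c : ℕ}
    (h1 : w lam mu (a + 1) b c ∈ N) (h2 : w lam mu a (b + 1) c ∈ N)
    (h3 : w lam mu a b (c + 1) ∈ N) (y : Sl3) (s : ℕ) (hs : 1 ≤ s) :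
    tpow y s • w lam mu a b c ∈ N := by
  have hk : IsSquareZero (F lam mu) := F_isSquareZero
  have hv : IsHighest (vF lam mu) (lam + mu) := isHighest_vF
  rw [w_eq_dw] at h1 h2 h3 ⊢
  rcases Nat.lt_or_ge 1 s with hs2 | hs2
  · rw [hk y s hs2]; exact N.zero_mem
  · obtain rfl : s = 1 := by omega
    rw [← Submodule.Quotient.mk_eq_zero, Submodule.Quotient.mk_smul]
    refine tpow_smul_eq_zero (fun α => ?_) (fun α => ?_) (fun α _ => ?_) y
    all_goals rw [← Submodule.Quotient.mk_smul, Submodule.Quotient.mk_eq_zero]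
    · rw [tpow_dw hk _ le_rfl, hv.pos, dw_zero_right]; exact N.zero_mem
    · cases α with
      | al1 => rw [f1_dw]; exact N.smul_of_tower_mem _ h1
      | al2 => rw [f2_dw hk]; exact N.smul_of_tower_mem _ h3
      | th => rw [fth_dw hk]; exact N.smul_of_tower_mem _ h2
    · rw [tpow_dw hk _ le_rfl, hv.car', dw_zero_right]; exact N.zero_mem

/-- The term with index `j` of the filtration given by the vectors `w(a₁, n - a₁ - a₂, a₂)`,
`a ∈ S`, and a last term `R`. -/
def stripFilt (S : Finset (ℕ × ℕ)) (n : ℕ) (R : Submodule UCur (F lam mu)) (j : ℕ) :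
    Submodule UCur (F lam mu) :=
  Submodule.span UCur
    {x | ∃ a ∈ S, j ≤ a.1 + a.2 ∧ x = w lam mu a.1 (n - (a.1 + a.2)) a.2} ⊔ R

/-- The conditions under which the vectors `w(a₁, n - a₁ - a₂, a₂)`, `a ∈ rectSet k m X Y`, form
a strip above the submodule `R`: the weight of `w(0, n, 0)` is `(X - m, Y - 1)`, the vectors of
degree `n` outside of the `k × m`-rectangle and the vectors of degree `n + 1` belong to `R`,
and the sizes are compatible with the two simple reflections. -/
structure IsStrip (lam mu : Wt) (k m n : ℕ) (X Y : ℤ) (R : Submodule UCur (F lam mu)) : Prop where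
  wt1 : ((lam.1 + mu.1 : ℕ) : ℤ) - n = X - m
  wt2 : ((lam.2 + mu.2 : ℕ) : ℤ) - n = Y - 1
  hX : k ≤ X + 1
  hY : m ≤ Y + k
  hXY : m - X + 1 ≤ Y
  hc1 : ∀ i < k, m - X + 2 * i ≤ n
  hc2 : ∀ j < m, 2 * (j : ℤ) + 1 - Y ≤ n
  hkm : k + m ≤ n + 2
  left : ∀ a b c, a + b + c = n → k ≤ a → w lam mu a b c ∈ R
  right : ∀ a b c, a + b + c = n → m ≤ c → w lam mu a b c ∈ R
  top : ∀ a b c, a + b + c = n + 1 → w lam mu a b c ∈ R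

/-- The highest weight of `w(a₁, n - a₁ - a₂, a₂)` modulo the later terms. -/
def stripWt (m : ℕ) (X Y : ℤ) (a : ℕ × ℕ) : Wt :=
  dom (X - m - a.1 + 2 * a.2) (Y - 1 + 2 * a.1 - a.2)

namespace IsStrip

variable {k m n : ℕ} {X Y : ℤ} {R : Submodule UCur (F lam mu)}

/-- All vectors `w(a₁, n - a₁ - a₂, a₂)` belong to the term with index `a₁ + a₂`. If
`a` is not in `rectSet`, then the weight for one of the simple roots is `-p` with `p > 0`, where
`p > a₂` or `p > a₁`, and the vector belongs to the submodule generated by a vector with larger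
`a₂` or `a₁`. -/
theorem w_mem (h : IsStrip lam mu k m n X Y R) {j a₁ a₂ : ℕ} (hj : j ≤ a₁ + a₂)
    (hn : a₁ + a₂ ≤ n) :
    w lam mu a₁ (n - (a₁ + a₂)) a₂ ∈ stripFilt (rectSet k m X Y) n R j := by
  have hk0 : IsSquareZero (F lam mu) := F_isSquareZero
  have hv : IsHighest (vF lam mu) (lam + mu) := isHighest_vF
  have := h.wt1
  have := h.wt2
  have := h.hX
  have := h.hY
  have := h.hXY
  have := h.hkm
  by_cases h1 : k ≤ a₁
  · exact Submodule.mem_sup_right (h.left _ _ _ (by omega) h1)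
  by_cases h2 : m ≤ a₂
  · exact Submodule.mem_sup_right (h.right _ _ _ (by omega) h2)
  have hc1 := h.hc1 a₁ (by omega)
  have hc2 := h.hc2 a₂ (by omega)
  have hS : ∀ p q : ℕ, j ≤ p + q → p < k → q < m → m - X + p ≤ q → (q : ℤ) + 1 - Y ≤ p →
      w lam mu p (n - (p + q)) q ∈ stripFilt (rectSet k m X Y) n R j := by
    intro p q h0 hp hq hpq hqp
    refine Submodule.mem_sup_left (Submodule.subset_span ⟨(p, q), ?_, h0, rfl⟩)
    simp only [rectSet, Finset.mem_filter, Finset.mem_product, Finset.mem_range]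
    exact ⟨⟨hp, hq⟩, hpq, hqp⟩
  by_cases h3 : m - X + a₁ ≤ a₂
  · by_cases h4 : (a₂ : ℤ) + 1 - Y ≤ a₁
    · exact hS _ _ hj (by omega) (by omega) h3 h4
    -- `w(0, n - a₂, a₂)` has the negative `α₂`-weight `-c`, and the `c`-th power of `x_{α₂}⁺` maps it
    -- to a multiple of the vector with `a₁ = c`
    · obtain ⟨c, hc⟩ : ∃ c : ℕ, (c : ℤ) = a₂ + 1 - Y := ⟨(a₂ + 1 - Y).toNat, by omega⟩
      have hcmem : w lam mu c (n - (c + a₂)) a₂ ∈ stripFilt (rectSet k m X Y) n R j := by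
        by_cases h5 : k ≤ c
        · exact Submodule.mem_sup_right (h.left _ _ _ (by omega) h5)
        · exact hS _ _ (by omega) (by omega) (by omega) (by omega) (by omega)
      have := dw_mem_of_al2 hk0 hv (F_nilpotent .al2 (by simp))
        (stripFilt (rectSet k m X Y) n R j) (c := a₂) (n := n - a₂) (p := c) (k := a₁)
        (by simp only [Prod.snd_add]; omega) (by omega)
        (by rw [show n - a₂ - c = n - (c + a₂) by omega]; exact hcmem) (by omega)
      rwa [show n - a₂ - a₁ = n - (a₁ + a₂) by omega] at this
  -- `w(a₁, n - a₁, 0)` has the negative `α₁`-weight `-c`, and the `c`-th power of `x_{α₁}⁺` maps it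
  -- to a multiple of the vector with `a₂ = c`
  · obtain ⟨c, hc⟩ : ∃ c : ℕ, (c : ℤ) = m - X + a₁ := ⟨(m - X + a₁).toNat, by omega⟩
    have hcmem : w lam mu a₁ (n - (a₁ + c)) c ∈ stripFilt (rectSet k m X Y) n R j := by
      by_cases h5 : m ≤ c
      · exact Submodule.mem_sup_right (h.right _ _ _ (by omega) h5)
      · exact hS _ _ (by omega) (by omega) (by omega) (by omega) (by omega)
    have := dw_mem_of_al1 hk0 hv (F_nilpotent .al1 (by simp))
      (stripFilt (rectSet k m X Y) n R j) (a := a₁) (n := n - a₁) (p := c) (k := a₂)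
      (by simp only [Prod.fst_add]; omega) (by omega)
      (by rw [show n - a₁ - c = n - (a₁ + c) by omega]; exact hcmem) (by omega)
    rwa [show n - a₁ - a₂ = n - (a₁ + a₂) by omega] at this

theorem filt_zero (h : IsStrip lam mu k m n X Y R) :
    stripFilt (rectSet k m X Y) n R 0 = Submodule.span UCur {w lam mu 0 n 0} ⊔ R := by
  refine le_antisymm (sup_le ?_ le_sup_right) (sup_le ?_ le_sup_right)
  · rw [Submodule.span_le]
    rintro _ ⟨a, ha, -, rfl⟩
    simp only [rectSet, Finset.mem_filter, Finset.mem_product, Finset.mem_range] at ha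
    have := h.hkm
    exact Submodule.mem_sup_left (w_mem_of_theta _
      (Submodule.mem_span_singleton_self _) (by omega))
  · rw [Submodule.span_le, Set.singleton_subset_iff]
    simpa using h.w_mem (j := 0) (a₁ := 0) (a₂ := 0) le_rfl (Nat.zero_le n)

theorem filt_top (h : IsStrip lam mu k m n X Y R) :
    stripFilt (rectSet k m X Y) n R (n + 1) = R := by
  refine le_antisymm (sup_le ?_ le_rfl) le_sup_right
  rw [Submodule.span_le]
  rintro _ ⟨a, ha, hj, rfl⟩
  simp only [rectSet, Finset.mem_filter, Finset.mem_product, Finset.mem_range] at ha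
  have := h.hkm
  omega

/-- The vectors `w(a₁, n - j, a₂)` with `a₁ + a₂ = j` are highest weight vectors modulo the term with
index `j + 1`: a raising operator increases `a₁ + a₂`, and `t` increases the degree. -/
theorem sumSurj (h : IsStrip lam mu k m n X Y R) {I : Type} [DecidableEq I] {j : ℕ}
    (hj : j ≤ n) (a : I → ℕ × ℕ) (ha : ∀ p, (∃ i, a i = p) ↔ p ∈ rectSet k m X Y ∧ p.1 + p.2 = j) :
    SumSurj (fun i => stripWt m X Y (a i)) n (fun i => w lam mu (a i).1 (n - j) (a i).2)
      (stripFilt (rectSet k m X Y) n R j) (stripFilt (rectSet k m X Y) n R (j + 1)) := by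
  have hk0 : IsSquareZero (F lam mu) := F_isSquareZero
  have hv : IsHighest (vF lam mu) (lam + mu) := isHighest_vF
  have ha' : ∀ i, a i ∈ rectSet k m X Y ∧ (a i).1 + (a i).2 = j := fun i => (ha _).1 ⟨i, rfl⟩
  refine sumSurj_of_highest ?_ ?_ ?_ ?_ ?_
  · refine le_antisymm (sup_le ?_ ?_) (sup_le ?_ (sup_le ?_ le_sup_right))
    · rw [Submodule.span_le]
      rintro _ ⟨p, hp, hpj, rfl⟩
      rcases hpj.lt_or_eq with hlt | heq
      · exact Submodule.mem_sup_right
          (Submodule.mem_sup_left (Submodule.subset_span ⟨p, hp, hlt, rfl⟩))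
      · obtain ⟨i, rfl⟩ := (ha p).2 ⟨hp, heq.symm⟩
        exact Submodule.mem_sup_left (Submodule.subset_span ⟨i, by simp only [← heq]⟩)
    · exact le_sup_right.trans le_sup_right
    · rw [Submodule.span_le]
      rintro _ ⟨i, rfl⟩
      have := ha' i
      exact Submodule.mem_sup_left (Submodule.subset_span ⟨a i, this.1, this.2.ge, by
        simp only [this.2]⟩)
    · refine le_trans (Submodule.span_mono ?_) le_sup_left
      rintro _ ⟨p, hp, hpj, rfl⟩
      exact ⟨p, hp, by omega, rfl⟩
  · intro i α hα
    have := ha' i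
    rw [w_eq_dw]
    obtain ⟨b, hb⟩ | hb : (∃ b, n - j = b + 1) ∨ n - j = 0 := by
      rcases n - j with _ | b
      · exact Or.inr rfl
      · exact Or.inl ⟨b, rfl⟩
    · rw [hb]
      cases α with
      | al1 =>
        rw [(e1_dw hk0 hv _ _ _).1]
        refine Submodule.smul_of_tower_mem _ _ ?_
        have h1 := h.w_mem (j := j + 1) (a₁ := (a i).1) (a₂ := (a i).2 + 1) (by omega) (by omega)
        rwa [show n - ((a i).1 + ((a i).2 + 1)) = b by omega] at h1
      | al2 =>
        rw [(e2_dw hk0 hv _ _ _).1]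
        refine Submodule.smul_of_tower_mem _ _ ?_
        have h1 := h.w_mem (j := j + 1) (a₁ := (a i).1 + 1) (a₂ := (a i).2) (by omega) (by omega)
        rwa [show n - ((a i).1 + 1 + (a i).2) = b by omega] at h1
      | th => exact absurd rfl hα
    · rw [hb]
      cases α with
      | al1 => rw [(e1_dw hk0 hv _ 0 _).2]; exact Submodule.zero_mem _
      | al2 => rw [(e2_dw hk0 hv _ 0 _).2]; exact Submodule.zero_mem _
      | th => exact absurd rfl hα
  · intro i y s hs
    have := ha' i
    exact tpow_w_mem _ (Submodule.mem_sup_right (h.top _ _ _ (by omega)))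
      (Submodule.mem_sup_right (h.top _ _ _ (by omega)))
      (Submodule.mem_sup_right (h.top _ _ _ (by omega))) y s hs
  · intro i α hα
    obtain ⟨h1, h2⟩ := ha' i
    simp only [rectSet, Finset.mem_filter, Finset.mem_product, Finset.mem_range] at h1
    have e1 := h.wt1
    have e2 := h.wt2
    rw [w_eq_dw, h_dw hv]
    have key : (((lam + mu).eval α : ℤ) - (a i).1 * cartan .al1 α - (n - j : ℕ) * cartan .th α -
        (a i).2 * cartan .al2 α) = ((stripWt m X Y (a i)).eval α : ℕ) := by
      cases α with
      | al1 => simp only [Wt.eval, Prod.fst_add, cartan, stripWt, dom]; omega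
      | al2 => simp only [Wt.eval, Prod.snd_add, cartan, stripWt, dom]; omega
      | th => exact absurd rfl hα
    rw [key, Int.cast_natCast]
  · intro i
    have := ha' i
    exact w_mem_gradeF lam mu (by omega)

end IsStrip

theorem minExp_al1 : minExp lam mu .al1 = min lam.1 mu.1 := rfl
theorem minExp_al2 : minExp lam mu .al2 = min lam.2 mu.2 := rfl
theorem minExp_th : minExp lam mu .th = min (lam.1 + lam.2) (mu.1 + mu.2) := rfl

theorem isStrip_right (h : IsFirstKind lam mu) (h1 : mu.1 = 0) :
    IsStrip lam mu 1 (mu.2 + 1) mu.2 (lam.1 + 1) (lam.2 + 1) ⊥ := by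
  obtain ⟨h3, h4, h5⟩ := h
  simp only [Wt.size] at h3
  constructor
  all_goals try omega
  · intro a b c _ ha
    exact mem_of_eq_zero (w_zero_of_left b c (by rw [minExp_al1]; omega))
  · intro a b c _
    exact mem_of_eq_zero (w_zero_of_degree (by rw [minExp_th]; omega))

theorem isStrip_left (h : IsFirstKind lam mu) (h1 : mu.2 = 0) :
    IsStrip lam mu (mu.1 + 1) 1 mu.1 (lam.1 + 1) (lam.2 - mu.1 + 1) ⊥ := by
  obtain ⟨h3, h4, h5⟩ := h
  simp only [Wt.size] at h3
  constructor
  all_goals try omega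
  · intro a b c _ ha
    exact mem_of_eq_zero (w_zero_of_right a b (by rw [minExp_al2]; omega))
  · intro a b c _
    exact mem_of_eq_zero (w_zero_of_degree (by rw [minExp_th]; omega))

theorem isStrip_first (h : IsFirstKind lam mu) :
    IsStrip lam mu (mu.1 + 1) mu.2 mu.size lam.1 (lam.2 - mu.1 + 1)
      (Submodule.span UCur {w lam mu 0 0 mu.2}) := by
  obtain ⟨h3, h4, h5⟩ := h
  simp only [Wt.size] at h3 ⊢
  constructor
  all_goals try omega
  · intro a b c _ ha
    exact mem_of_eq_zero (w_zero_of_left b c (by rw [minExp_al1]; omega))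
  · intro a b c _ hc
    rcases hc.lt_or_eq with hc | rfl
    · exact mem_of_eq_zero (w_zero_of_right a b (by rw [minExp_al2]; omega))
    · exact w_mem_of_right _ (Submodule.mem_span_singleton_self _) a b
  · intro a b c _
    exact mem_of_eq_zero (w_zero_of_degree (by rw [minExp_th]; omega))

theorem isStrip_second (h : IsSecondKind lam mu) {l : ℕ} (hl : 1 ≤ l) (hl' : l ≤ mu.2 - lam.2) :
    IsStrip lam mu (mu.1 + 1) (lam.2 + 1) (mu.1 + lam.2 + l) (lam.1 - l + 1)
      (mu.2 - mu.1 - l + 1) (Submodule.span UCur {w lam mu 0 (mu.1 + lam.2 + l + 1) 0}) := by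
  obtain ⟨h3, h4, h5⟩ := h
  simp only [Wt.size] at h3
  constructor
  all_goals try omega
  · intro a b c _ ha
    exact mem_of_eq_zero (w_zero_of_left b c (by rw [minExp_al1]; omega))
  · intro a b c _ hc
    exact mem_of_eq_zero (w_zero_of_right a b (by rw [minExp_al2]; omega))
  · intro a b c habc
    exact w_mem_of_theta _ (Submodule.mem_span_singleton_self _) habc

end

noncomputable section

/-! ### Counting dimensions -/

theorem finite_of_surjective_of_ker {A C : Type*} [AddCommGroup A] [Module ℂ A] [AddCommGroup C]
    [Module ℂ C] (g : A →ₗ[ℂ] C) (hg : Function.Surjective g) [Module.Finite ℂ C]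
    [Module.Finite ℂ (LinearMap.ker g)] :
    Module.Finite ℂ A ∧
      Module.finrank ℂ A = Module.finrank ℂ C + Module.finrank ℂ (LinearMap.ker g) := by
  have e := LinearMap.quotKerEquivOfSurjective g hg
  have : Module.Finite ℂ (A ⧸ LinearMap.ker g) := Module.Finite.equiv e.symm
  have hA : Module.Finite ℂ A := Module.Finite.of_submodule_quotient (LinearMap.ker g)
  refine ⟨hA, ?_⟩
  rw [← LinearMap.finrank_range_add_finrank_ker g, LinearMap.range_eq_top.2 hg, finrank_top]

variable {lam mu : Wt}

theorem finite_of_quotient {A B : Submodule UCur (F lam mu)} (hBA : B ≤ A) [Module.Finite ℂ B]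
    [Module.Finite ℂ (A ⧸ B.submoduleOf A)] :
    Module.Finite ℂ A ∧
      Module.finrank ℂ A = Module.finrank ℂ (A ⧸ B.submoduleOf A) + Module.finrank ℂ B := by
  let g : A →ₗ[ℂ] (A ⧸ B.submoduleOf A) := (B.submoduleOf A).mkQ.restrictScalars ℂ
  have e : LinearMap.ker g ≃ₗ[ℂ] B :=
    (LinearEquiv.ofEq _ ((B.submoduleOf A).restrictScalars ℂ) (by
      rw [LinearMap.ker_restrictScalars, Submodule.ker_mkQ])).trans
      ((Submodule.submoduleOfEquivOfLe hBA).restrictScalars ℂ)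
  have : Module.Finite ℂ (LinearMap.ker g) := Module.Finite.equiv e.symm
  have hg : Function.Surjective g := Submodule.mkQ_surjective (B.submoduleOf A)
  have := finite_of_surjective_of_ker g hg
  rwa [e.finrank_eq] at this

instance isScalarTower_directSum {I : Type} (ν : I → Wt) :
    IsScalarTower ℂ UCur (⨁ i, EvV (ν i)) :=
  inferInstanceAs (IsScalarTower ℂ UCur (Π₀ i, EvV (ν i)))

section

variable {I : Type} [DecidableEq I] [Fintype I] {ν : I → Wt} {m : ℕ} {x : I → F lam mu}
  {A B : Submodule UCur (F lam mu)}

theorem SumSurj.finite (h : SumSurj ν m x A B) (hBA : B ≤ A) [Module.Finite ℂ B] :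
    Module.Finite ℂ A ∧
      Module.finrank ℂ A ≤ ∑ i, Module.finrank ℂ (EvV (ν i)) + Module.finrank ℂ B := by
  obtain ⟨φ, -, -, hφ⟩ := h
  have h1 : Module.Finite ℂ (A ⧸ B.submoduleOf A) :=
    Module.Finite.of_surjective (φ.restrictScalars ℂ) hφ
  have h2 := LinearMap.finrank_le_finrank_of_surjective (f := φ.restrictScalars ℂ) hφ
  rw [Module.finrank_directSum] at h2
  have h3 := finite_of_quotient hBA
  exact ⟨h3.1, by omega⟩

theorem SumSurj.sumIso (h : SumSurj ν m x A B) (hBA : B ≤ A) [Module.Finite ℂ B]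
    (heq : ∑ i, Module.finrank ℂ (EvV (ν i)) + Module.finrank ℂ B ≤ Module.finrank ℂ A) :
    SumIso ν m x A B := by
  obtain ⟨φ, h1, h2, hφ⟩ := h
  refine ⟨φ, h1, h2, ?_, hφ⟩
  have h3 : Module.Finite ℂ (A ⧸ B.submoduleOf A) :=
    Module.Finite.of_surjective (φ.restrictScalars ℂ) hφ
  have h4 := (finite_of_quotient hBA).2
  have h5 := LinearMap.finrank_le_finrank_of_surjective (f := φ.restrictScalars ℂ) hφ
  rw [← Module.finrank_directSum] at heq
  exact (LinearMap.injective_iff_surjective_of_finrank_eq_finrank (f := φ.restrictScalars ℂ)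
    (by omega)).2 hφ

end

theorem stripFilt_succ_le (S : Finset (ℕ × ℕ)) (n : ℕ) (R : Submodule UCur (F lam mu)) (j : ℕ) :
    stripFilt S n R (j + 1) ≤ stripFilt S n R j := by
  refine sup_le_sup_right (Submodule.span_mono ?_) R
  rintro _ ⟨p, hp, hpj, rfl⟩
  exact ⟨p, hp, by omega, rfl⟩

namespace IsStrip

variable {k m n : ℕ} {X Y : ℤ} {R : Submodule UCur (F lam mu)}

theorem sum_index {I : Type} [Fintype I] {S : Finset (ℕ × ℕ)} {j : ℕ} (a : I → ℕ × ℕ)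
    (hinj : Function.Injective a) (ha : ∀ p, (∃ i, a i = p) ↔ p ∈ S ∧ p.1 + p.2 = j)
    (f : ℕ × ℕ → ℕ) : ∑ i, f (a i) = ∑ p ∈ S.filter (fun p => p.1 + p.2 = j), f p := by
  refine Finset.sum_bij (fun i _ => a i) ?_ ?_ ?_ ?_
  · intro i _
    rw [Finset.mem_filter]
    exact (ha _).1 ⟨i, rfl⟩
  · intro i _ i' _ h; exact hinj h
  · intro p hp
    rw [Finset.mem_filter] at hp
    obtain ⟨i, hi⟩ := (ha p).2 hp
    exact ⟨i, Finset.mem_univ _, hi⟩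
  · intro i _; rfl

theorem finite_step (h : IsStrip lam mu k m n X Y R) {j : ℕ} (hj : j ≤ n)
    [Module.Finite ℂ (stripFilt (rectSet k m X Y) n R (j + 1))] :
    Module.Finite ℂ (stripFilt (rectSet k m X Y) n R j) ∧
      Module.finrank ℂ (stripFilt (rectSet k m X Y) n R j) ≤
        ∑ p ∈ (rectSet k m X Y).filter (fun p => p.1 + p.2 = j),
          Module.finrank ℂ (EvV (stripWt m X Y p)) +
        Module.finrank ℂ (stripFilt (rectSet k m X Y) n R (j + 1)) := by
  let I := {p : ℕ × ℕ // p ∈ (rectSet k m X Y).filter (fun p => p.1 + p.2 = j)}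
  have ha : ∀ p, (∃ i : I, i.1 = p) ↔ p ∈ rectSet k m X Y ∧ p.1 + p.2 = j := by
    intro p
    refine ⟨?_, fun hp => ⟨⟨p, Finset.mem_filter.2 hp⟩, rfl⟩⟩
    rintro ⟨i, rfl⟩
    exact Finset.mem_filter.1 i.2
  have : Fintype I := Finset.Subtype.fintype _
  have h1 := (h.sumSurj hj (fun i : I => i.1) ha).finite (stripFilt_succ_le _ _ _ _)
  rwa [sum_index (fun i : I => i.1) Subtype.val_injective ha
    (fun p => Module.finrank ℂ (EvV (stripWt m X Y p)))] at h1

theorem sum_filter_succ (S : Finset (ℕ × ℕ)) (f : ℕ × ℕ → ℕ) (j : ℕ) :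
    ∑ p ∈ S.filter (fun p => j ≤ p.1 + p.2), f p =
      ∑ p ∈ S.filter (fun p => p.1 + p.2 = j), f p +
        ∑ p ∈ S.filter (fun p => j + 1 ≤ p.1 + p.2), f p := by
  simp only [Finset.sum_filter]
  rw [← Finset.sum_add_distrib]
  refine Finset.sum_congr rfl fun p _ => ?_
  split_ifs <;> omega

/-- Each term is finite-dimensional, and its dimension is bounded by the sum of the dimensions of
the subquotients. -/
theorem finite_filt (h : IsStrip lam mu k m n X Y R) [Module.Finite ℂ R] {j : ℕ} (hj : j ≤ n + 1) :
    Module.Finite ℂ (stripFilt (rectSet k m X Y) n R j) ∧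
      Module.finrank ℂ (stripFilt (rectSet k m X Y) n R j) ≤
        ∑ p ∈ (rectSet k m X Y).filter (fun p => j ≤ p.1 + p.2),
          Module.finrank ℂ (EvV (stripWt m X Y p)) + Module.finrank ℂ R := by
  induction hj using Nat.decreasingInduction with
  | self => rw [h.filt_top]; exact ⟨inferInstance, by omega⟩
  | of_succ j hj ih =>
    obtain ⟨h1, h2⟩ := ih
    obtain ⟨h3, h4⟩ := h.finite_step (j := j) (by omega)
    refine ⟨h3, ?_⟩
    rw [sum_filter_succ]
    omega

theorem finite_zero (h : IsStrip lam mu k m n X Y R) [Module.Finite ℂ R] :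
    Module.Finite ℂ (stripFilt (rectSet k m X Y) n R 0) ∧
      Module.finrank ℂ (stripFilt (rectSet k m X Y) n R 0) ≤
        ∑ p ∈ rectSet k m X Y, Module.finrank ℂ (EvV (stripWt m X Y p)) + Module.finrank ℂ R := by
  simpa using h.finite_filt (j := 0) (Nat.zero_le _)

/-- If the dimension of the first term is the sum of the dimensions of the sources, then all the
maps onto the subquotients are isomorphisms. -/
theorem sumIso (h : IsStrip lam mu k m n X Y R) [Module.Finite ℂ R]
    (heq : ∑ p ∈ rectSet k m X Y, Module.finrank ℂ (EvV (stripWt m X Y p)) + Module.finrank ℂ R ≤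
      Module.finrank ℂ (stripFilt (rectSet k m X Y) n R 0))
    {I : Type} [DecidableEq I] {j : ℕ} (hj : j ≤ n) (a : I → ℕ × ℕ)
    (hinj : Function.Injective a)
    (ha : ∀ p, (∃ i, a i = p) ↔ p ∈ rectSet k m X Y ∧ p.1 + p.2 = j) :
    SumIso (fun i => stripWt m X Y (a i)) n (fun i => w lam mu (a i).1 (n - j) (a i).2)
      (stripFilt (rectSet k m X Y) n R j) (stripFilt (rectSet k m X Y) n R (j + 1)) := by
  have : Finite I := Finite.of_injective
    (fun i => (⟨a i, ((ha _).1 ⟨i, rfl⟩).1⟩ : {p // p ∈ rectSet k m X Y}))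
    fun i i' hi => hinj (congrArg Subtype.val hi)
  have : Fintype I := Fintype.ofFinite I
  set f : ℕ × ℕ → ℕ := fun p => Module.finrank ℂ (EvV (stripWt m X Y p)) with hf
  set S := rectSet k m X Y with hS
  have hfin : ∀ j, j ≤ n + 1 → Module.Finite ℂ (stripFilt S n R j) ∧
      Module.finrank ℂ (stripFilt S n R j) ≤
        ∑ p ∈ S.filter (fun p => j ≤ p.1 + p.2), f p + Module.finrank ℂ R :=
    fun j hj => h.finite_filt hj
  have := (hfin (j + 1) (by omega)).1
  refine (h.sumSurj hj a ha).sumIso (stripFilt_succ_le _ _ _ _) ?_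
  rw [sum_index a hinj ha f]
  -- the dimension of the first term, compared with the one of the term with index `j`
  have hdown : ∀ j, j ≤ n + 1 → ∑ p ∈ S.filter (fun p => j ≤ p.1 + p.2), f p +
      Module.finrank ℂ R ≤ Module.finrank ℂ (stripFilt S n R j) := by
    intro j
    induction j with
    | zero => intro _; simpa using heq
    | succ j ih =>
      intro hj
      have h1 := ih (by omega)
      have := (hfin (j + 1) hj).1
      have h2 : Module.finrank ℂ (stripFilt S n R j) ≤
          ∑ p ∈ S.filter (fun p => p.1 + p.2 = j), f p +
            Module.finrank ℂ (stripFilt S n R (j + 1)) := (h.finite_step (j := j) (by omega)).2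
      rw [sum_filter_succ] at h1
      omega
  have h1 := hdown j (by omega)
  have h2 := (hfin (j + 1) (by omega)).2
  rw [sum_filter_succ] at h1
  change _ + Module.finrank ℂ (stripFilt S n R (j + 1)) ≤ Module.finrank ℂ (stripFilt S n R j)
  omega

theorem weyl_stripWt {p : ℕ × ℕ} (hp : p ∈ rectSet k m X Y) :
    weyl (stripWt m X Y p).1 (stripWt m X Y p).2 =
      weyl (X - m - p.1 + 2 * p.2) (Y - 1 + 2 * p.1 - p.2) := by
  simp only [rectSet, Finset.mem_filter, Finset.mem_product, Finset.mem_range] at hp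
  simp only [stripWt, dom]
  rw [Int.toNat_of_nonneg (by omega), Int.toNat_of_nonneg (by omega)]

theorem sum_weyl (h : IsStrip lam mu k m n X Y R) :
    ∑ p ∈ rectSet k m X Y, weyl (stripWt m X Y p).1 (stripWt m X Y p).2 = rectSum k m X Y := by
  rw [← sum_rectSet k m X Y h.hX h.hY (by have := h.hXY; omega)]
  exact Finset.sum_congr rfl fun p hp => weyl_stripWt hp

theorem two_mul_sum_le (h : IsStrip lam mu k m n X Y R) :
    2 * ((∑ p ∈ rectSet k m X Y, Module.finrank ℂ (EvV (stripWt m X Y p)) : ℕ) : ℤ) ≤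
      rectSum k m X Y := by
  rw [← h.sum_weyl, Nat.cast_sum, Finset.mul_sum]
  refine Finset.sum_le_sum fun p _ => ?_
  have := finrank_evV_le (stripWt m X Y p)
  rw [weyl]
  exact_mod_cast this

end IsStrip

theorem IsKerPlus.finite {K : Submodule UCur (F lam mu)} (h : IsKerPlus lam mu K)
    [Module.Finite ℂ K] [Module.Finite ℂ (FPlus lam mu)] :
    Module.Finite ℂ (F lam mu) ∧
      Module.finrank ℂ (F lam mu) = Module.finrank ℂ (FPlus lam mu) + Module.finrank ℂ K := by
  obtain ⟨φ, -, hφ, rfl⟩ := h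
  have e : LinearMap.ker (φ.restrictScalars ℂ) ≃ₗ[ℂ] LinearMap.ker φ :=
    LinearEquiv.refl ℂ _
  have : Module.Finite ℂ (LinearMap.ker (φ.restrictScalars ℂ)) := Module.Finite.equiv e.symm
  have := finite_of_surjective_of_ker (φ.restrictScalars ℂ) hφ
  rwa [e.finrank_eq] at this

end

noncomputable section

/-! ### The kernel of `F_{λ,μ} → F⁺_{λ,μ}` -/

variable {lam mu : Wt}

theorem span_divPow (u : UCur) (n : ℕ) : Submodule.span UCur {u ^ n • vF lam mu} =
    Submodule.span UCur {divPow u n • vF lam mu} := by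
  have h : (n.factorial : ℂ) ≠ 0 := Nat.cast_ne_zero.2 n.factorial_ne_zero
  rw [divPow, smul_assoc]
  refine le_antisymm ?_ ?_
  all_goals rw [Submodule.span_le, Set.singleton_subset_iff]
  · have := Submodule.smul_of_tower_mem _ (n.factorial : ℂ) (Submodule.mem_span_singleton_self
      (R := UCur) ((n.factorial : ℂ)⁻¹ • u ^ n • vF lam mu))
    rwa [smul_inv_smul₀ h] at this
  · exact Submodule.smul_of_tower_mem _ _ (Submodule.mem_span_singleton_self _)

theorem span_pow_al1 (n : ℕ) : Submodule.span UCur {tpow (xm .al1) 1 ^ n • vF lam mu} =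
    Submodule.span UCur {w lam mu n 0 0} := by
  rw [span_divPow]; simp [w, divPow]

theorem span_pow_th (n : ℕ) : Submodule.span UCur {tpow (xm .th) 1 ^ n • vF lam mu} =
    Submodule.span UCur {w lam mu 0 n 0} := by
  rw [span_divPow]; simp [w, divPow]

theorem span_pow_al2 (n : ℕ) : Submodule.span UCur {tpow (xm .al2) 1 ^ n • vF lam mu} =
    Submodule.span UCur {w lam mu 0 0 n} := by
  rw [span_divPow]; simp [w, divPow]

/-- The map onto `F⁺_{λ,μ}` exists, and its kernel is generated by the additional relations
`(x_α⁻ ⊗ t)^(m_α + 1)`. -/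
theorem isKerPlus_of_minExp (hsum : lam + mu = (plusPair lam mu).1 + (plusPair lam mu).2)
    {p q r : ℕ} (h1 : minExp (plusPair lam mu).1 (plusPair lam mu).2 .al1 + 1 = p)
    (h2 : minExp (plusPair lam mu).1 (plusPair lam mu).2 .th + 1 = q)
    (h3 : minExp (plusPair lam mu).1 (plusPair lam mu).2 .al2 + 1 = r)
    (hp : p ≤ minExp lam mu .al1 + 1) (hq : q ≤ minExp lam mu .th + 1)
    (hr : r ≤ minExp lam mu .al2 + 1) :
    IsKerPlus lam mu (Submodule.span UCur {w lam mu p 0 0} ⊔ (Submodule.span UCur {w lam mu 0 q 0} ⊔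
      Submodule.span UCur {w lam mu 0 0 r})) := by
  obtain ⟨φ, hφ, hsurj, hker⟩ := exists_quotient_map hsum (by
    intro α
    cases α <;> omega)
  refine ⟨φ, hφ, hsurj, hker.trans ?_⟩
  rw [← span_pow_al1, ← span_pow_th, ← span_pow_al2, ← h1, ← h2, ← h3]
  refine le_antisymm ?_ (sup_le ?_ (sup_le ?_ ?_))
  · rw [Submodule.span_le]
    rintro _ ⟨α, rfl⟩
    cases α with
    | al1 => exact Submodule.mem_sup_left (Submodule.mem_span_singleton_self _)
    | th =>
      exact Submodule.mem_sup_right (Submodule.mem_sup_left (Submodule.mem_span_singleton_self _))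
    | al2 =>
      exact Submodule.mem_sup_right (Submodule.mem_sup_right (Submodule.mem_span_singleton_self _))
  · exact Submodule.span_mono (Set.singleton_subset_iff.2 ⟨.al1, rfl⟩)
  · exact Submodule.span_mono (Set.singleton_subset_iff.2 ⟨.th, rfl⟩)
  · exact Submodule.span_mono (Set.singleton_subset_iff.2 ⟨.al2, rfl⟩)

theorem span_le_of_theta {n a b c : ℕ} (h : a + b + c = n) :
    Submodule.span UCur {w lam mu a b c} ≤ Submodule.span UCur {w lam mu 0 n 0} := by
  rw [Submodule.span_le, Set.singleton_subset_iff]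
  exact w_mem_of_theta _ (Submodule.mem_span_singleton_self _) h

theorem span_eq_bot_of_eq_zero {x : F lam mu} (h : x = 0) : Submodule.span UCur {x} = ⊥ := by
  rw [h]; exact Submodule.span_zero_singleton UCur

theorem plusPair_right (h : IsFirstKind lam mu) (h2 : 0 < mu.2) :
    plusPair lam mu = ((lam.1, lam.2 + 1), (mu.1, mu.2 - 1)) := by
  obtain ⟨-, -, h5⟩ := h
  rw [plusPair, if_neg (by omega), if_pos h2]

theorem plusPair_left (h2 : mu.2 = 0) :
    plusPair lam mu = ((lam.1 + 1, lam.2), (mu.1 - 1, mu.2)) := by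
  rw [plusPair, if_neg (by omega), if_neg (by omega)]

theorem plusPair_second (h : IsSecondKind lam mu) :
    plusPair lam mu = ((lam.1, mu.2), (mu.1, lam.2)) := by
  obtain ⟨-, -, h5⟩ := h
  rw [plusPair, if_pos h5, show lam.2 + (mu.2 - lam.2) = mu.2 by omega,
    show mu.2 - (mu.2 - lam.2) = lam.2 by omega]

theorem isKerPlus_right (h : IsFirstKind lam mu) (h1 : mu.1 = 0) (h2 : 0 < mu.2) :
    IsKerPlus lam mu (stripFilt (rectSet 1 (mu.2 + 1) (lam.1 + 1) (lam.2 + 1)) mu.2 ⊥ 0) := by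
  have e := plusPair_right h h2
  rw [(isStrip_right h h1).filt_zero]
  obtain ⟨h3, h4, h5⟩ := h
  simp only [Wt.size] at h3
  have := isKerPlus_of_minExp (lam := lam) (mu := mu) (p := 1) (q := mu.2) (r := mu.2)
    (by rw [e]; ext <;> simp <;> omega)
    (by rw [e, minExp_al1]; dsimp only; omega) (by rw [e, minExp_th]; dsimp only; omega)
    (by rw [e, minExp_al2]; dsimp only; omega) (by omega)
    (by rw [minExp_th]; omega) (by rw [minExp_al2]; omega)
  rwa [span_eq_bot_of_eq_zero (w_zero_of_left 0 0 (by rw [minExp_al1]; omega)), bot_sup_eq,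
    sup_eq_left.2 (span_le_of_theta (by omega)), ← sup_bot_eq (Submodule.span UCur _)] at this

theorem isKerPlus_left (h : IsFirstKind lam mu) (h1 : mu.2 = 0) (h2 : 0 < mu.1) :
    IsKerPlus lam mu
      (stripFilt (rectSet (mu.1 + 1) 1 (lam.1 + 1) (lam.2 - mu.1 + 1)) mu.1 ⊥ 0) := by
  have e := plusPair_left (lam := lam) h1
  rw [(isStrip_left h h1).filt_zero]
  obtain ⟨h3, h4, h5⟩ := h
  simp only [Wt.size] at h3
  have := isKerPlus_of_minExp (lam := lam) (mu := mu) (p := mu.1) (q := mu.1) (r := 1)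
    (by rw [e]; ext <;> simp <;> omega)
    (by rw [e, minExp_al1]; dsimp only; omega) (by rw [e, minExp_th]; dsimp only; omega)
    (by rw [e, minExp_al2]; dsimp only; omega) (by rw [minExp_al1]; omega)
    (by rw [minExp_th]; omega) (by omega)
  rwa [span_eq_bot_of_eq_zero (w_zero_of_right 0 0 (c := 1) (by rw [minExp_al2]; omega)),
    sup_bot_eq,
    sup_eq_right.2 (span_le_of_theta (by omega)), ← sup_bot_eq (Submodule.span UCur _)] at this

theorem isKerPlus_first (h : IsFirstKind lam mu) (h2 : 0 < mu.2) :
    IsKerPlus lam mu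
      (stripFilt (rectSet (mu.1 + 1) mu.2 lam.1 (lam.2 - mu.1 + 1)) mu.size
        (Submodule.span UCur {w lam mu 0 0 mu.2}) 0) := by
  have e := plusPair_right h h2
  rw [(isStrip_first h).filt_zero]
  obtain ⟨h3, h4, h5⟩ := h
  simp only [Wt.size] at h3 ⊢
  have := isKerPlus_of_minExp (lam := lam) (mu := mu) (p := mu.1 + 1) (q := mu.1 + mu.2)
    (r := mu.2)
    (by rw [e]; ext <;> simp; omega)
    (by rw [e, minExp_al1]; dsimp only; omega) (by rw [e, minExp_th]; dsimp only; omega)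
    (by rw [e, minExp_al2]; dsimp only; omega) (by rw [minExp_al1]; omega)
    (by rw [minExp_th]; omega) (by rw [minExp_al2]; omega)
  rwa [span_eq_bot_of_eq_zero (w_zero_of_left 0 0 (by rw [minExp_al1]; omega)), bot_sup_eq] at this

theorem isKerPlus_second (h : IsSecondKind lam mu) :
    IsKerPlus lam mu (Submodule.span UCur {w lam mu 0 (mu.1 + lam.2 + 1) 0}) := by
  have e := plusPair_second h
  obtain ⟨h3, h4, h5⟩ := h
  simp only [Wt.size] at h3
  have := isKerPlus_of_minExp (lam := lam) (mu := mu) (p := mu.1 + 1) (q := mu.1 + lam.2 + 1)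
    (r := lam.2 + 1)
    (by rw [e]; ext <;> simp; omega)
    (by rw [e, minExp_al1]; dsimp only; omega) (by rw [e, minExp_th]; dsimp only; omega)
    (by rw [e, minExp_al2]; dsimp only; omega) (by rw [minExp_al1]; omega)
    (by rw [minExp_th]; omega) (by rw [minExp_al2]; omega)
  rwa [span_eq_bot_of_eq_zero (w_zero_of_left 0 0 (by rw [minExp_al1]; omega)), bot_sup_eq,
    span_eq_bot_of_eq_zero (w_zero_of_right 0 0 (c := lam.2 + 1) (by rw [minExp_al2]; omega)),
    sup_bot_eq] at this

/-! ### The filtrations of the kernel as strips -/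

theorem filtA_eq (h : IsFirstKind lam mu) (h1 : mu.1 = 0) {j : ℕ}
    (hj : mu.2 - lam.1 ≤ j) (hj' : j ≤ mu.2 + 1) : filtA lam mu j =
      stripFilt (rectSet 1 (mu.2 + 1) (lam.1 + 1) (lam.2 + 1)) mu.2 ⊥ j := by
  have hs := isStrip_right h h1
  rcases hj'.lt_or_eq with hlt | rfl
  · rw [filtA, if_pos (by omega)]
    refine le_antisymm (sup_le ?_ ?_) (sup_le ?_ bot_le)
    · rw [Submodule.span_le, Set.singleton_subset_iff]
      simpa using hs.w_mem (j := j) (a₁ := 0) (a₂ := j) (by omega) (by omega)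
    · rw [Submodule.span_le, Set.singleton_subset_iff]
      simpa using hs.w_mem (j := j) (a₁ := 0) (a₂ := mu.2) (by omega) (by omega)
    · rw [Submodule.span_le]
      rintro _ ⟨p, hp, hpj, rfl⟩
      simp only [rectSet, Finset.mem_filter, Finset.mem_product, Finset.mem_range] at hp
      refine Submodule.mem_sup_left ?_
      have := dw_mem_of_e1 F_isSquareZero isHighest_vF
        (Submodule.span UCur {w lam mu 0 (mu.2 - j) j}) (a := 0) (b := mu.2 - p.2) (c := j)
        (p.2 - j) (by
          rw [show mu.2 - p.2 + (p.2 - j) = mu.2 - j by omega]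
          exact Submodule.mem_span_singleton_self _)
      rw [show j + (p.2 - j) = p.2 by omega] at this
      rw [show p.1 = 0 by omega, zero_add]
      exact this
  · rw [hs.filt_top, filtA, if_neg (by omega)]

theorem filtB_eq (h : IsFirstKind lam mu) (h1 : mu.2 = 0) {j : ℕ}
    (hj : mu.1 - lam.2 ≤ j) (hj' : j ≤ mu.1 + 1) : filtB lam mu j =
      stripFilt (rectSet (mu.1 + 1) 1 (lam.1 + 1) (lam.2 - mu.1 + 1)) mu.1 ⊥ j := by
  have hs := isStrip_left h h1
  rcases hj'.lt_or_eq with hlt | rfl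
  · rw [filtB, if_pos (by omega)]
    refine le_antisymm (sup_le ?_ ?_) (sup_le ?_ bot_le)
    · rw [Submodule.span_le, Set.singleton_subset_iff]
      simpa using hs.w_mem (j := j) (a₁ := j) (a₂ := 0) (by omega) (by omega)
    · rw [Submodule.span_le, Set.singleton_subset_iff]
      simpa using hs.w_mem (j := j) (a₁ := mu.1) (a₂ := 0) (by omega) (by omega)
    · rw [Submodule.span_le]
      rintro _ ⟨p, hp, hpj, rfl⟩
      simp only [rectSet, Finset.mem_filter, Finset.mem_product, Finset.mem_range] at hp
      refine Submodule.mem_sup_left ?_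
      have := dw_mem_of_e2 F_isSquareZero isHighest_vF
        (Submodule.span UCur {w lam mu j (mu.1 - j) 0}) (a := j) (b := mu.1 - p.1) (c := 0)
        (p.1 - j) (by
          rw [show mu.1 - p.1 + (p.1 - j) = mu.1 - j by omega]
          exact Submodule.mem_span_singleton_self _)
      rw [show j + (p.1 - j) = p.1 by omega] at this
      rw [show p.2 = 0 by omega, add_zero]
      exact this
  · rw [hs.filt_top, filtB, if_neg (by omega)]

/-- The terms below the smallest index of an element of the strip agree. -/
theorem stripFilt_eq_zero {S : Finset (ℕ × ℕ)} {n j : ℕ} {R : Submodule UCur (F lam mu)}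
    (h : ∀ p ∈ S, j ≤ p.1 + p.2) : stripFilt S n R j = stripFilt S n R 0 := by
  rw [stripFilt, stripFilt]
  congr 2
  ext x
  exact ⟨fun ⟨p, hp, _, hx⟩ => ⟨p, hp, Nat.zero_le _, hx⟩,
    fun ⟨p, hp, _, hx⟩ => ⟨p, hp, h p hp, hx⟩⟩

theorem mem_Sninv {p : ℕ × ℕ} :
    p ∈ Sninv lam mu ↔ p ∈ rectSet (mu.1 + 1) mu.2 lam.1 (lam.2 - mu.1 + 1) := by
  simp only [Sninv, Set.mem_ofPred_eq, rectSet, Finset.mem_filter, Finset.mem_product,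
    Finset.mem_range]
  omega

theorem mem_Sinv {l : ℕ} {p : ℕ × ℕ} : p ∈ Sinv lam mu l ↔
    p ∈ rectSet (mu.1 + 1) (lam.2 + 1) (lam.1 - l + 1) (mu.2 - mu.1 - l + 1) := by
  simp only [Sinv, Set.mem_ofPred_eq, rectSet, Finset.mem_filter, Finset.mem_product,
    Finset.mem_range]
  omega

theorem filtNinv_eq (j : ℕ) : filtNinv lam mu j =
    stripFilt (rectSet (mu.1 + 1) mu.2 lam.1 (lam.2 - mu.1 + 1)) mu.size
      (Submodule.span UCur {w lam mu 0 0 mu.2}) j := by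
  simp only [filtNinv, stripFilt, mem_Sninv]

theorem filtInv_eq (h : IsSecondKind lam mu) {l : ℕ} (hl : 1 ≤ l) (hl' : l ≤ mu.2 - lam.2) (j : ℕ) :
    filtInv lam mu l j =
      stripFilt (rectSet (mu.1 + 1) (lam.2 + 1) (lam.1 - l + 1) (mu.2 - mu.1 - l + 1))
        (mu.1 + lam.2 + l) (Submodule.span UCur {w lam mu 0 (mu.1 + lam.2 + l + 1) 0}) j := by
  rw [filtInv]
  split_ifs with hj
  · subst hj
    rw [(isStrip_second h hl hl').filt_zero, eq_comm, sup_eq_left, Submodule.span_le,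
      Set.singleton_subset_iff]
    have := (Submodule.span UCur {w lam mu 0 (mu.1 + lam.2 + l) 0}).smul_mem (tpow (xm .th) 1)
      (Submodule.mem_span_singleton_self _)
    rw [w_eq_dw, fth_dw F_isSquareZero] at this
    exact (Submodule.smul_mem_iff _ (Nat.cast_add_one_ne_zero (R := ℂ) _)).1 this
  · simp only [stripFilt, mem_Sinv]

/-- The last term of a strip for a pair of second kind is the first term of the next one. -/
theorem span_theta_eq (h : IsSecondKind lam mu) {l : ℕ} (hl : l ≤ mu.2 - lam.2) :
    Submodule.span UCur {w lam mu 0 (mu.1 + lam.2 + l + 1) 0} =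
      if l < mu.2 - lam.2 then filtInv lam mu (l + 1) 0 else ⊥ := by
  split_ifs with h1
  · rw [filtInv, if_pos rfl]; rfl
  · obtain ⟨h3, h4, h5⟩ := h
    simp only [Wt.size] at h3
    exact span_eq_bot_of_eq_zero (w_zero_of_degree (by rw [minExp_th]; omega))

theorem filtInvNext_eq (h : IsSecondKind lam mu) {l : ℕ} (hl : 1 ≤ l) (hl' : l ≤ mu.2 - lam.2)
    {j : ℕ} (hj : j ≤ mu.1 + lam.2) : filtInvNext lam mu l j =
      stripFilt (rectSet (mu.1 + 1) (lam.2 + 1) (lam.1 - l + 1) (mu.2 - mu.1 - l + 1))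
        (mu.1 + lam.2 + l) (Submodule.span UCur {w lam mu 0 (mu.1 + lam.2 + l + 1) 0})
        (j + 1) := by
  rw [filtInvNext]
  split_ifs with h1 h2
  · exact filtInv_eq h hl hl' _
  all_goals
    have e := span_theta_eq h hl'
    first | rw [if_pos h2] at e | rw [if_neg h2] at e
    rw [← e]
    refine le_antisymm le_sup_right (sup_le ?_ le_rfl)
    rw [Submodule.span_le]
    rintro _ ⟨p, hp, hpj, rfl⟩
    simp only [rectSet, Finset.mem_filter, Finset.mem_product, Finset.mem_range] at hp
    omega

end

noncomputable section

/-! ### Upper bounds for the dimension of `F_{λ,μ}` -/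

variable {lam mu : Wt}

/-- For a pair of first kind, the submodule generated by `w(0, 0, μ₂)` is a quotient of
`τ_{μ₂}^* F_{λ + μ₂(ω₁ - ω₂), μ₁ω₁}`. -/
theorem exists_map_right (h : IsFirstKind lam mu) :
    ∃ φ : F (lam.1 + mu.2, lam.2 - mu.2) (mu.1, 0) →ₗ[UCur]
        Submodule.span UCur {w lam mu 0 0 mu.2},
      ((φ (vF _ _) : Submodule.span UCur {w lam mu 0 0 mu.2}) : F lam mu) = w lam mu 0 0 mu.2 ∧
      (∀ r, ∀ z ∈ gradeF (lam.1 + mu.2, lam.2 - mu.2) (mu.1, 0) r,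
        ((φ z : Submodule.span UCur {w lam mu 0 0 mu.2}) : F lam mu) ∈
          gradeF lam mu (r + mu.2)) ∧
      Function.Surjective φ := by
  obtain ⟨h3, h4, h5⟩ := h
  simp only [Wt.size] at h3
  have hk : IsSquareZero (F lam mu) := F_isSquareZero
  have hv : IsHighest (vF lam mu) (lam + mu) := isHighest_vF
  set z := w lam mu 0 0 mu.2 with hz
  have hzdw : z = dw (vF lam mu) 0 0 mu.2 := rfl
  have he : ∀ α, α ≠ .th → tpow (xp α) 0 • z = 0 := by
    intro α hα
    rw [hzdw]
    cases α with
    | al1 => exact (e1_dw hk hv _ 0 _).2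
    | al2 => exact (e2_dw hk hv _ 0 _).2
    | th => exact absurd rfl hα
  have hw : ∀ α, α ≠ .th →
      tpow (hh α) 0 • z = ((Wt.eval (lam.1 + mu.2 + mu.1, lam.2 - mu.2) α : ℕ) : ℂ) • z := by
    intro α hα
    rw [hzdw, h_dw hv]
    have : (((lam + mu).eval α : ℤ) - (0 : ℕ) * cartan .al1 α - (0 : ℕ) * cartan .th α -
        mu.2 * cartan .al2 α) = (Wt.eval (lam.1 + mu.2 + mu.1, lam.2 - mu.2) α : ℕ) := by
      cases α with
      | al1 => simp only [Wt.eval, Prod.fst_add, cartan]; omega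
      | al2 => simp only [Wt.eval, Prod.snd_add, cartan]; omega
      | th => exact absurd rfl hα
    rw [this, Int.cast_natCast]
  have hT : IsTruncated z (lam.1 + mu.2 + mu.1, lam.2 - mu.2)
      (minExp (lam.1 + mu.2, lam.2 - mu.2) (mu.1, 0)) :=
    { pos := by
        intro α s
        rcases s with _ | s
        · by_cases hα : α = .th
          · have hcomm := tpow_smul_comm (M := F lam mu) (xp .al1) (xp .al2) 0 0 z
            rw [lie_e1_e2, he _ (by simp), he _ (by simp), smul_zero, smul_zero, zero_add] at hcomm
            rw [hα]
            exact hcomm.symm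
          · exact he α hα
        · rw [hzdw, tpow_dw hk _ (by omega), hv.pos, dw_zero_right]
      car := by
        intro α s _
        rw [hzdw, tpow_dw hk _ (by omega), hv.car', dw_zero_right]
      wt := by
        intro α hα
        rw [hw α hα, algebraMap_smul]
      int := by
        intro α hα
        obtain ⟨K, hK⟩ := F_nilpotent α hα z
        have := sl2_pow_eq_zero (act_ef (M := F lam mu) α) (act_hf_self α) (v := z) (he α hα)
          (hw α hα) (K := K) (by rw [act_pow_apply, hK])
        rwa [act_pow_apply] at this
      sq := fun α s hs => hk _ s hs z
      -- powers of `x_α⁻ ⊗ t` applied to `w(0, 0, μ₂)` give the vectors `w(μ₁ + 1, 0, μ₂)`,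
      -- `w(0, 0, μ₂ + 1)` and `w(0, μ₁ + 1, μ₂)`, which are zero in `F_{λ,μ}`
      nil := by
        intro α
        rw [← act_pow_apply]
        cases α with
        | al1 =>
          have h0 := w_zero_of_left (lam := lam) (mu := mu) (a := mu.1 + 1) 0 mu.2
            (by rw [minExp_al1]; omega)
          rw [minExp_al1, show min (lam.1 + mu.2) mu.1 = mu.1 by omega]
          rw [w_eq_dw, dw_eq] at h0
          rw [hzdw, dw_eq, map_smul]
          simpa [Nat.factorial_ne_zero] using h0
        | al2 =>
          rw [minExp_al2, show min (lam.2 - mu.2) 0 = 0 by omega, zero_add, pow_one, act_apply,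
            hzdw, f2_dw hk]
          have h0 := w_zero_of_right (lam := lam) (mu := mu) 0 0 (c := mu.2 + 1)
            (by rw [minExp_al2]; omega)
          rw [w_eq_dw] at h0
          rw [h0, smul_zero]
        | th =>
          have h0 := w_zero_of_degree (lam := lam) (mu := mu) (a := 0) (b := mu.1 + 1) (c := mu.2)
            (by rw [minExp_th]; omega)
          rw [minExp_th]
          dsimp only
          rw [show min (lam.1 + mu.2 + (lam.2 - mu.2)) (mu.1 + 0) = mu.1 by omega]
          rw [w_eq_dw, dw_eq] at h0
          rw [hzdw, dw_eq, map_smul]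
          simpa [Nat.factorial_ne_zero] using h0 }
  obtain ⟨φ, hφ⟩ := exists_lift (lam := (lam.1 + mu.2, lam.2 - mu.2)) (mu := (mu.1, 0)) hT
    (by ext <;> simp) (fun _ => le_rfl)
  have hmem : ∀ y, φ y ∈ Submodule.span UCur {z} := by
    intro y
    obtain ⟨u, rfl⟩ := F_exists_smul y
    rw [map_smul, hφ]
    exact Submodule.smul_mem _ _ (Submodule.mem_span_singleton_self _)
  refine ⟨φ.codRestrict _ hmem, hφ, ?_, ?_⟩
  · rintro r _ ⟨u, hu, rfl⟩
    change φ (u • vF _ _) ∈ _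
    rw [map_smul, hφ]
    exact smul_mem_gradeF hu (w_mem_gradeF lam mu (by omega))
  · rintro ⟨y, hy⟩
    obtain ⟨u, rfl⟩ := Submodule.mem_span_singleton.1 hy
    refine ⟨u • vF _ _, Subtype.ext ?_⟩
    change φ (u • vF _ _) = _
    rw [map_smul, hφ]

/-- The modules `F_{ν,0}` and `V(ν)` have the same dimension. -/
theorem finrank_F_zero (ν : Wt) : Module.Finite ℂ (F ν 0) ∧
    Module.finrank ℂ (F ν 0) = Module.finrank ℂ (EvV ν) := by
  have hv : IsTruncated (vF ν 0) (ν + 0) (minExp ν 0) := isTruncated_vF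
  have hmin : ∀ α, minExp ν 0 α = 0 := by
    intro α
    cases α <;> simp [minExp, Wt.eval]
  have h1 : ∀ x s, 1 ≤ s → tpow x s • vF ν 0 = 0 := by
    intro x s hs
    refine tpow_smul_eq_zero (fun α => hv.pos α s) (fun α => ?_) (fun α _ => ?_) x
    · rcases hs.lt_or_eq with hs | rfl
      · exact hv.sq α s hs
      · have := hv.nil α
        rwa [hmin, zero_add, pow_one] at this
    · obtain ⟨s, rfl⟩ := Nat.exists_eq_add_of_le' hs
      exact hv.car' α s
  have h2 : ∀ x s, 1 ≤ s → ∀ m : F ν 0, tpow x s • m = 0 := by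
    intro x s hs m
    obtain ⟨u, rfl⟩ := F_exists_smul m
    exact killed_of_generator h1 u x s hs
  obtain ⟨φ, hφ⟩ := exists_evV_lift h2 (v := vF ν 0) (ν := ν) (by simpa using hv.toIsHighest)
  have hφs : Function.Surjective φ := by
    intro y
    obtain ⟨u, rfl⟩ := F_exists_smul y
    exact ⟨u • EvV.gen ν, by rw [map_smul, hφ]⟩
  have hfin : Module.Finite ℂ (F ν 0) := Module.Finite.of_surjective (φ.restrictScalars ℂ) hφs
  have hT : IsTruncated (EvV.gen ν) ν (minExp ν 0) :=
    { toIsHighest := isHighest_gen ν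
      sq := fun α s hs => evV_killed ν _ s (by omega) _
      nil := fun α => by rw [hmin, zero_add, pow_one, evV_killed ν _ 1 le_rfl] }
  obtain ⟨ψ, hψ⟩ := exists_lift (lam := ν) (mu := 0) hT (by simp) (fun _ => le_rfl)
  have hψs : Function.Surjective ψ := by
    intro y
    obtain ⟨u, -, rfl⟩ := evV_exists_smul ν y
    exact ⟨u • vF ν 0, by rw [map_smul, hψ]⟩
  exact ⟨hfin, le_antisymm
    (LinearMap.finrank_le_finrank_of_surjective (f := φ.restrictScalars ℂ) hφs)
    (LinearMap.finrank_le_finrank_of_surjective (f := ψ.restrictScalars ℂ) hψs)⟩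

theorem finrank_F_zero_le (ν : Wt) : Module.Finite ℂ (F ν 0) ∧
    4 * (Module.finrank ℂ (F ν 0) : ℤ) ≤ weyl ν.1 ν.2 * weyl (0 : Wt).1 (0 : Wt).2 := by
  refine ⟨(finrank_F_zero ν).1, ?_⟩
  rw [(finrank_F_zero ν).2]
  have := finrank_evV_le ν
  zify at this
  simp only [weyl, Prod.fst_zero, Prod.snd_zero, Nat.cast_zero]
  linarith

theorem IsStrip.finite_F {k m n : ℕ} {X Y : ℤ} {R : Submodule UCur (F lam mu)}
    (h : IsStrip lam mu k m n X Y R)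
    (hK : IsKerPlus lam mu (stripFilt (rectSet k m X Y) n R 0)) [Module.Finite ℂ R]
    [Module.Finite ℂ (FPlus lam mu)] : Module.Finite ℂ (F lam mu) ∧
      2 * (Module.finrank ℂ (F lam mu) : ℤ) ≤ 2 * Module.finrank ℂ (FPlus lam mu) +
        2 * Module.finrank ℂ R + rectSum k m X Y := by
  obtain ⟨h1, h2⟩ := h.finite_zero
  obtain ⟨h3, h4⟩ := hK.finite
  have h5 := h.two_mul_sum_le
  exact ⟨h3, by omega⟩

theorem finrank_bot_F : Module.finrank ℂ (⊥ : Submodule UCur (F lam mu)) = 0 :=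
  Module.finrank_zero_of_subsingleton

theorem finite_plus {pr : Wt × Wt} (e : plusPair lam mu = pr) {c : ℤ}
    (h : Module.Finite ℂ (F pr.1 pr.2) ∧ 4 * (Module.finrank ℂ (F pr.1 pr.2) : ℤ) ≤ c) :
    Module.Finite ℂ (FPlus lam mu) ∧ 4 * (Module.finrank ℂ (FPlus lam mu) : ℤ) ≤ c := by
  subst e
  exact h

/-- The upper bound for pairs of first kind, by induction on `|μ|`: it holds for `F⁺_{λ,μ}` and for the
source of the map onto the submodule generated by `w(0, 0, μ₂)`, and the rest of the kernel is a
strip. -/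
theorem finrank_F_le_of_first (n : ℕ) : ∀ lam mu : Wt, mu.size = n → IsFirstKind lam mu →
    Module.Finite ℂ (F lam mu) ∧
      4 * (Module.finrank ℂ (F lam mu) : ℤ) ≤ weyl lam.1 lam.2 * weyl mu.1 mu.2 := by
  induction n using Nat.strong_induction_on with
  | _ n ih =>
    rintro ⟨l1, l2⟩ ⟨m1, m2⟩ hn h
    have h' := h
    obtain ⟨h3, h4, h5⟩ := h'
    simp only [Wt.size] at h3 hn h4 h5
    rcases m2 with _ | m2
    · rcases m1 with _ | m1
      · rw [show ((0, 0) : Wt) = 0 from rfl]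
        exact finrank_F_zero_le (l1, l2)
      · have hs := isStrip_left h rfl
        have hK := isKerPlus_left h rfl (Nat.succ_pos m1)
        have i0 := ih m1 (by omega) (l1 + 1, l2) (m1, 0) rfl
          ⟨by simp only [Wt.size]; omega, by dsimp only; omega, by dsimp only; omega⟩
        have e0 : plusPair (l1, l2) (m1 + 1, 0) = ((l1 + 1, l2), (m1, 0)) := plusPair_left rfl
        obtain ⟨i1, i2⟩ := finite_plus e0 i0
        obtain ⟨j1, j2⟩ := hs.finite_F hK
        refine ⟨j1, ?_⟩
        have e := weyl_identity_left l1 l2 m1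
        rw [finrank_bot_F] at j2
        rw [show (l2 : ℤ) - ((m1 + 1 : ℕ) : ℤ) + 1 = l2 - m1 by push_cast; ring] at j2
        push_cast at i2 j2 e ⊢
        linarith
    · rcases m1 with _ | m1
      · have hs := isStrip_right h rfl
        have hK := isKerPlus_right h rfl (Nat.succ_pos m2)
        have i0 := ih m2 (by omega) (l1, l2 + 1) (0, m2) (by simp [Wt.size])
          ⟨by simp only [Wt.size]; omega, by dsimp only; omega, by dsimp only; omega⟩
        have e0 : plusPair (l1, l2) (0, m2 + 1) = ((l1, l2 + 1), (0, m2)) :=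
          plusPair_right h (Nat.succ_pos m2)
        obtain ⟨i1, i2⟩ := finite_plus e0 i0
        obtain ⟨j1, j2⟩ := hs.finite_F hK
        refine ⟨j1, ?_⟩
        have e := weyl_identity_right l1 l2 m2
        rw [finrank_bot_F] at j2
        push_cast at i2 j2 e ⊢
        linarith
      · have hs := isStrip_first h
        have hK := isKerPlus_first h (Nat.succ_pos m2)
        obtain ⟨φ, -, -, hφ⟩ := exists_map_right h
        have i0 := ih (m1 + 1 + m2) (by omega) (l1, l2 + 1) (m1 + 1, m2) rfl
          ⟨by simp only [Wt.size]; omega, by dsimp only; omega, by dsimp only; omega⟩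
        have e0 : plusPair (l1, l2) (m1 + 1, m2 + 1) = ((l1, l2 + 1), (m1 + 1, m2)) :=
          plusPair_right h (Nat.succ_pos m2)
        obtain ⟨i1, i2⟩ := finite_plus e0 i0
        obtain ⟨q1, q2⟩ := ih (m1 + 1) (by omega) (l1 + (m2 + 1), l2 - (m2 + 1)) (m1 + 1, 0) rfl
            ⟨by simp only [Wt.size]; omega, by dsimp only; omega, by dsimp only; omega⟩
        have r1 := Module.Finite.of_surjective (φ.restrictScalars ℂ) hφ
        have r2 := LinearMap.finrank_le_finrank_of_surjective (f := φ.restrictScalars ℂ) hφ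
        obtain ⟨j1, j2⟩ := hs.finite_F hK
        refine ⟨j1, ?_⟩
        have e := weyl_identity_first l1 l2 (m1 + 1) m2
        zify at r2
        push_cast [Nat.cast_sub h5] at i2 j2 e q2 r2 ⊢
        linarith

/-- The parameters of the strip with number `l` of a pair of second kind. -/
abbrev secondSet (lam mu : Wt) (l : ℕ) : Finset (ℕ × ℕ) :=
  rectSet (mu.1 + 1) (lam.2 + 1) (lam.1 - l + 1) (mu.2 - mu.1 - l + 1)

/-- The sum of the dimensions of the sources for the strip with number `l`. -/
def secondSum (lam mu : Wt) (l : ℕ) : ℕ := ∑ p ∈ secondSet lam mu l,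
  Module.finrank ℂ (EvV (stripWt (lam.2 + 1) (lam.1 - l + 1) (mu.2 - mu.1 - l + 1) p))

theorem filtInv_zero_eq (l : ℕ) :
    filtInv lam mu l 0 = Submodule.span UCur {w lam mu 0 (mu.1 + lam.2 + l) 0} := by
  rw [filtInv, if_pos rfl]

theorem finite_second_step (h : IsSecondKind lam mu) {l : ℕ} (hl : 1 ≤ l)
    (hl' : l ≤ mu.2 - lam.2) [Module.Finite ℂ (filtInv lam mu (l + 1) 0)] :
    Module.Finite ℂ (filtInv lam mu l 0) ∧ Module.finrank ℂ (filtInv lam mu l 0) ≤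
      secondSum lam mu l + Module.finrank ℂ (filtInv lam mu (l + 1) 0) := by
  have hs := isStrip_second h hl hl'
  rw [filtInv_eq h hl hl', filtInv_zero_eq]
  have : Module.Finite ℂ (Submodule.span UCur {w lam mu 0 (mu.1 + lam.2 + l + 1) 0}) := by
    rw [show mu.1 + lam.2 + l + 1 = mu.1 + lam.2 + (l + 1) from rfl, ← filtInv_zero_eq]
    infer_instance
  exact hs.finite_zero

/-- The terms `V_{ℓ,0}` are bounded by descending induction on `ℓ`, one strip at a time. -/
theorem finite_second (h : IsSecondKind lam mu) {i : ℕ} (hi : i ≤ mu.2 - lam.2) :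
    Module.Finite ℂ (filtInv lam mu (i + 1) 0) ∧ Module.finrank ℂ (filtInv lam mu (i + 1) 0) ≤
      ∑ l ∈ Finset.Ico i (mu.2 - lam.2), secondSum lam mu (l + 1) := by
  induction hi using Nat.decreasingInduction with
  | self =>
    have e := span_theta_eq h (le_refl (mu.2 - lam.2))
    rw [if_neg (lt_irrefl _)] at e
    rw [filtInv_zero_eq, ← add_assoc, e]
    exact ⟨inferInstance, by rw [finrank_bot_F]; exact Nat.zero_le _⟩
  | of_succ i hi ih =>
    obtain ⟨h1, h2⟩ := ih
    obtain ⟨h3, h4⟩ := finite_second_step h (l := i + 1) (by omega) (by omega)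
    refine ⟨h3, ?_⟩
    rw [Finset.sum_eq_sum_Ico_succ_bot hi]
    omega

theorem two_mul_secondSum_le (h : IsSecondKind lam mu) {l : ℕ} (hl : 1 ≤ l)
    (hl' : l ≤ mu.2 - lam.2) : 2 * (secondSum lam mu l : ℤ) ≤
      rectSum (mu.1 + 1) (lam.2 + 1) (lam.1 - l + 1) (mu.2 - mu.1 - l + 1) :=
  (isStrip_second h hl hl').two_mul_sum_le

/-- The upper bound for pairs of second kind. -/
theorem finite_F_second (h : IsSecondKind lam mu) : Module.Finite ℂ (F lam mu) ∧
    Module.Finite ℂ (FPlus lam mu) ∧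
    4 * (Module.finrank ℂ (FPlus lam mu) : ℤ) ≤ weyl lam.1 mu.2 * weyl mu.1 lam.2 ∧
    2 * (Module.finrank ℂ (F lam mu) : ℤ) ≤ 2 * Module.finrank ℂ (FPlus lam mu) +
      ∑ l ∈ Finset.range (mu.2 - lam.2),
        rectSum (mu.1 + 1) (lam.2 + 1) (lam.1 - l) (mu.2 - mu.1 - l) := by
  have h' := h
  obtain ⟨h3, h4, h5⟩ := h'
  simp only [Wt.size] at h3
  obtain ⟨i1, i2⟩ := finite_plus (plusPair_second h)
    (finrank_F_le_of_first _ (lam.1, mu.2) (mu.1, lam.2) rfl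
      ⟨by simp only [Wt.size]; omega, by dsimp only; omega, by dsimp only; omega⟩)
  obtain ⟨k1, k2⟩ := finite_second h (Nat.zero_le _)
  have hK := isKerPlus_second h
  rw [← filtInv_zero_eq] at hK
  obtain ⟨j1, j2⟩ := hK.finite
  refine ⟨j1, i1, i2, ?_⟩
  have h6 : 2 * ((∑ l ∈ Finset.Ico 0 (mu.2 - lam.2), secondSum lam mu (l + 1) : ℕ) : ℤ) ≤
      ∑ l ∈ Finset.range (mu.2 - lam.2),
        rectSum (mu.1 + 1) (lam.2 + 1) (lam.1 - l) (mu.2 - mu.1 - l) := by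
    rw [Nat.cast_sum, Finset.mul_sum, Nat.Ico_zero_eq_range]
    refine Finset.sum_le_sum fun l hl => ?_
    rw [Finset.mem_range] at hl
    have := two_mul_secondSum_le h (l := l + 1) (by omega) (by omega)
    rw [show (lam.1 : ℤ) - ((l + 1 : ℕ) : ℤ) + 1 = lam.1 - l by push_cast; ring,
      show (mu.2 : ℤ) - mu.1 - ((l + 1 : ℕ) : ℤ) + 1 = mu.2 - mu.1 - l by push_cast; ring] at this
    exact this
  rw [zero_add] at k2
  omega

/-- The identity that makes the bound of `finite_F_second` the product of the Weyl dimensions. -/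
theorem weyl_second (h : IsSecondKind lam mu) :
    weyl lam.1 lam.2 * weyl mu.1 mu.2 = weyl lam.1 mu.2 * weyl mu.1 lam.2 +
      2 * ∑ l ∈ Finset.range (mu.2 - lam.2),
        rectSum (mu.1 + 1) (lam.2 + 1) (lam.1 - l) (mu.2 - mu.1 - l) := by
  have := weyl_identity_second lam.1 lam.2 mu.1 (mu.2 - lam.2)
  have e : ((lam.2 : ℤ) + (mu.2 - lam.2 : ℕ)) = mu.2 := by have := h.2.2; omega
  rwa [e] at this

theorem finrank_F_le_of_second (h : IsSecondKind lam mu) : Module.Finite ℂ (F lam mu) ∧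
    4 * (Module.finrank ℂ (F lam mu) : ℤ) ≤ weyl lam.1 lam.2 * weyl mu.1 mu.2 := by
  obtain ⟨h1, -, h2, h3⟩ := finite_F_second h
  refine ⟨h1, ?_⟩
  rw [weyl_second h]
  omega

end

noncomputable section

/-! ### The diagram automorphism -/

open scoped Matrix

/-- The antidiagonal matrix with entries `1, -1, 1`. -/
def swapMatrix : Matrix (Fin 3) (Fin 3) ℂ := !![0, 0, 1; 0, -1, 0; 1, 0, 0]

theorem swapMatrix_sq : swapMatrix * swapMatrix = 1 := by
  ext i j
  fin_cases i <;> fin_cases j <;> simp [swapMatrix, Matrix.mul_apply, Fin.sum_univ_three]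

/-- The diagram automorphism `A ↦ -J Aᵀ J` of `sl₃`, which exchanges the simple roots. -/
def sl3Swap : Sl3 →ₗ⁅ℂ⁆ Sl3 where
  toFun A := ⟨-(swapMatrix * A.1ᵀ * swapMatrix), by
    have h : Matrix.trace A.1 = 0 := A.2
    change Matrix.trace (-(swapMatrix * A.1ᵀ * swapMatrix)) = 0
    rw [Matrix.trace_neg, Matrix.trace_mul_comm (swapMatrix * A.1ᵀ) swapMatrix, ← mul_assoc,
        swapMatrix_sq, one_mul,
      Matrix.trace_transpose, h, neg_zero]⟩
  map_add' A B := by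
    apply Subtype.ext
    change -(swapMatrix * (A.1 + B.1)ᵀ * swapMatrix) = -_ + -_
    rw [Matrix.transpose_add, mul_add, add_mul, neg_add]
  map_smul' c A := by
    apply Subtype.ext
    change -(swapMatrix * (c • A.1)ᵀ * swapMatrix) = c • -_
    rw [Matrix.transpose_smul, Matrix.mul_smul, Matrix.smul_mul, smul_neg]
  map_lie' := by
    intro A B
    apply Subtype.ext
    change -(swapMatrix * (A.1 * B.1 - B.1 * A.1)ᵀ * swapMatrix) =
      -(swapMatrix * A.1ᵀ * swapMatrix) *
        -(swapMatrix * B.1ᵀ * swapMatrix) -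
      -(swapMatrix * B.1ᵀ * swapMatrix) *
        -(swapMatrix * A.1ᵀ * swapMatrix)
    have key : ∀ C D : Matrix (Fin 3) (Fin 3) ℂ, swapMatrix * C * swapMatrix *
        (swapMatrix * D * swapMatrix) = swapMatrix * (C * D) * swapMatrix := by
      intro C D
      calc _ = swapMatrix * C * (swapMatrix * swapMatrix) * D * swapMatrix := by
            simp only [mul_assoc]
        _ = _ := by rw [swapMatrix_sq, mul_one]; simp only [mul_assoc]
    rw [neg_mul_neg, neg_mul_neg, key, key, Matrix.transpose_sub, Matrix.transpose_mul,
      Matrix.transpose_mul, mul_sub, sub_mul, neg_sub]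

theorem sl3Swap_val (A : Sl3) : (sl3Swap A : Matrix (Fin 3) (Fin 3) ℂ) =
    -(swapMatrix * A.1ᵀ * swapMatrix) := rfl

/-- The exchange of the simple roots. -/
def rootSwap : PosRoot → PosRoot
  | .al1 => .al2
  | .al2 => .al1
  | .th => .th

/-- The sign with which the diagram automorphism acts on the root vectors. -/
def rootSign : PosRoot → ℂ
  | .al1 => 1
  | .al2 => 1
  | .th => -1

theorem sl3Swap_apply (A : Sl3) (i j : Fin 3) : (sl3Swap A : Matrix (Fin 3) (Fin 3) ℂ) i j =
    -∑ k, (∑ l, swapMatrix i l * A.1 k l) * swapMatrix k j := by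
  rw [sl3Swap_val, Matrix.neg_apply, Matrix.mul_apply]
  rfl

theorem sl3Swap_xp (α : PosRoot) : sl3Swap (xp α) = rootSign α • xp (rootSwap α) := by
  apply Subtype.ext
  ext i j
  rw [sl3Swap_apply]
  simp only [Fin.sum_univ_three]
  cases α <;> fin_cases i <;> fin_cases j <;>
    simp [rootSign, rootSwap, swapMatrix, xp_al1_val, xp_al2_val, xp_th_val]

theorem sl3Swap_xm (α : PosRoot) : sl3Swap (xm α) = rootSign α • xm (rootSwap α) := by
  apply Subtype.ext
  ext i j
  rw [sl3Swap_apply]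
  simp only [Fin.sum_univ_three]
  cases α <;> fin_cases i <;> fin_cases j <;>
    simp [rootSign, rootSwap, swapMatrix, xm_al1_val, xm_al2_val, xm_th_val]

theorem rootSign_sq (α : PosRoot) : rootSign α * rootSign α = 1 := by
  cases α <;> simp [rootSign]

theorem sl3Swap_hh (α : PosRoot) : sl3Swap (hh α) = hh (rootSwap α) := by
  rw [hh, LieHom.map_lie, sl3Swap_xp, sl3Swap_xm, smul_lie, lie_smul, smul_smul, rootSign_sq,
    one_smul, hh]

section

attribute [local instance 100] LieRing.ofAssociativeRing

/-- The diagram automorphism of the current algebra. -/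
def curSwap : Cur →ₗ⁅ℂ⁆ Cur :=
  { LinearMap.lTensor ℂ[X] (sl3Swap : Sl3 →ₗ[ℂ] Sl3) with
    map_lie' := by
      intro x y
      change LinearMap.lTensor ℂ[X] (sl3Swap : Sl3 →ₗ[ℂ] Sl3) _ =
        @Bracket.bracket Cur Cur LieRing.toBracket
          (LinearMap.lTensor ℂ[X] (sl3Swap : Sl3 →ₗ[ℂ] Sl3) x)
          (LinearMap.lTensor ℂ[X] (sl3Swap : Sl3 →ₗ[ℂ] Sl3) y)
      induction x using TensorProduct.induction_on with
      | zero =>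
        refine (congrArg _ (zero_lie (L := Cur) (M := Cur) y)).trans ?_
        rw [map_zero]
        exact (zero_lie (L := Cur) (M := Cur) _).symm
      | add a b ha hb =>
        refine (congrArg _ (add_lie (L := Cur) (M := Cur) a b y)).trans ?_
        rw [map_add, ha, hb, map_add]
        exact (add_lie (L := Cur) (M := Cur) _ _ _).symm
      | tmul f a =>
        induction y using TensorProduct.induction_on with
        | zero =>
          refine (congrArg _ (lie_zero (L := Cur) (M := Cur) (f ⊗ₜ[ℂ] a))).trans ?_
          rw [map_zero]
          exact (lie_zero (L := Cur) (M := Cur) _).symm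
        | add c d hc hd =>
          refine (congrArg _ (lie_add (L := Cur) (M := Cur) (f ⊗ₜ[ℂ] a) c d)).trans ?_
          rw [map_add, hc, hd, map_add]
          exact (lie_add (L := Cur) (M := Cur) _ _ _).symm
        | tmul g b =>
          rw [LinearMap.lTensor_tmul, LinearMap.lTensor_tmul]
          erw [LieAlgebra.ExtendScalars.bracket_tmul, LieAlgebra.ExtendScalars.bracket_tmul]
          rw [LinearMap.lTensor_tmul]
          exact congrArg _ (LieHom.map_lie sl3Swap a b) }

/-- The diagram automorphism of the enveloping algebra of the current algebra. -/
def swapU : UCur →ₐ[ℂ] UCur :=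
  UniversalEnvelopingAlgebra.lift ℂ ((UniversalEnvelopingAlgebra.ι ℂ).comp curSwap)

theorem swapU_tpow (x : Sl3) (s : ℕ) : swapU (tpow x s) = tpow (sl3Swap x) s := by
  rw [swapU, tpow, UniversalEnvelopingAlgebra.lift_ι_apply]
  rfl

end

theorem swapU_divPow (y : UCur) (s : ℕ) : swapU (divPow y s) = divPow (swapU y) s := by
  rw [divPow, divPow, map_smul, map_pow]

theorem divPow_smul (c : ℂ) (y : UCur) (s : ℕ) : divPow (c • y) s = c ^ s • divPow y s := by
  rw [divPow, divPow, smul_pow, smul_comm]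

theorem eval_swap (ν : Wt) (α : PosRoot) : Wt.eval (ν.2, ν.1) α = ν.eval (rootSwap α) := by
  cases α
  · rfl
  · rfl
  · exact add_comm _ _

theorem rootSwap_ne_th {α : PosRoot} (h : α ≠ .th) : rootSwap α ≠ .th := by
  cases α <;> simp_all [rootSwap]

variable {lam mu : Wt}

/-- The diagram automorphism sends the relations for the exchanged weights to those for `λ`, `μ`, up to
the signs of the root vectors. -/
theorem swapU_relations {u : UCur}
    (hu : u ∈ cvRelations ((lam.2, lam.1) + (mu.2, mu.1))
      (pairPartition (lam.2, lam.1) (mu.2, mu.1))) : swapU u • vF lam mu = 0 := by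
  have hev : ∀ α, Wt.eval ((lam.2, lam.1) + (mu.2, mu.1)) α = (lam + mu).eval (rootSwap α) :=
    fun α => eval_swap (lam + mu) α
  have hv : IsHighest (vF lam mu) (lam + mu) := isHighest_vF
  rcases hu with ((⟨α, s, rfl⟩ | ⟨α, s, hα, rfl⟩) | ⟨α, hα, rfl⟩) |
    ⟨α, r, s, k, hr, hs, hk, hle, rfl⟩
  · rw [swapU_tpow, sl3Swap_xp, tpow_smul, smul_assoc, hv.pos, smul_zero]
  · rw [map_sub, swapU_tpow, sl3Swap_hh, AlgHom.commutes, hev]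
    exact smul_vF_of_mem (Or.inl (Or.inl (Or.inr ⟨rootSwap α, s, rootSwap_ne_th hα, rfl⟩)))
  · rw [map_pow, swapU_tpow, sl3Swap_xm, tpow_smul, smul_pow, smul_assoc, hev,
      hv.int _ (rootSwap_ne_th hα), smul_zero]
  · rw [map_mul, swapU_divPow, swapU_divPow, swapU_tpow, swapU_tpow, sl3Swap_xp, sl3Swap_xm,
      tpow_smul, tpow_smul, divPow_smul, divPow_smul, smul_mul_smul_comm, smul_assoc]
    have hp : pairPartition (lam.2, lam.1) (mu.2, mu.1) α =
        pairPartition lam mu (rootSwap α) := by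
      rw [pairPartition, pairPartition, eval_swap, eval_swap]
    rw [hp] at hle
    rw [smul_vF_of_mem (Or.inr ⟨rootSwap α, r, s, k, hr, hs, hk, hle, rfl⟩), smul_zero]

/-- The diagram automorphism turns `F_{λ,μ}` into the module for the exchanged weights. -/
theorem finrank_le_swap [Module.Finite ℂ (F (lam.2, lam.1) (mu.2, mu.1))] :
    Module.Finite ℂ (F lam mu) ∧
      Module.finrank ℂ (F lam mu) ≤ Module.finrank ℂ (F (lam.2, lam.1) (mu.2, mu.1)) := by
  let ψ : UCur →ₗ[ℂ] F lam mu :=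
    { toFun := fun u => swapU u • vF lam mu
      map_add' := fun u u' => by rw [map_add, add_smul]
      map_smul' := fun c u => by rw [map_smul, smul_assoc]; rfl }
  set P := Submodule.span UCur (cvRelations ((lam.2, lam.1) + (mu.2, mu.1))
    (pairPartition (lam.2, lam.1) (mu.2, mu.1))) with hP
  have hψ : P.restrictScalars ℂ ≤ LinearMap.ker ψ := by
    intro u hu
    replace hu : u ∈ P := hu
    change swapU u • vF lam mu = 0
    induction hu using Submodule.span_induction with
    | mem u h => exact swapU_relations h
    | zero => rw [map_zero, zero_smul]
    | add a b _ _ ha hb => rw [map_add, add_smul, ha, hb, add_zero]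
    | smul u' a _ ha => rw [smul_eq_mul, map_mul, mul_smul, ha, smul_zero]
  let φ : F (lam.2, lam.1) (mu.2, mu.1) →ₗ[ℂ] F lam mu :=
    ((P.restrictScalars ℂ).liftQ ψ hψ) ∘ₗ
      (Submodule.Quotient.restrictScalarsEquiv ℂ P).symm.toLinearMap
  have hφ : ∀ u : UCur, φ (Submodule.Quotient.mk u) = swapU u • vF lam mu := fun u => rfl
  -- the diagram automorphism is an involution on the generators
  have hsurj : ∀ u : UCur, ∃ u', swapU u' = u := by
    intro u
    have hu : u ∈ Algebra.adjoin ℂ {u : UCur | ∃ x s, u = tpow x s} := by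
      rw [adjoin_tpow]; trivial
    have : Algebra.adjoin ℂ {u : UCur | ∃ x s, u = tpow x s} ≤ swapU.range := by
      rw [Algebra.adjoin_le_iff]
      rintro _ ⟨x, s, rfl⟩
      refine ⟨tpow (sl3Swap x) s, ?_⟩
      change swapU _ = _
      rw [swapU_tpow]
      congr 1
      apply Subtype.ext
      rw [sl3Swap_val, sl3Swap_val]
      have hT : swapMatrixᵀ = swapMatrix := by
        ext i j
        fin_cases i <;> fin_cases j <;> simp [swapMatrix]
      rw [Matrix.transpose_neg, Matrix.transpose_mul, Matrix.transpose_mul, hT,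
        Matrix.transpose_transpose]
      calc _ = (swapMatrix * swapMatrix) * x.1 *
            (swapMatrix * swapMatrix) := by noncomm_ring
        _ = _ := by rw [swapMatrix_sq, one_mul, mul_one]
    exact this hu
  have hφs : Function.Surjective φ := by
    intro y
    obtain ⟨u, rfl⟩ := F_exists_smul y
    obtain ⟨u', rfl⟩ := hsurj u
    exact ⟨Submodule.Quotient.mk u', hφ u'⟩
  exact ⟨Module.Finite.of_surjective φ hφs, LinearMap.finrank_le_finrank_of_surjective hφs⟩

/-- Exchanging `λ` and `μ` does not change the relations of `F_{λ,μ}`. -/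
theorem finrank_le_comm [Module.Finite ℂ (F mu lam)] : Module.Finite ℂ (F lam mu) ∧
    Module.finrank ℂ (F lam mu) ≤ Module.finrank ℂ (F mu lam) := by
  obtain ⟨φ, -, hφ, -⟩ := exists_quotient_map (lam := mu) (mu := lam) (lam' := lam) (mu' := mu)
    (add_comm _ _) (fun α => by rw [minExp, minExp, min_comm])
  exact ⟨Module.Finite.of_surjective (φ.restrictScalars ℂ) hφ,
    LinearMap.finrank_le_finrank_of_surjective (f := φ.restrictScalars ℂ) hφ⟩

end

noncomputable section

/-! ### Representations of `sl₃` on vector spaces -/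

section

attribute [local instance 100] LieRing.ofAssociativeRing

variable {W : Type} [AddCommGroup W] [Module ℂ W]

/-- A cyclic highest weight representation on `W` bounds the dimension of `V(ν)` from below. -/
theorem finrank_le_evV_of_rep (ρ : Sl3 →ₗ⁅ℂ⁆ Module.End ℂ W) {ν : Wt} {v : W}
    (hp : ∀ α, ρ (xp α) v = 0) (hh' : ∀ α, α ≠ .th → ρ (hh α) v = (ν.eval α : ℂ) • v)
    (hm : ∀ α, α ≠ .th → (ρ (xm α) ^ (ν.eval α + 1)) v = 0)
    (hW : ∀ N : Submodule ℂ W, v ∈ N → (∀ x, ∀ m ∈ N, ρ x m ∈ N) → N = ⊤) :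
    Module.finrank ℂ W ≤ Module.finrank ℂ (EvV ν) := by
  let r : USl3 →ₐ[ℂ] Module.End ℂ W := UniversalEnvelopingAlgebra.lift ℂ ρ
  have hr : ∀ x, r (inU x) = ρ x := fun x => UniversalEnvelopingAlgebra.lift_ι_apply ℂ ρ x
  let ψ : USl3 →ₗ[ℂ] W :=
    { toFun := fun u => r u v
      map_add' := fun u u' => by rw [map_add, LinearMap.add_apply]
      map_smul' := fun c u => by rw [map_smul, LinearMap.smul_apply]; rfl }
  set P := Submodule.span USl3 (irrRelations ν) with hP
  have hψ : P.restrictScalars ℂ ≤ LinearMap.ker ψ := by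
    intro u hu
    replace hu : u ∈ P := hu
    change r u v = 0
    induction hu using Submodule.span_induction with
    | mem u h =>
      rcases h with (⟨α, rfl⟩ | ⟨α, hα, rfl⟩) | ⟨α, hα, rfl⟩
      · rw [hr, hp]
      · rw [map_sub, hr, AlgHom.commutes, LinearMap.sub_apply, hh' α hα,
          Module.algebraMap_end_apply, sub_self]
      · rw [map_pow, hr, hm α hα]
    | zero => rw [map_zero, LinearMap.zero_apply]
    | add a b _ _ ha hb => rw [map_add, LinearMap.add_apply, ha, hb, add_zero]
    | smul u' a _ ha => rw [smul_eq_mul, map_mul, Module.End.mul_apply, ha, map_zero]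
  let φ : V ν →ₗ[ℂ] W :=
    ((P.restrictScalars ℂ).liftQ ψ hψ) ∘ₗ
      (Submodule.Quotient.restrictScalarsEquiv ℂ P).symm.toLinearMap
  have hφ : ∀ u : USl3, φ (Submodule.Quotient.mk u) = r u v := fun u => rfl
  have hψs : LinearMap.range ψ = ⊤ := by
    refine hW _ ⟨1, by change r 1 v = v; rw [map_one, Module.End.one_apply]⟩ ?_
    rintro x _ ⟨u, rfl⟩
    refine ⟨inU x * u, ?_⟩
    change r (inU x * u) v = ρ x (r u v)
    rw [map_mul, hr, Module.End.mul_apply]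
  have hφs : Function.Surjective φ := by
    intro y
    obtain ⟨u, hu⟩ := LinearMap.range_eq_top.1 hψs y
    exact ⟨Submodule.Quotient.mk u, (hφ u).trans hu⟩
  have : Module.Finite ℂ (V ν) := Module.Finite.equiv (evVEquiv ν)
  rw [finrank_evV]
  exact LinearMap.finrank_le_finrank_of_surjective hφs

theorem one_le_finrank_evV_zero : 1 ≤ Module.finrank ℂ (EvV (0, 0)) := by
  have := finrank_le_evV_of_rep (0 : Sl3 →ₗ⁅ℂ⁆ Module.End ℂ ℂ) (ν := (0, 0)) (v := 1)
    (fun α => rfl) (fun α hα => by cases α <;> simp [Wt.eval])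
    (fun α hα => by cases α <;> simp [Wt.eval]) (fun N hN _ => by
      rw [Submodule.eq_top_iff']
      intro z
      simpa using N.smul_mem z hN)
  simpa using this

/-- The natural representation of `sl₃`. -/
def naturalRep : Sl3 →ₗ⁅ℂ⁆ Module.End ℂ (Fin 3 → ℂ) :=
  (lieEquivMatrix' (R := ℂ) (n := Fin 3)).symm.toLieHom.comp
    (LieAlgebra.SpecialLinear.sl (Fin 3) ℂ).incl

theorem naturalRep_apply (x : Sl3) (v : Fin 3 → ℂ) : naturalRep x v =
    (x : Matrix (Fin 3) (Fin 3) ℂ).mulVec v := rfl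

theorem three_le_finrank_evV : 3 ≤ Module.finrank ℂ (EvV (1, 0)) := by
  have hf1 : naturalRep (xm .al1) ![1, 0, 0] = ![0, 1, 0] := by
    rw [naturalRep_apply, xm_al1_val]
    ext i; fin_cases i <;> simp [Matrix.mulVec, dotProduct, Fin.sum_univ_three]
  have hf2 : naturalRep (xm .al2) ![0, 1, 0] = ![0, 0, 1] := by
    rw [naturalRep_apply, xm_al2_val]
    ext i; fin_cases i <;> simp [Matrix.mulVec, dotProduct, Fin.sum_univ_three]
  have := finrank_le_evV_of_rep naturalRep (ν := (1, 0)) (v := ![1, 0, 0]) ?_ ?_ ?_ ?_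
  · simpa using this
  · intro α
    rw [naturalRep_apply]
    ext i
    cases α <;> fin_cases i <;>
      simp [Matrix.mulVec, dotProduct, Fin.sum_univ_three, xp_al1_val, xp_al2_val, xp_th_val]
  · intro α hα
    rw [naturalRep_apply]
    ext i
    cases α <;> fin_cases i <;>
      simp [Matrix.mulVec, dotProduct, Fin.sum_univ_three, hh_al1_val, hh_al2_val, Wt.eval] at hα ⊢
  · intro α hα
    cases α with
    | al1 =>
      change naturalRep (xm .al1) (naturalRep (xm .al1) ![1, 0, 0]) = 0
      rw [hf1, naturalRep_apply, xm_al1_val]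
      ext i; fin_cases i <;> simp [Matrix.mulVec, dotProduct, Fin.sum_univ_three]
    | al2 =>
      change naturalRep (xm .al2) ![1, 0, 0] = 0
      rw [naturalRep_apply, xm_al2_val]
      ext i; fin_cases i <;> simp [Matrix.mulVec, dotProduct, Fin.sum_univ_three]
    | th => exact absurd rfl hα
  · intro N h0 hN
    have h1 := hN (xm .al1) _ h0
    rw [hf1] at h1
    have h2 := hN (xm .al2) _ h1
    rw [hf2] at h2
    rw [Submodule.eq_top_iff']
    intro z
    have : z = z 0 • ![1, 0, 0] + z 1 • ![0, 1, 0] + z 2 • ![0, 0, 1] := by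
      ext i; fin_cases i <;> simp
    rw [this]
    exact N.add_mem (N.add_mem (N.smul_mem _ h0) (N.smul_mem _ h1)) (N.smul_mem _ h2)

end

end

noncomputable section

/-! ### Weyl's dimension formula -/

variable {lam mu : Wt}

theorem finrank_plus_zero {ν : Wt} (e : plusPair lam mu = (ν, 0)) :
    Module.Finite ℂ (FPlus lam mu) ∧
      Module.finrank ℂ (FPlus lam mu) = Module.finrank ℂ (EvV ν) := by
  have : ∀ pr : Wt × Wt, pr = (ν, 0) → Module.Finite ℂ (F pr.1 pr.2) ∧
      Module.finrank ℂ (F pr.1 pr.2) = Module.finrank ℂ (EvV ν) := by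
    rintro _ rfl
    exact finrank_F_zero ν
  exact this _ e

theorem evV_le_weyl (ν : Wt) : 2 * (Module.finrank ℂ (EvV ν) : ℤ) ≤ weyl ν.1 ν.2 := by
  have := finrank_evV_le ν
  rw [weyl]
  exact_mod_cast this

/-- `V(ω₂)` and `V(ω₁)` are exchanged by the diagram automorphism. -/
theorem three_le_finrank_evV_right : 3 ≤ Module.finrank ℂ (EvV (0, 1)) := by
  have h1 := finrank_F_zero (1, 0)
  have h2 := finrank_F_zero (0, 1)
  have h3 := three_le_finrank_evV
  have h4 : Module.Finite ℂ (F (((1, 0) : Wt).2, ((1, 0) : Wt).1) ((0 : Wt).2, (0 : Wt).1)) :=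
    h2.1
  have h5 := (finrank_le_swap (lam := (1, 0)) (mu := 0)).2
  rw [← h2.2]
  rw [← h1.2] at h3
  exact h3.trans h5

/-- If `F_{λ,ω}` is an extension of `V(λ + ω)` by modules `V(ν)` with
`dim V(λ) dim V(ω) = dim V(λ + ω) + ∑ dim V(ν)` for the Weyl dimensions, then Weyl's formula
for `λ` and `ω` gives the lower bound for `λ + ω`. -/
theorem weyl_le_of_step {ν : Wt} (e : plusPair lam mu = (ν, 0)) [Module.Finite ℂ (F lam mu)]
    {S : ℤ} (hF : 2 * (Module.finrank ℂ (F lam mu) : ℤ) ≤ 2 * Module.finrank ℂ (FPlus lam mu) + S)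
    (h1 : weyl lam.1 lam.2 ≤ 2 * Module.finrank ℂ (EvV lam))
    (h2 : weyl mu.1 mu.2 ≤ 2 * Module.finrank ℂ (EvV mu))
    (hW : weyl lam.1 lam.2 * weyl mu.1 mu.2 = weyl ν.1 ν.2 * 2 + 2 * S) :
    weyl ν.1 ν.2 ≤ 2 * Module.finrank ℂ (EvV ν) := by
  have h3 := finrank_mul_le (lam := lam) (mu := mu)
  have h4 : weyl lam.1 lam.2 = 2 * Module.finrank ℂ (EvV lam) := le_antisymm h1 (evV_le_weyl lam)
  have h5 : weyl mu.1 mu.2 = 2 * Module.finrank ℂ (EvV mu) := le_antisymm h2 (evV_le_weyl mu)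
  rw [(finrank_plus_zero e).2] at hF
  rw [h4, h5] at hW
  zify at h3
  linarith

/-- The lower bound in Weyl's dimension formula, by adding one fundamental weight at a time. -/
theorem weyl_le_evV (a b : ℕ) : weyl a b ≤ 2 * Module.finrank ℂ (EvV (a, b)) := by
  have h10 : weyl (1 : ℕ) (0 : ℕ) ≤ 2 * Module.finrank ℂ (EvV (1, 0)) := by
    have := three_le_finrank_evV
    simp only [weyl]; push_cast; omega
  have h01 : weyl (0 : ℕ) (1 : ℕ) ≤ 2 * Module.finrank ℂ (EvV (0, 1)) := by
    have := three_le_finrank_evV_right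
    simp only [weyl]; push_cast; omega
  -- the first coordinate grows by `ω₁` while the second one is zero
  have hleft : ∀ a : ℕ, weyl a (0 : ℕ) ≤ 2 * Module.finrank ℂ (EvV (a, 0)) := by
    intro a
    induction a with
    | zero =>
      have := one_le_finrank_evV_zero
      simp only [weyl]; push_cast; omega
    | succ a ih =>
      rcases a with _ | a
      · exact h10
      · have hk : IsFirstKind (a + 1, 0) (1, 0) :=
          ⟨by simp [Wt.size], by simp, by simp⟩
        have e : plusPair (a + 1, 0) (1, 0) = ((a + 1 + 1, 0), 0) := plusPair_left rfl
        have := (finrank_plus_zero e).1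
        obtain ⟨h1, h2⟩ := (isStrip_left hk rfl).finite_F
          (isKerPlus_left hk rfl Nat.one_pos)
        rw [finrank_bot_F, Nat.cast_zero, mul_zero, add_zero] at h2
        refine weyl_le_of_step e h2 ih h10 ?_
        have := weyl_identity_left (a + 1) 0 0
        simp only [weyl] at this ⊢
        push_cast at this ⊢
        linarith
  induction b with
  | zero => exact hleft a
  | succ b ih =>
    rcases b with _ | b
    -- the step from `aω₁` to `aω₁ + ω₂` uses a pair of second kind
    · rcases a with _ | a
      · exact h01
      · have hk : IsSecondKind (a + 1, 0) (0, 1) :=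
          ⟨by simp [Wt.size], by simp, by simp⟩
        have e : plusPair (a + 1, 0) (0, 1) = ((a + 1, 1), 0) := plusPair_second hk
        obtain ⟨h1, -, -, h2⟩ := finite_F_second hk
        refine weyl_le_of_step e h2 ih h01 ?_
        have := weyl_second hk
        simp only [weyl] at this ⊢
        push_cast at this ⊢
        linarith
    · have hk : IsFirstKind (a, b + 1) (0, 1) :=
        ⟨by simp only [Wt.size]; omega, by simp, by simp⟩
      have e : plusPair (a, b + 1) (0, 1) = ((a, b + 1 + 1), 0) := plusPair_right hk Nat.one_pos
      have := (finrank_plus_zero e).1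
      obtain ⟨h1, h2⟩ := (isStrip_right hk rfl).finite_F
        (isKerPlus_right hk rfl Nat.one_pos)
      rw [finrank_bot_F, Nat.cast_zero, mul_zero, add_zero] at h2
      refine weyl_le_of_step e h2 ih h01 ?_
      have := weyl_identity_right a (b + 1) 0
      simp only [weyl] at this ⊢
      push_cast at this ⊢
      linarith

/-- Weyl's dimension formula for `sl₃`. -/
theorem two_mul_finrank_evV (ν : Wt) : 2 * (Module.finrank ℂ (EvV ν) : ℤ) = weyl ν.1 ν.2 :=
  le_antisymm (evV_le_weyl ν) (weyl_le_evV ν.1 ν.2)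

/-! ### The dimension formula for `F_{λ,μ}` -/

theorem four_mul_evV (lam mu : Wt) : weyl lam.1 lam.2 * weyl mu.1 mu.2 =
    4 * ((Module.finrank ℂ (EvV lam) * Module.finrank ℂ (EvV mu) : ℕ) : ℤ) := by
  rw [← two_mul_finrank_evV, ← two_mul_finrank_evV]
  push_cast
  ring

theorem weyl_le_finrank_F [Module.Finite ℂ (F lam mu)] :
    weyl lam.1 lam.2 * weyl mu.1 mu.2 ≤ 4 * (Module.finrank ℂ (F lam mu) : ℤ) := by
  have := finrank_mul_le (lam := lam) (mu := mu)
  rw [four_mul_evV]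
  omega

theorem finrank_F_le_of_fst_le (h : mu.size ≤ lam.size) (h1 : mu.1 ≤ lam.1) :
    Module.Finite ℂ (F lam mu) ∧
      4 * (Module.finrank ℂ (F lam mu) : ℤ) ≤ weyl lam.1 lam.2 * weyl mu.1 mu.2 := by
  rcases Nat.lt_or_ge lam.2 mu.2 with h2 | h2
  · exact finrank_F_le_of_second ⟨h, h1, h2⟩
  · exact finrank_F_le_of_first _ lam mu rfl ⟨h, h1, h2⟩

theorem weyl_comm (a b : ℤ) : weyl a b = weyl b a := by
  simp only [weyl]; ring

/-- If `λ₁ < μ₁`, then `|μ| ≤ |λ|` forces `μ₂ < λ₂`, and the diagram automorphism applies. -/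
theorem finrank_F_le_of_size_le (h : mu.size ≤ lam.size) :
    Module.Finite ℂ (F lam mu) ∧
      4 * (Module.finrank ℂ (F lam mu) : ℤ) ≤ weyl lam.1 lam.2 * weyl mu.1 mu.2 := by
  rcases Nat.lt_or_ge lam.1 mu.1 with h1 | h1
  · simp only [Wt.size] at h
    obtain ⟨h2, h3⟩ := finrank_F_le_of_fst_le (lam := (lam.2, lam.1)) (mu := (mu.2, mu.1))
      (by simp only [Wt.size]; omega) (by dsimp only; omega)
    obtain ⟨h4, h5⟩ := finrank_le_swap (lam := lam) (mu := mu)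
    refine ⟨h4, ?_⟩
    rw [weyl_comm lam.1, weyl_comm mu.1]
    dsimp only at h3
    omega
  · exact finrank_F_le_of_fst_le h h1

/-- The upper bound from the strips meets the lower bound from the fusion product. -/
theorem finrank_F (lam mu : Wt) : Module.Finite ℂ (F lam mu) ∧
    4 * (Module.finrank ℂ (F lam mu) : ℤ) = weyl lam.1 lam.2 * weyl mu.1 mu.2 := by
  have : Module.Finite ℂ (F lam mu) ∧
      4 * (Module.finrank ℂ (F lam mu) : ℤ) ≤ weyl lam.1 lam.2 * weyl mu.1 mu.2 := by
    rcases Nat.le_total mu.size lam.size with h | h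
    · exact finrank_F_le_of_size_le h
    · obtain ⟨h2, h3⟩ := finrank_F_le_of_size_le h
      obtain ⟨h4, h5⟩ := finrank_le_comm (lam := lam) (mu := mu)
      refine ⟨h4, ?_⟩
      rw [mul_comm (weyl lam.1 lam.2)]
      omega
  obtain ⟨h1, h2⟩ := this
  exact ⟨h1, le_antisymm h2 weyl_le_finrank_F⟩

instance finite_F (lam mu : Wt) : Module.Finite ℂ (F lam mu) := (finrank_F lam mu).1

theorem four_mul_finrank_plus {pr : Wt × Wt} (e : plusPair lam mu = pr) :
    4 * (Module.finrank ℂ (FPlus lam mu) : ℤ) = weyl pr.1.1 pr.1.2 * weyl pr.2.1 pr.2.2 := by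
  subst e
  exact (finrank_F _ _).2

/-! ### The filtrations -/

theorem IsStrip.two_mul_sum_eq {k m n : ℕ} {X Y : ℤ} {R : Submodule UCur (F lam mu)}
    (h : IsStrip lam mu k m n X Y R) :
    2 * ((∑ p ∈ rectSet k m X Y, Module.finrank ℂ (EvV (stripWt m X Y p)) : ℕ) : ℤ) =
      rectSum k m X Y := by
  rw [← h.sum_weyl, Nat.cast_sum, Finset.mul_sum]
  exact Finset.sum_congr rfl fun p _ => two_mul_finrank_evV _

instance finite_submodule (N : Submodule UCur (F lam mu)) : Module.Finite ℂ N :=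
  inferInstanceAs (Module.Finite ℂ (N.restrictScalars ℂ))

theorem filtration_right (h : IsFirstKind lam mu) (h1 : mu.1 = 0) (h2 : 0 < mu.2) :
    IsKerPlus lam mu (filtA lam mu (mu.2 - lam.1)) ∧
      ∀ j : ℕ, mu.2 - lam.1 ≤ j → j ≤ mu.2 →
        filtA lam mu (j + 1) ≤ filtA lam mu j ∧
        SumIso (fun _ : Unit => dom ((lam.1 : ℤ) - (mu.2 - 2 * j)) ((lam.2 : ℤ) - j)) mu.2
          (fun _ => w lam mu 0 (mu.2 - j) j) (filtA lam mu j) (filtA lam mu (j + 1)) := by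
  have hs := isStrip_right h h1
  have hK := isKerPlus_right h h1 h2
  refine ⟨?_, fun j hj hj' => ?_⟩
  · rw [filtA_eq h h1 le_rfl (by omega), stripFilt_eq_zero]
    · exact hK
    · intro p hp
      simp only [rectSet, Finset.mem_filter, Finset.mem_product, Finset.mem_range] at hp
      omega
  · rw [filtA_eq h h1 hj (by omega), filtA_eq h h1 (j := j + 1) (by omega) (by omega)]
    refine ⟨stripFilt_succ_le _ _ _ _, ?_⟩
    have heq : ∑ p ∈ rectSet 1 (mu.2 + 1) (lam.1 + 1) (lam.2 + 1),
        Module.finrank ℂ (EvV (stripWt (mu.2 + 1) (lam.1 + 1) (lam.2 + 1) p)) +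
        Module.finrank ℂ (⊥ : Submodule UCur (F lam mu)) ≤ Module.finrank ℂ
          (stripFilt (rectSet 1 (mu.2 + 1) (lam.1 + 1) (lam.2 + 1)) mu.2
            (⊥ : Submodule UCur (F lam mu)) 0) := by
      have e1 := hs.two_mul_sum_eq
      have e2 := hK.finite.2
      have e3 := (finrank_F lam mu).2
      have e4 := four_mul_finrank_plus (plusPair_right h h2)
      have e5 := weyl_identity_right lam.1 lam.2 (mu.2 - 1)
      rw [show mu.2 - 1 + 2 = mu.2 + 1 by omega] at e5
      have e6 : ((mu.2 - 1 : ℕ) : ℤ) + 1 = mu.2 := by omega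
      rw [e6] at e5
      rw [finrank_bot_F]
      rw [h1, Nat.cast_zero] at e3
      dsimp only at e4
      rw [h1, Nat.cast_zero, Nat.cast_add, Nat.cast_one] at e4
      omega
    have := hs.sumIso heq hj' (fun _ : Unit => (0, j)) (fun _ _ _ => rfl) (by
      intro p
      simp only [rectSet, Finset.mem_filter, Finset.mem_product, Finset.mem_range]
      constructor
      · rintro ⟨_, rfl⟩
        have hl := h.2.2
        dsimp only
        omega
      · intro hp
        exact ⟨(), Prod.ext (by dsimp only; omega) (by dsimp only; omega)⟩)
    convert this using 2
    rw [stripWt]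
    congr 1 <;> push_cast <;> ring

theorem filtration_left (h : IsFirstKind lam mu) (h1 : mu.2 = 0) (h2 : 0 < mu.1) :
    IsKerPlus lam mu (filtB lam mu (mu.1 - lam.2)) ∧
      ∀ j : ℕ, mu.1 - lam.2 ≤ j → j ≤ mu.1 →
        filtB lam mu (j + 1) ≤ filtB lam mu j ∧
        SumIso (fun _ : Unit => dom ((lam.1 : ℤ) - j) ((lam.2 : ℤ) - (mu.1 - 2 * j))) mu.1
          (fun _ => w lam mu j (mu.1 - j) 0) (filtB lam mu j) (filtB lam mu (j + 1)) := by
  have hs := isStrip_left h h1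
  have hK := isKerPlus_left h h1 h2
  refine ⟨?_, fun j hj hj' => ?_⟩
  · rw [filtB_eq h h1 le_rfl (by omega), stripFilt_eq_zero]
    · exact hK
    · intro p hp
      simp only [rectSet, Finset.mem_filter, Finset.mem_product, Finset.mem_range] at hp
      omega
  · rw [filtB_eq h h1 hj (by omega), filtB_eq h h1 (j := j + 1) (by omega) (by omega)]
    refine ⟨stripFilt_succ_le _ _ _ _, ?_⟩
    have heq : ∑ p ∈ rectSet (mu.1 + 1) 1 (lam.1 + 1) (lam.2 - mu.1 + 1),
        Module.finrank ℂ (EvV (stripWt 1 (lam.1 + 1) (lam.2 - mu.1 + 1) p)) +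
        Module.finrank ℂ (⊥ : Submodule UCur (F lam mu)) ≤ Module.finrank ℂ
          (stripFilt (rectSet (mu.1 + 1) 1 (lam.1 + 1) (lam.2 - mu.1 + 1)) mu.1
            (⊥ : Submodule UCur (F lam mu)) 0) := by
      have e1 := hs.two_mul_sum_eq
      have e2 := hK.finite.2
      have e3 := (finrank_F lam mu).2
      have e4 := four_mul_finrank_plus (plusPair_left (lam := lam) h1)
      have e5 := weyl_identity_left lam.1 lam.2 (mu.1 - 1)
      rw [show mu.1 - 1 + 2 = mu.1 + 1 by omega] at e5
      have e6 : ((mu.1 - 1 : ℕ) : ℤ) = mu.1 - 1 := by omega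
      rw [e6, sub_add_cancel, show (lam.2 : ℤ) - (mu.1 - 1) = lam.2 - mu.1 + 1 by ring] at e5
      rw [finrank_bot_F]
      rw [h1, Nat.cast_zero] at e3
      dsimp only at e4
      rw [h1, Nat.cast_zero, Nat.cast_add, Nat.cast_one, e6] at e4
      omega
    have := hs.sumIso heq hj' (fun _ : Unit => (j, 0)) (fun _ _ _ => rfl) (by
      intro p
      simp only [rectSet, Finset.mem_filter, Finset.mem_product, Finset.mem_range]
      constructor
      · rintro ⟨_, rfl⟩
        dsimp only
        have := h.2.1
        omega
      · intro hp
        exact ⟨(), Prod.ext (by dsimp only; omega) (by dsimp only; omega)⟩)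
    convert this using 2
    rw [stripWt]
    congr 1 <;> push_cast <;> ring

theorem filtration_first (h : IsFirstKind lam mu) (h2 : 0 < mu.2) :
    IsKerPlus lam mu (filtNinv lam mu 0) ∧
      (∀ j : ℕ, j < mu.size →
        filtNinv lam mu (j + 1) ≤ filtNinv lam mu j ∧
        SumIso (fun a : {a : ℕ × ℕ // a ∈ Sninv lam mu ∧ a.1 + a.2 = j} => wtNinv lam mu a)
          mu.size (fun a => w lam mu a.1.1 (mu.size - j) a.1.2)
          (filtNinv lam mu j) (filtNinv lam mu (j + 1))) ∧
      FIso (lam.1 + mu.2, lam.2 - mu.2) (mu.1, 0) mu.2 (w lam mu 0 0 mu.2)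
        (filtNinv lam mu mu.size) := by
  have hs := isStrip_first h
  have hK := isKerPlus_first h h2
  obtain ⟨φ, hφ1, hφ2, hφ3⟩ := exists_map_right h
  have e1 := hs.two_mul_sum_eq
  have e2 := hK.finite.2
  have e3 := (finrank_F lam mu).2
  have e4 := four_mul_finrank_plus (plusPair_right h h2)
  have e5 := weyl_identity_first lam.1 lam.2 mu.1 (mu.2 - 1)
  have e6 : ((mu.2 - 1 : ℕ) : ℤ) + 1 = mu.2 := by omega
  rw [show mu.2 - 1 + 1 = mu.2 by omega, e6] at e5
  have e7 := (finrank_F (lam.1 + mu.2, lam.2 - mu.2) (mu.1, 0)).2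
  have e8 := LinearMap.finrank_le_finrank_of_surjective (f := φ.restrictScalars ℂ) hφ3
  have e9 := hs.finite_zero.2
  dsimp only at e4 e7
  rw [Nat.cast_add, Nat.cast_one] at e4
  rw [Nat.cast_zero, Nat.cast_sub h.2.2, Nat.cast_add] at e7
  refine ⟨?_, fun j hj => ?_, ?_⟩
  · rw [filtNinv_eq]
    exact hK
  · rw [filtNinv_eq, filtNinv_eq]
    refine ⟨stripFilt_succ_le _ _ _ _, ?_⟩
    have := hs.sumIso (by omega) hj.le
      (fun a : {a : ℕ × ℕ // a ∈ Sninv lam mu ∧ a.1 + a.2 = j} => a.1)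
      Subtype.val_injective (fun p => ⟨?_, fun hp => ⟨⟨p, mem_Sninv.2 hp.1, hp.2⟩, rfl⟩⟩)
    · convert this using 2
      rw [stripWt, wtNinv]
      congr 1 <;> ring
    · rintro ⟨a, rfl⟩
      exact ⟨mem_Sninv.1 a.2.1, a.2.2⟩
  · have e : filtNinv lam mu mu.size = Submodule.span UCur {w lam mu 0 0 mu.2} := by
      rw [filtNinv_eq]
      refine le_antisymm (sup_le ?_ le_rfl) le_sup_right
      rw [Submodule.span_le]
      rintro _ ⟨p, hp, hpj, rfl⟩
      simp only [rectSet, Finset.mem_filter, Finset.mem_product, Finset.mem_range] at hp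
      simp only [Wt.size] at hpj
      omega
    rw [e]
    refine ⟨φ, hφ1, hφ2, ?_, hφ3⟩
    exact (LinearMap.injective_iff_surjective_of_finrank_eq_finrank (f := φ.restrictScalars ℂ)
      (by omega)).2 hφ3

theorem filtration_second (h : IsSecondKind lam mu) :
    IsKerPlus lam mu (filtInv lam mu 1 0) ∧
      ∀ l : ℕ, 1 ≤ l → l ≤ mu.2 - lam.2 → ∀ j : ℕ, j ≤ mu.1 + lam.2 →
        filtInvNext lam mu l j ≤ filtInv lam mu l j ∧
        SumIso (fun a : {a : ℕ × ℕ // a ∈ Sinv lam mu l ∧ a.1 + a.2 = j} => wtInv lam mu l a)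
          (mu.1 + lam.2 + l) (fun a => w lam mu a.1.1 (mu.1 + lam.2 + l - j) a.1.2)
          (filtInv lam mu l j) (filtInvNext lam mu l j) := by
  have hK := isKerPlus_second h
  rw [← filtInv_zero_eq] at hK
  refine ⟨hK, fun l hl hl' j hj => ?_⟩
  have hs := isStrip_second h hl hl'
  have e2 := hK.finite.2
  have e3 := (finrank_F lam mu).2
  have e4 := four_mul_finrank_plus (plusPair_second h)
  have e5 := weyl_second h
  have e1 : 2 * ((∑ l ∈ Finset.Ico 0 (mu.2 - lam.2), secondSum lam mu (l + 1) : ℕ) : ℤ) =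
      ∑ l ∈ Finset.range (mu.2 - lam.2),
        rectSum (mu.1 + 1) (lam.2 + 1) (lam.1 - l) (mu.2 - mu.1 - l) := by
    rw [Nat.cast_sum, Finset.mul_sum, Nat.Ico_zero_eq_range]
    refine Finset.sum_congr rfl fun l hl => ?_
    rw [Finset.mem_range] at hl
    refine (isStrip_second h (l := l + 1) (by omega) (by omega)).two_mul_sum_eq.trans ?_
    rw [show (lam.1 : ℤ) - ((l + 1 : ℕ) : ℤ) + 1 = lam.1 - l by push_cast; ring,
      show (mu.2 : ℤ) - mu.1 - ((l + 1 : ℕ) : ℤ) + 1 = mu.2 - mu.1 - l by push_cast; ring]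
  -- the total dimension is attained, so every strip contributes the full sum of its sources
  have hdown : ∀ i, i ≤ mu.2 - lam.2 → ∑ l ∈ Finset.Ico i (mu.2 - lam.2), secondSum lam mu (l + 1) ≤
      Module.finrank ℂ (filtInv lam mu (i + 1) 0) := by
    intro i
    induction i with
    | zero =>
      intro _
      dsimp only at e4
      rw [zero_add]
      omega
    | succ i ih =>
      intro hi
      have h1 := ih (by omega)
      rw [Finset.sum_eq_sum_Ico_succ_bot hi] at h1
      have h2 := (finite_second_step h (l := i + 1) (by omega) hi).2
      omega
  have hstep : secondSum lam mu l + Module.finrank ℂ (filtInv lam mu (l + 1) 0) ≤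
      Module.finrank ℂ (filtInv lam mu l 0) := by
    obtain ⟨i, rfl⟩ := Nat.exists_eq_add_of_le' hl
    have h1 := hdown i (by omega)
    rw [Finset.sum_eq_sum_Ico_succ_bot hl'] at h1
    have h2 := (finite_second h (i := i + 1) hl').2
    omega
  rw [filtInv_eq h hl hl' 0, filtInv_zero_eq] at hstep
  rw [filtInv_eq h hl hl', filtInvNext_eq h hl hl' hj]
  refine ⟨stripFilt_succ_le _ _ _ _, ?_⟩
  have := hs.sumIso hstep (by omega : j ≤ mu.1 + lam.2 + l)
    (fun a : {a : ℕ × ℕ // a ∈ Sinv lam mu l ∧ a.1 + a.2 = j} => a.1)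
    Subtype.val_injective (fun p => ⟨?_, fun hp => ⟨⟨p, mem_Sinv.2 hp.1, hp.2⟩, rfl⟩⟩)
  · convert this using 2
    rw [stripWt, wtInv]
    congr 1 <;> push_cast <;> ring
  · rintro ⟨a, rfl⟩
    exact ⟨mem_Sinv.1 a.2.1, a.2.2⟩

end

end SL3Current

theorem mainTheorem2 :
    -- first kind, `μ₁ = 0 < μ₂`
    (∀ lam mu : Wt, IsFirstKind lam mu → mu.1 = 0 → 0 < mu.2 →
      IsKerPlus lam mu (filtA lam mu (mu.2 - lam.1)) ∧
      ∀ j : ℕ, mu.2 - lam.1 ≤ j → j ≤ mu.2 →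
        filtA lam mu (j + 1) ≤ filtA lam mu j ∧
        SumIso (fun _ : Unit => dom ((lam.1 : ℤ) - (mu.2 - 2 * j)) ((lam.2 : ℤ) - j)) mu.2
          (fun _ => w lam mu 0 (mu.2 - j) j) (filtA lam mu j) (filtA lam mu (j + 1))) ∧
    -- first kind, `μ₂ = 0 < μ₁`
    (∀ lam mu : Wt, IsFirstKind lam mu → mu.2 = 0 → 0 < mu.1 →
      IsKerPlus lam mu (filtB lam mu (mu.1 - lam.2)) ∧
      ∀ j : ℕ, mu.1 - lam.2 ≤ j → j ≤ mu.1 →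
        filtB lam mu (j + 1) ≤ filtB lam mu j ∧
        SumIso (fun _ : Unit => dom ((lam.1 : ℤ) - j) ((lam.2 : ℤ) - (mu.1 - 2 * j))) mu.1
          (fun _ => w lam mu j (mu.1 - j) 0) (filtB lam mu j) (filtB lam mu (j + 1))) ∧
    -- first kind, `μ₁, μ₂ > 0`
    (∀ lam mu : Wt, IsFirstKind lam mu → 0 < mu.1 → 0 < mu.2 →
      IsKerPlus lam mu (filtNinv lam mu 0) ∧
      (∀ j : ℕ, j < mu.size →
        filtNinv lam mu (j + 1) ≤ filtNinv lam mu j ∧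
        SumIso (fun a : {a : ℕ × ℕ // a ∈ Sninv lam mu ∧ a.1 + a.2 = j} => wtNinv lam mu a)
          mu.size (fun a => w lam mu a.1.1 (mu.size - j) a.1.2)
          (filtNinv lam mu j) (filtNinv lam mu (j + 1))) ∧
      FIso (lam.1 + mu.2, lam.2 - mu.2) (mu.1, 0) mu.2 (w lam mu 0 0 mu.2)
        (filtNinv lam mu mu.size)) ∧
    -- second kind
    (∀ lam mu : Wt, IsSecondKind lam mu →
      IsKerPlus lam mu (filtInv lam mu 1 0) ∧
      ∀ l : ℕ, 1 ≤ l → l ≤ mu.2 - lam.2 → ∀ j : ℕ, j ≤ mu.1 + lam.2 →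
        filtInvNext lam mu l j ≤ filtInv lam mu l j ∧
        SumIso (fun a : {a : ℕ × ℕ // a ∈ Sinv lam mu l ∧ a.1 + a.2 = j} => wtInv lam mu l a)
          (mu.1 + lam.2 + l) (fun a => w lam mu a.1.1 (mu.1 + lam.2 + l - j) a.1.2)
          (filtInv lam mu l j) (filtInvNext lam mu l j)) ∧
    -- the dimension formula
    (∀ lam mu : Wt, Module.Finite ℂ (F lam mu) ∧
      Module.finrank ℂ (F lam mu) = Module.finrank ℂ (V lam) * Module.finrank ℂ (V mu)) := by
  refine ⟨fun lam mu h h1 h2 => filtration_right h h1 h2,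
    fun lam mu h h1 h2 => filtration_left h h1 h2,
    fun lam mu h _ h2 => filtration_first h h2, fun lam mu h => filtration_second h,
    fun lam mu => ⟨(finrank_F lam mu).1, ?_⟩⟩
  have h1 := (finrank_F lam mu).2
  rw [four_mul_evV] at h1
  rw [← finrank_evV, ← finrank_evV]
  omega
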